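/- Let $k$ be a field of characteristic $0$ and let $\mathcal V$ be the category of quasi-projective $k$-schemes (separated, of finite type, carrying an ample line bundle). Write $pt=\operatorname{Spec}k$; for morphisms in $\mathcal V$, proper and projective mean the same. **The Lazard ring.** $\mathbb L$ is the coefficient ring of the universal commutative formal group law $F_{\mathbb L}(u,v)=\sum a_{ij}u^iv^j$. **The theory $\mathbb{OB}$.** A *bivariant cobordism cycle* for $f:X\to Y$ in $\mathcal V$ is $(h:W\to X;L_1,\dots,L_r)$ with $W\in\mathcal V$, $h$ projective, $f\circ h$ smooth and $L_1,\dots,L_r$ ($r\ge 0$) line bundles on $W$. Two cycles $(h:W\to X;L_1,\dots,L_r)$ and $(h':W'\to X;L_1',\dots,L_r')$ are identified if there is an isomorphism $g:W\to W'$ with $h=h'\circ g$ such that $g^*L_1',\dots,g^*L_r'$ are, up to order, isomorphic to $L_1,\dots,L_r$. $\mathbb{OB}(X\xrightarrow{f}Y)$ is the free abelian group on the classes $[h:W\to X;L_1,\dots,L_r]_f$. It has * pushforwards $f'_*:\mathbb{OB}(X'\xrightarrow{ff'}Y)\to\mathbb{OB}(X\xrightarrow{f}Y)$ for $f':X'\to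 X$ proper, by composing $h$ with $f'$; * pullbacks $g^*:\mathbb{OB}(Z'\to Z)\to\mathbb{OB}(Z'\times_ZY\to Y)$ for $g:Y\to Z$, by base change; * operators $\widetilde{c_1}(L)[h:W\to X;L_1,\dots,L_r]_f=[h:W\to X;L_1,\dots,L_r,h^*L]_f$ for $L$ a line bundle on $X$. If $X$ is smooth over $k$ and $f$ is smooth, $[X\xrightarrow{f}Y]:=[\mathrm{id}:X\to X]_f$. *Imposing* a family of relations $\mathcal R(Z'\xrightarrow{z}Z)$ on such a theory means dividing its value at $f:X\to Y$ by the subgroup generated by all $f'_*\,\widetilde{c_1}(L_1)\cdots\widetilde{c_1}(L_r)\,g^*\rho$, where $z:Z'\to Z$ is in $\mathcal V$, $\rho\in\mathcal R(Z'\xrightarrow{z}Z)$, $g:Y\to Z$ is smooth and equidimensional, $X'=Z'\times_ZY$, the projection $X'\to Y$ factors as $f\circ f'$ with $f':X'\to X$ proper, and $L_1,\dots,L_r$ are line bundles on $X'$. **The theory $\mathbb{OB}1$.** Impose successively: 1. (Dimension) on $\mathbb{OB}$: $\widetilde{c_1}(L_1)\cdots\widetilde{c_1}(L_r)[X\xrightarrow{f}Y]$,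 for $X$ smooth over $k$, $f$ smooth, $L_i$ line bundles on $X$, $r>\dim X$; 2. (Section) on the result: $\widetilde{c_1}(L)[X\xrightarrow{f}Y]-i_*[Z\xrightarrow{fi}Y]$, for $X$ smooth over $k$, $f$ smooth, $L$ a line bundle on $X$, $s$ a section of $L$ transverse to the zero section (that is, $s$ is locally a non-zero-divisor and its zero scheme is smooth over $k$), $i:Z\to X$ the inclusion of its zero scheme, $fi$ smooth. Call the result $\underline\Omega_*(X\xrightarrow{f}Y)$; 3. (Formal group law) on $\mathbb L\otimes_{\mathbb Z}\underline\Omega_*$: the $\mathbb L$-multiples of $\big(F_{\mathbb L}(\widetilde{c_1}(L_1),\widetilde{c_1}(L_2))-\widetilde{c_1}(L_1\otimes L_2)\big)\alpha$, for $f:X\to Y$ with $X$ smooth over $k$, $L_1,L_2$ line bundles on $X$, and $\alpha\in\underline\Omega_*(X\xrightarrow{f}Y)$ with $\widetilde{c_1}(L_1)^i\widetilde{c_1}(L_2)^j\alpha=0$ for $i+j\gg0$. The result is $\mathbb{OB}1(X\xrightarrow{f}Y)$. Put $\mathbb{OB}1_*(X):=\mathbb{OB}1(X\to pt)$; it has pushforwards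 along proper morphisms. **Algebraic bordism.** $\mathcal Z_*(X)$ is the free abelian group on isomorphism classes of cobordism cycles $[h:V\to X;L_1,\dots,L_r]$, with $V\in\mathcal V$ smooth over $k$ and integral, $h$ projective, $L_i$ line bundles on $V$, and isomorphism as above. It has pushforwards along proper morphisms, operators $\widetilde{c_1}(L)$, and pullbacks along smooth equidimensional morphisms, given by base change; the class of a cycle with smooth but disconnected source is the sum of its restrictions to the connected components. Imposing relations $\mathcal R$ means dividing the group of $X$ by the subgroup generated by all $f_*\widetilde{c_1}(L_1)\cdots\widetilde{c_1}(L_r)g^*\rho$ with $f:Y\to X$ proper, $L_i$ line bundles on $Y$, $g:Y\to W$ smooth and equidimensional, $\rho\in\mathcal R(W)$. Impose successively: $[V\to X;L_1,\dots,L_r]$ for $X$ smooth and $r>\dim V$; then $[V\xrightarrow{h}X;L_1,\dots,L_r,L]-[Z\xrightarrow{hi}X;i^*L_1,\dots,i^*L_r]$, with $i:Z\to V$ the zero scheme of a section of $L$ transverse to the zero section; and, after tensoring with $\mathbb L$, the $\mathbb L$-multiples of $\big(F_{\mathbb L}(\widetilde{c_1}(L_1),\widetilde{c_1}(L_2))-\widetilde{c_1}(L_1\otimes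 L_2)\big)\alpha$ for $X$ smooth and $\alpha$ with $\widetilde{c_1}(L_1)^i\widetilde{c_1}(L_2)^j\alpha=0$ for $i+j\gg0$. The result is $\Omega_*(X)$. **Claim.** $\mathbb{OB}1_*$ is a covariant theory: its pushforwards along proper morphisms are functorial, that is, $(\mathrm{id}_X)_*=\mathrm{id}$ and $(g\circ f)_*=g_*\circ f_*$. For every $X\in\mathcal V$ there is an isomorphism of abelian groups, indeed of $\mathbb L$-modules, $$\mathbb{OB}1_*(X)\;\cong\;\Omega_*(X).$$ These isomorphisms can be chosen so that each sends the class $[h:V\to X;L_1,\dots,L_r]$ of every cobordism cycle with $V$ smooth and integral to the class of the same cycle, and so that they commute with pushforward along all proper morphisms. -/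

import Mathlib

open CategoryTheory AlgebraicGeometry TopologicalSpace
open scoped TensorProduct

universe u

noncomputable section

namespace Bordism

/-! ### Line bundles on schemes, by transition functions -/

/-- Restriction of regular functions. -/
def res {X : Scheme.{u}} {U V : X.Opens} (h : V ≤ U) : Γ(X, U) →+* Γ(X, V) :=
  (X.presheaf.map (homOfLE h).op).hom

theorem res_res {X : Scheme.{u}} {U V W : X.Opens} (h : V ≤ U) (h' : W ≤ V) (a : Γ(X, U)) :
    res h' (res h a) = res (h'.trans h) a := by
  simp only [res, ← CommRingCat.comp_apply, ← Functor.map_comp]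
  rfl

theorem res_self {X : Scheme.{u}} {U : X.Opens} (h : U ≤ U) (a : Γ(X, U)) : res h a = a := by
  have : (homOfLE h).op = 𝟙 _ := rfl
  rw [res, this, X.presheaf.map_id]
  rfl

theorem app_res {X Y : Scheme.{u}} (f : Y ⟶ X) {U V : X.Opens} (h : V ≤ U) (a : Γ(X, U)) :
    (f.app V).hom (res h a) = res (f.preimage_mono h) ((f.app U).hom a) := by
  simp only [res, ← CommRingCat.comp_apply]
  rw [f.naturality]
  rfl

/-- A line bundle on `X`, given by a trivialising open neighbourhood of each point and transition
functions satisfying the cocycle condition. -/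
structure LineBundle (X : Scheme.{u}) where
  nbhd : X → X.Opens
  mem_nbhd : ∀ x, x ∈ nbhd x
  trans : ∀ x y, Γ(X, nbhd x ⊓ nbhd y)
  trans_self : ∀ x, trans x x = 1
  cocycle : ∀ (x y z : X) (V : X.Opens) (hxy : V ≤ nbhd x ⊓ nbhd y) (hyz : V ≤ nbhd y ⊓ nbhd z)
    (hxz : V ≤ nbhd x ⊓ nbhd z),
    res hxy (trans x y) * res hyz (trans y z) = res hxz (trans x z)

namespace LineBundle

variable {X Y Z : Scheme.{u}}

/-- Isomorphism of line bundles: units on a common refinement of the two trivialising covers,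
intertwining the transition functions. -/
def Iso (L M : LineBundle X) : Prop :=
  ∃ (N : X → X.Opens) (_ : ∀ x, x ∈ N x) (hL : ∀ x, N x ≤ L.nbhd x) (hM : ∀ x, N x ≤ M.nbhd x)
    (c : ∀ x, (Γ(X, N x))ˣ), ∀ x y,
      res inf_le_left (c x).1 * res (inf_le_inf (hM x) (hM y)) (M.trans x y) =
        res (inf_le_inf (hL x) (hL y)) (L.trans x y) * res inf_le_right (c y).1

theorem Iso.refl (L : LineBundle X) : L.Iso L :=
  ⟨L.nbhd, L.mem_nbhd, fun _ => le_rfl, fun _ => le_rfl, fun _ => 1, fun x y => by simp⟩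

theorem Iso.symm {L M : LineBundle X} (h : L.Iso M) : M.Iso L := by
  obtain ⟨N, hN, hL, hM, c, hc⟩ := h
  refine ⟨N, hN, hM, hL, fun x => (c x)⁻¹, fun x y => ?_⟩
  have h1 : res (inf_le_left : N x ⊓ N y ≤ N x) (c x).1 * res inf_le_left ((c x)⁻¹).1 = 1 := by
    rw [← map_mul, Units.mul_inv, map_one]
  have h2 : res (inf_le_right : N x ⊓ N y ≤ N y) (c y).1 * res inf_le_right ((c y)⁻¹).1 = 1 := by
    rw [← map_mul, Units.mul_inv, map_one]
  have h3 := hc x y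
  generalize res (inf_le_left : N x ⊓ N y ≤ N x) (c x).1 = a at *
  generalize res (inf_le_left : N x ⊓ N y ≤ N x) ((c x)⁻¹).1 = a' at *
  generalize res (inf_le_right : N x ⊓ N y ≤ N y) (c y).1 = b at *
  generalize res (inf_le_right : N x ⊓ N y ≤ N y) ((c y)⁻¹).1 = b' at *
  generalize res _ (M.trans x y) = m at *
  generalize res _ (L.trans x y) = l at *
  linear_combination (-a' * b') * h3 + (b' * m) * h1 - (a' * l) * h2

theorem Iso.trans {L M P : LineBundle X} (h : L.Iso M) (h' : M.Iso P) : L.Iso P := by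
  obtain ⟨N, hN, hL, hM, c, hc⟩ := h
  obtain ⟨N', hN', hM', hP, c', hc'⟩ := h'
  refine ⟨fun x => N x ⊓ N' x, fun x => ⟨hN x, hN' x⟩, fun x => inf_le_left.trans (hL x),
    fun x => inf_le_right.trans (hP x),
    fun x => Units.map (res inf_le_left).toMonoidHom (c x) *
      Units.map (res inf_le_right).toMonoidHom (c' x), fun x y => ?_⟩
  have e1 := congrArg (res (inf_le_inf inf_le_left inf_le_left :
    (N x ⊓ N' x) ⊓ (N y ⊓ N' y) ≤ N x ⊓ N y)) (hc x y)
  have e2 := congrArg (res (inf_le_inf inf_le_right inf_le_right :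
    (N x ⊓ N' x) ⊓ (N y ⊓ N' y) ≤ N' x ⊓ N' y)) (hc' x y)
  simp only [map_mul, res_res, Units.val_mul, Units.coe_map, RingHom.toMonoidHom_eq_coe,
    MonoidHom.coe_coe] at e1 e2 ⊢
  linear_combination (res _ (c' y).1) * e1 + (res _ (c x).1) * e2

instance setoid (X : Scheme.{u}) : Setoid (LineBundle X) :=
  ⟨Iso, Iso.refl, Iso.symm, Iso.trans⟩

/-- The trivial line bundle. -/
def trivial (X : Scheme.{u}) : LineBundle X where
  nbhd _ := ⊤
  mem_nbhd _ := _root_.trivial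
  trans _ _ := 1
  trans_self _ := rfl
  cocycle _ _ _ _ _ _ _ := by simp

/-- The tensor product of two line bundles. -/
def tensor (L M : LineBundle X) : LineBundle X where
  nbhd x := L.nbhd x ⊓ M.nbhd x
  mem_nbhd x := ⟨L.mem_nbhd x, M.mem_nbhd x⟩
  trans x y := res (inf_le_inf inf_le_left inf_le_left) (L.trans x y) *
    res (inf_le_inf inf_le_right inf_le_right) (M.trans x y)
  trans_self x := by simp [L.trans_self, M.trans_self]
  cocycle x y z V hxy hyz hxz := by
    have e1 := L.cocycle x y z V (hxy.trans (inf_le_inf inf_le_left inf_le_left))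
      (hyz.trans (inf_le_inf inf_le_left inf_le_left))
      (hxz.trans (inf_le_inf inf_le_left inf_le_left))
    have e2 := M.cocycle x y z V (hxy.trans (inf_le_inf inf_le_right inf_le_right))
      (hyz.trans (inf_le_inf inf_le_right inf_le_right))
      (hxz.trans (inf_le_inf inf_le_right inf_le_right))
    simp only [map_mul, res_res]
    rw [← e1, ← e2]
    ring

/-- The tensor power `L^{⊗ n}`. -/
def pow (L : LineBundle X) (n : ℕ) : LineBundle X where
  nbhd := L.nbhd
  mem_nbhd := L.mem_nbhd
  trans x y := L.trans x y ^ n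
  trans_self x := by simp [L.trans_self]
  cocycle x y z V hxy hyz hxz := by
    simp only [map_pow, ← mul_pow, L.cocycle x y z V hxy hyz hxz]

/-- The pullback of a line bundle along a morphism. -/
def pull (f : Y ⟶ X) (L : LineBundle X) : LineBundle Y where
  nbhd y := f ⁻¹ᵁ L.nbhd (f y)
  mem_nbhd y := L.mem_nbhd (f y)
  trans y z := (f.app (L.nbhd (f y) ⊓ L.nbhd (f z))).hom (L.trans (f y) (f z))
  trans_self y := by
    rw [L.trans_self (f y)]
    exact map_one _
  cocycle x y z V hxy hyz hxz := by
    let A := L.nbhd (f x) ⊓ L.nbhd (f y) ⊓ L.nbhd (f z)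
    have hA : V ≤ f ⁻¹ᵁ A := le_inf hxy (hyz.trans inf_le_right)
    have h1 : A ≤ L.nbhd (f x) ⊓ L.nbhd (f y) := inf_le_left
    have h2 : A ≤ L.nbhd (f y) ⊓ L.nbhd (f z) := inf_le_inf inf_le_right le_rfl
    have h3 : A ≤ L.nbhd (f x) ⊓ L.nbhd (f z) := inf_le_inf inf_le_left le_rfl
    have e := congrArg (fun t => res hA ((f.app A).hom t))
      (L.cocycle (f x) (f y) (f z) A h1 h2 h3)
    simp only [map_mul, app_res, res_res] at e
    exact e

theorem res_tensor (L M : LineBundle X) (x y : X) (V : X.Opens)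
    (h : V ≤ (L.tensor M).nbhd x ⊓ (L.tensor M).nbhd y) :
    res h ((L.tensor M).trans x y) =
      res (h.trans (inf_le_inf inf_le_left inf_le_left)) (L.trans x y) *
        res (h.trans (inf_le_inf inf_le_right inf_le_right)) (M.trans x y) := by
  exact (map_mul (res h) _ _).trans (congrArg₂ (· * ·) (res_res _ _ _) (res_res _ _ _))

theorem tensor_congr {L L' M M' : LineBundle X} (h : L.Iso L') (h' : M.Iso M') :
    (L.tensor M).Iso (L'.tensor M') := by
  obtain ⟨N, hN, hL, hM, c, hc⟩ := h
  obtain ⟨N', hN', hL', hM', c', hc'⟩ := h'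
  refine ⟨fun x => N x ⊓ N' x, fun x => ⟨hN x, hN' x⟩, fun x => inf_le_inf (hL x) (hL' x),
    fun x => inf_le_inf (hM x) (hM' x),
    fun x => Units.map (res inf_le_left).toMonoidHom (c x) *
      Units.map (res inf_le_right).toMonoidHom (c' x), fun x y => ?_⟩
  have e1 := congrArg (res (inf_le_inf inf_le_left inf_le_left :
    (N x ⊓ N' x) ⊓ (N y ⊓ N' y) ≤ N x ⊓ N y)) (hc x y)
  have e2 := congrArg (res (inf_le_inf inf_le_right inf_le_right :
    (N x ⊓ N' x) ⊓ (N y ⊓ N' y) ≤ N' x ⊓ N' y)) (hc' x y)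
  simp only [map_mul, res_res, Units.val_mul, Units.coe_map, RingHom.toMonoidHom_eq_coe,
    MonoidHom.coe_coe, res_tensor] at e1 e2 ⊢
  linear_combination (res _ (c' x).1 * res _ (M'.trans x y)) * e1 +
    (res _ (L.trans x y) * res _ (c y).1) * e2

theorem pull_congr (f : Y ⟶ X) {L L' : LineBundle X} (h : L.Iso L') :
    (pull f L).Iso (pull f L') := by
  obtain ⟨N, hN, hL, hM, c, hc⟩ := h
  refine ⟨fun y => f ⁻¹ᵁ N (f y), fun y => hN (f y), fun y => f.preimage_mono (hL (f y)),
    fun y => f.preimage_mono (hM (f y)),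
    fun y => Units.map (f.app (N (f y))).hom.toMonoidHom (c (f y)), fun x y => ?_⟩
  have e := congrArg (f.app (N (f x) ⊓ N (f y))).hom (hc (f x) (f y))
  simp only [map_mul, app_res] at e
  exact e

theorem pull_id (L : LineBundle X) : (pull (𝟙 X) L).Iso L :=
  ⟨L.nbhd, L.mem_nbhd, fun _ => le_rfl, fun _ => le_rfl, fun _ => 1, fun x y => by
    simp [pull]; rfl⟩

theorem pull_comp (f : Y ⟶ X) (g : Z ⟶ Y) (L : LineBundle X) :
    (pull (g ≫ f) L).Iso (pull g (pull f L)) :=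
  ⟨(pull (g ≫ f) L).nbhd, (pull (g ≫ f) L).mem_nbhd, fun _ => le_rfl, fun _ => le_rfl, fun _ => 1,
    fun x y => by
      rw [Units.val_one, Units.val_one, map_one, map_one, one_mul, mul_one]
      rfl⟩

/-- A global section of a line bundle. -/
structure Sec (L : LineBundle X) where
  val : ∀ x, Γ(X, L.nbhd x)
  compat : ∀ x y, res inf_le_left (val x) = L.trans x y * res inf_le_right (val y)

/-- The open locus where a section generates the line bundle. -/
def Sec.locus {L : LineBundle X} (s : L.Sec) : X.Opens := ⨆ x, X.basicOpen (s.val x)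

/-- `L` is ample: the affine loci of non-vanishing of sections of positive powers of `L`
cover `X`. -/
def IsAmple (L : LineBundle X) : Prop :=
  ∀ x : X, ∃ n : ℕ, 0 < n ∧ ∃ s : (L.pow n).Sec, x ∈ s.locus ∧ IsAffineOpen s.locus

/-- The closed immersion `i : Z ⟶ X` is the zero scheme of the section `s`: its ideal sheaf is
locally generated by `s`. -/
def Sec.IsZeroScheme {L : LineBundle X} (s : L.Sec) (i : Z ⟶ X) : Prop :=
  IsClosedImmersion i ∧ ∀ (x : X) (V : X.affineOpens) (h : V.1 ≤ L.nbhd x),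
    i.ker.ideal V = Ideal.span {res h (s.val x)}

/-- The section `s` is regular: locally, it is not a zero divisor. -/
def Sec.IsRegular {L : LineBundle X} (s : L.Sec) : Prop :=
  ∀ (x : X) (V : X.affineOpens) (h : V.1 ≤ L.nbhd x),
    res h (s.val x) ∈ nonZeroDivisors Γ(X, V.1)

theorem Sec.mem_locus {L : LineBundle X} (s : L.Sec) (x y : X) (hx : x ∈ L.nbhd y) :
    x ∈ s.locus ↔ x ∈ X.basicOpen (s.val y) := by
  refine ⟨fun h => ?_, fun h => Opens.mem_iSup.2 ⟨y, h⟩⟩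
  obtain ⟨z, hz⟩ := Opens.mem_iSup.1 h
  have hz' : x ∈ L.nbhd z := X.basicOpen_le _ hz
  have h1 : x ∈ X.basicOpen (res (inf_le_left : L.nbhd z ⊓ L.nbhd y ≤ _) (s.val z)) := by
    rw [res, X.basicOpen_res]
    exact ⟨⟨hz', hx⟩, hz⟩
  rw [s.compat, Scheme.basicOpen_mul] at h1
  have h2 := h1.2
  rw [res, X.basicOpen_res] at h2
  exact h2.2


/-- Ample line bundles pull back to ample line bundles along affine morphisms. -/
theorem IsAmple.pull {L : LineBundle X} (h : L.IsAmple) (f : Y ⟶ X) [IsAffineHom f] :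
    (pull f L).IsAmple := fun y => by
  obtain ⟨n, hn, s, hs, ha⟩ := h (f y)
  let t : ((LineBundle.pull f L).pow n).Sec :=
    { val := fun z => (f.app (L.nbhd (f z))).hom (s.val (f z))
      compat := fun z w => by
        have e := congrArg (f.app (L.nbhd (f z) ⊓ L.nbhd (f w))).hom (s.compat (f z) (f w))
        refine (app_res f _ _).symm.trans (e.trans ((map_mul _ _ _).trans ?_))
        exact congrArg₂ (· * ·) (map_pow (f.app (L.nbhd (f z) ⊓ L.nbhd (f w))).hom _ n)
          (app_res f _ _) }
  have ht : t.locus = f ⁻¹ᵁ s.locus := by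
    ext z
    have h1 := t.mem_locus z z ((LineBundle.pull f L).mem_nbhd z)
    have h2 := s.mem_locus (f z) (f z) (L.mem_nbhd (f z))
    have h3 : Y.basicOpen (t.val z) = f ⁻¹ᵁ X.basicOpen (s.val (f z)) :=
      (Scheme.preimage_basicOpen f _).symm
    rw [h3] at h1
    exact h1.trans h2.symm
  refine ⟨n, hn, t, ?_, ?_⟩
  · rw [ht]
    exact hs
  · rw [ht]
    exact ha.preimage f

end LineBundle

/-- The set of isomorphism classes of line bundles on `X`. -/
def Pic (X : Scheme.{u}) : Type u := Quotient (LineBundle.setoid X)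

namespace Pic

variable {X Y Z : Scheme.{u}}

/-- The tensor product of isomorphism classes of line bundles. -/
def tensor : Pic X → Pic X → Pic X :=
  Quotient.map₂ LineBundle.tensor fun _ _ h _ _ h' => LineBundle.tensor_congr h h'

/-- Pullback of isomorphism classes of line bundles. -/
def pull (f : Y ⟶ X) : Pic X → Pic Y :=
  Quotient.map (LineBundle.pull f) fun _ _ h => LineBundle.pull_congr f h

theorem pull_id (L : Pic X) : pull (𝟙 X) L = L := by
  induction L using Quotient.inductionOn with
  | _ L => exact Quotient.sound (LineBundle.pull_id L)

theorem pull_comp (f : Y ⟶ X) (g : Z ⟶ Y) (L : Pic X) : pull (g ≫ f) L = pull g (pull f L) := by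
  induction L using Quotient.inductionOn with
  | _ L => exact Quotient.sound (LineBundle.pull_comp f g L)

end Pic

/-! ### Quasi-projective schemes over a field -/

/-- A scheme over `k` is quasi-projective if it is separated, of finite type and carries an ample
line bundle. -/
structure IsQuasiProjective {k : Type u} [Field k] (X : Over (Spec (.of k))) : Prop where
  locallyOfFiniteType : LocallyOfFiniteType X.hom
  quasiCompact : QuasiCompact X.hom
  isSeparated : IsSeparated X.hom
  exists_ample : ∃ L : LineBundle X.left, L.IsAmple

/-- The category of quasi-projective schemes over `k`. -/
abbrev QProj (k : Type u) [Field k] : Type (u + 1) :=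
  ObjectProperty.FullSubcategory (C := Over (Spec (.of k))) IsQuasiProjective

variable {k : Type u} [Field k]

/-- The underlying scheme. -/
abbrev QProj.sch (X : QProj k) : Scheme.{u} := X.obj.left

/-- The structure morphism. -/
abbrev QProj.str (X : QProj k) : X.sch ⟶ Spec (.of k) := X.obj.hom

/-- The underlying morphism of schemes. -/
abbrev QProj.mor {X Y : QProj k} (f : X ⟶ Y) : X.sch ⟶ Y.sch := f.hom.left

open QProj

theorem QProj.mor_str {X Y : QProj k} (f : X ⟶ Y) : mor f ≫ Y.str = X.str := Over.w f.hom

/-- The morphism of quasi-projective schemes given by a morphism over `k`. -/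
def QProj.homMk {X Y : QProj k} (f : X.sch ⟶ Y.sch) (h : f ≫ Y.str = X.str) : X ⟶ Y :=
  ObjectProperty.homMk (Over.homMk f h)

theorem isQuasiProjective_of_isClosedImmersion (X : QProj k) {Y : Scheme.{u}} (i : Y ⟶ X.sch)
    [IsClosedImmersion i] : IsQuasiProjective (Over.mk (i ≫ X.str)) := by
  obtain ⟨h1, h2, h3, L, hL⟩ := X.property
  exact ⟨inferInstanceAs (LocallyOfFiniteType (i ≫ X.str)),
    inferInstanceAs (QuasiCompact (i ≫ X.str)), inferInstanceAs (IsSeparated (i ≫ X.str)),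
    LineBundle.pull i L, hL.pull i⟩

/-- The point `Spec k`. -/
def pt (k : Type u) [Field k] : QProj k :=
  ⟨Over.mk (𝟙 (Spec (.of k))), inferInstanceAs (LocallyOfFiniteType (𝟙 (Spec (.of k)))),
    inferInstanceAs (QuasiCompact (𝟙 (Spec (.of k)))),
    inferInstanceAs (IsSeparated (𝟙 (Spec (.of k)))), LineBundle.trivial _, fun x => by
      let s : ((LineBundle.trivial (Spec (.of k))).pow 1).Sec :=
        { val := fun _ => 1
          compat := fun x y => by
            rw [map_one, map_one, mul_one]
            exact (one_pow 1).symm }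
      have hs : s.locus = ⊤ := by
        refine top_le_iff.1 (le_iSup_of_le x ?_)
        exact ((Spec (.of k)).basicOpen_of_isUnit isUnit_one).ge
      exact ⟨1, one_pos, s, hs ▸ trivial, hs ▸ isAffineOpen_top (Spec (.of k))⟩⟩

/-- The structure morphism to the point. -/
def toPt (X : QProj k) : X ⟶ pt k := homMk X.str (Category.comp_id _)

theorem isAffineOpen_preimage_inf {W V Z P : Scheme.{u}} {p : P ⟶ W} {q : P ⟶ V} {a : W ⟶ Z}
    {b : V ⟶ Z} (sq : IsPullback p q a b) (c : Z ⟶ Spec (.of k)) [IsSeparated c] {A : W.Opens}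
    {B : V.Opens} (hA : IsAffineOpen A) (hB : IsAffineOpen B) :
    IsAffineOpen (p ⁻¹ᵁ A ⊓ q ⁻¹ᵁ B) := by
  have : IsAffine A := hA
  have : IsAffineHom ((A.ι ≫ a) ≫ c) := isAffineHom_of_isAffine _
  have : IsAffineHom (A.ι ≫ a) := IsAffineHom.of_comp _ c
  have sq1 := (isPullback_morphismRestrict p A).flip.paste_horiz sq.flip
  have : IsAffineHom ((p ⁻¹ᵁ A).ι ≫ q) :=
    MorphismProperty.of_isPullback (P := @IsAffineHom) sq1.flip inferInstance
  have h := (hB.preimage ((p ⁻¹ᵁ A).ι ≫ q)).image_of_isOpenImmersion (p ⁻¹ᵁ A).ι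
  convert! h using 1
  ext z
  simp only [SetLike.mem_coe, Opens.mem_inf, Scheme.Hom.mem_preimage]
  exact ⟨fun h => ⟨⟨z, h.1⟩, h.2, rfl⟩, by rintro ⟨⟨x, hx⟩, h, rfl⟩; exact ⟨hx, h⟩⟩

/-- Schemes that are fibre products of quasi-projective schemes are quasi-projective. -/
theorem isQuasiProjective_of_isPullback {W V Z : QProj k} {P : Scheme.{u}} {p : P ⟶ W.sch}
    {q : P ⟶ V.sch} {a : W ⟶ Z} {b : V ⟶ Z} (sq : IsPullback p q (mor a) (mor b)) :
    IsQuasiProjective (Over.mk (p ≫ W.str)) := by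
  obtain ⟨w1, w2, w3, L, hL⟩ := W.property
  obtain ⟨v1, v2, v3, M, hM⟩ := V.property
  obtain ⟨z1, z2, z3, -⟩ := Z.property
  have b1 : LocallyOfFiniteType (mor b ≫ Z.str) := by rwa [mor_str]
  have b2 : QuasiCompact (mor b ≫ Z.str) := by rwa [mor_str]
  have b3 : IsSeparated (mor b ≫ Z.str) := by rwa [mor_str]
  have c1 : LocallyOfFiniteType (mor b) := locallyOfFiniteType_of_comp _ Z.str
  have c2 : QuasiCompact (mor b) := QuasiCompact.of_comp _ Z.str
  have c3 : IsSeparated (mor b) := IsSeparated.of_comp _ Z.str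
  have p1 : LocallyOfFiniteType p := MorphismProperty.of_isPullback sq.flip c1
  have p2 : QuasiCompact p := MorphismProperty.of_isPullback sq.flip c2
  have p3 : IsSeparated p := MorphismProperty.of_isPullback sq.flip c3
  refine ⟨inferInstanceAs (LocallyOfFiniteType (p ≫ W.str)),
    inferInstanceAs (QuasiCompact (p ≫ W.str)), inferInstanceAs (IsSeparated (p ≫ W.str)),
    (L.pull p).tensor (M.pull q), fun z => ?_⟩
  obtain ⟨n, hn, s, hs, hsa⟩ := hL (p z)
  obtain ⟨m, hm, t, ht, hta⟩ := hM (q z)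
  let A (y : P) : P.Opens := p ⁻¹ᵁ L.nbhd (p y)
  let B (y : P) : P.Opens := q ⁻¹ᵁ M.nbhd (q y)
  let s' (y : P) : Γ(P, A y) := (p.app (L.nbhd (p y))).hom (s.val (p y))
  let t' (y : P) : Γ(P, B y) := (q.app (M.nbhd (q y))).hom (t.val (q y))
  let G (y y' : P) : Γ(P, A y ⊓ A y') := (L.pull p).trans y y'
  let H (y y' : P) : Γ(P, B y ⊓ B y') := (M.pull q).trans y y'
  have hs' (y y' : P) : res (inf_le_left : A y ⊓ A y' ≤ A y) (s' y) =
      G y y' ^ n * res inf_le_right (s' y') := by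
    have e := congrArg (p.app (L.nbhd (p y) ⊓ L.nbhd (p y'))).hom (s.compat (p y) (p y'))
    refine (app_res p _ _).symm.trans (e.trans ((map_mul _ _ _).trans ?_))
    exact congrArg₂ (· * ·) (map_pow (p.app (L.nbhd (p y) ⊓ L.nbhd (p y'))).hom _ n)
      (app_res p _ _)
  have ht' (y y' : P) : res (inf_le_left : B y ⊓ B y' ≤ B y) (t' y) =
      H y y' ^ m * res inf_le_right (t' y') := by
    have e := congrArg (q.app (M.nbhd (q y) ⊓ M.nbhd (q y'))).hom (t.compat (q y) (q y'))
    refine (app_res q _ _).symm.trans (e.trans ((map_mul _ _ _).trans ?_))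
    exact congrArg₂ (· * ·) (map_pow (q.app (M.nbhd (q y) ⊓ M.nbhd (q y'))).hom _ m)
      (app_res q _ _)
  let r : (((L.pull p).tensor (M.pull q)).pow (n * m)).Sec :=
    { val := fun y => res (inf_le_left : A y ⊓ B y ≤ A y) (s' y) ^ m *
        res (inf_le_right : A y ⊓ B y ≤ B y) (t' y) ^ n
      compat := fun y y' => by
        have e1 := congrArg (res (inf_le_inf inf_le_left inf_le_left :
          (A y ⊓ B y) ⊓ (A y' ⊓ B y') ≤ A y ⊓ A y')) (hs' y y')
        have e2 := congrArg (res (inf_le_inf inf_le_right inf_le_right :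
          (A y ⊓ B y) ⊓ (A y' ⊓ B y') ≤ B y ⊓ B y')) (ht' y y')
        rw [map_mul, map_pow, res_res, res_res] at e1 e2
        change res (inf_le_left : (A y ⊓ B y) ⊓ (A y' ⊓ B y') ≤ _) (_ * _) =
          (res (inf_le_inf inf_le_left inf_le_left :
          (A y ⊓ B y) ⊓ (A y' ⊓ B y') ≤ A y ⊓ A y') (G y y') *
          res (inf_le_inf inf_le_right inf_le_right :
          (A y ⊓ B y) ⊓ (A y' ⊓ B y') ≤ B y ⊓ B y') (H y y')) ^ (n * m) *
          res (inf_le_right : (A y ⊓ B y) ⊓ (A y' ⊓ B y') ≤ _) (_ * _)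
        rw [map_mul, map_mul, map_pow, map_pow, map_pow, map_pow, res_res, res_res, res_res,
          res_res, e1, e2]
        ring }
  have hr : r.locus = p ⁻¹ᵁ s.locus ⊓ q ⁻¹ᵁ t.locus := by
    ext y
    have h1 := r.mem_locus y y (((L.pull p).tensor (M.pull q)).mem_nbhd y)
    have h2 := s.mem_locus (p y) (p y) (L.mem_nbhd (p y))
    have h3 := t.mem_locus (q y) (q y) (M.mem_nbhd (q y))
    have h6 : P.basicOpen (res (inf_le_left : A y ⊓ B y ≤ A y) (s' y) ^ m *
        res (inf_le_right : A y ⊓ B y ≤ B y) (t' y) ^ n) =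
        (A y ⊓ B y) ⊓ (p ⁻¹ᵁ W.sch.basicOpen (s.val (p y)) ⊓
          q ⁻¹ᵁ V.sch.basicOpen (t.val (q y))) := by
      rw [P.basicOpen_mul, P.basicOpen_pow _ hm, P.basicOpen_pow _ hn]
      simp only [res, P.basicOpen_res, s', t', Scheme.preimage_basicOpen]
      exact (inf_inf_distrib_left _ _ _).symm
    have h4 : P.basicOpen (r.val y) = (A y ⊓ B y) ⊓ (p ⁻¹ᵁ W.sch.basicOpen (s.val (p y)) ⊓
        q ⁻¹ᵁ V.sch.basicOpen (t.val (q y))) := h6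
    rw [h4] at h1
    have h5 : y ∈ A y ⊓ B y := ⟨L.mem_nbhd (p y), M.mem_nbhd (q y)⟩
    exact h1.trans ⟨fun h => ⟨h2.2 h.2.1, h3.2 h.2.2⟩, fun h => ⟨h5, h2.1 h.1, h3.1 h.2⟩⟩
  refine ⟨n * m, Nat.mul_pos hn hm, r, ?_, ?_⟩
  · rw [hr]
    exact ⟨hs, ht⟩
  · rw [hr]
    exact isAffineOpen_preimage_inf sq Z.str hsa hta

/-- The fibre product of quasi-projective schemes. -/
def fibreProd {W V Z : QProj k} (a : W ⟶ Z) (b : V ⟶ Z) : QProj k :=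
  ⟨Over.mk (Limits.pullback.fst (mor a) (mor b) ≫ W.str),
    isQuasiProjective_of_isPullback (IsPullback.of_hasPullback (mor a) (mor b))⟩

/-- The first projection from the fibre product. -/
def fibreProd.fst {W V Z : QProj k} (a : W ⟶ Z) (b : V ⟶ Z) : fibreProd a b ⟶ W :=
  homMk (Limits.pullback.fst (mor a) (mor b)) rfl

/-- The second projection from the fibre product. -/
def fibreProd.snd {W V Z : QProj k} (a : W ⟶ Z) (b : V ⟶ Z) : fibreProd a b ⟶ V :=
  homMk (Limits.pullback.snd (mor a) (mor b)) (by
    change _ = Limits.pullback.fst (mor a) (mor b) ≫ W.str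
    rw [← mor_str a, ← mor_str b, Limits.pullback.condition_assoc]
    rfl)

theorem fibreProd.isPullback {W V Z : QProj k} (a : W ⟶ Z) (b : V ⟶ Z) :
    IsPullback (mor (fst a b)) (mor (snd a b)) (mor a) (mor b) :=
  IsPullback.of_hasPullback (mor a) (mor b)

/-- The open and closed subscheme of `X` with underlying set `U`. -/
def clopenSub (X : QProj k) (U : X.sch.Opens) (hU : IsClosed (U : Set X.sch)) : QProj k :=
  ⟨Over.mk (U.ι ≫ X.str),
    haveI : IsClosedImmersion U.ι := .of_isPreimmersion _ (by simpa using hU)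
    isQuasiProjective_of_isClosedImmersion X U.ι⟩

/-- The inclusion of an open and closed subscheme. -/
def clopenSub.ι (X : QProj k) (U : X.sch.Opens) (hU : IsClosed (U : Set X.sch)) :
    clopenSub X U hU ⟶ X := homMk U.ι rfl

theorem clopenSub.isClosedImmersion_ι (X : QProj k) (U : X.sch.Opens)
    (hU : IsClosed (U : Set X.sch)) : IsClosedImmersion (mor (clopenSub.ι X U hU)) :=
  .of_isPreimmersion U.ι (by simpa using hU)

/-! ### Cycles -/

/-- A family `(h : W ⟶ X; L₁, …, L_r)` with `h` proper and `L₁, …, L_r` line bundles on `W`; as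
the order of the line bundles is irrelevant and they only matter up to isomorphism, they are
recorded as a multiset of isomorphism classes. A morphism of quasi-projective schemes over a field
is proper if and only if it is projective. -/
structure Cycle (X : QProj k) where
  src : QProj k
  map : src ⟶ X
  isProper : IsProper (mor map)
  bundles : Multiset (Pic src.sch)

namespace Cycle

variable {X Y : QProj k}

/-- Isomorphism of cycles over `X`. -/
def Iso (c d : Cycle X) : Prop :=
  ∃ e : c.src ≅ d.src, e.hom ≫ d.map = c.map ∧ d.bundles.map (Pic.pull (mor e.hom)) = c.bundles

theorem pull_id_bundles (W : QProj k) (M : Multiset (Pic W.sch)) :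
    M.map (Pic.pull (mor (𝟙 W))) = M :=
  (Multiset.map_congr rfl fun L _ => Pic.pull_id L).trans (Multiset.map_id' M)

theorem pull_comp_bundles {U V W : QProj k} (f : U ⟶ V) (g : V ⟶ W) (M : Multiset (Pic W.sch)) :
    M.map (Pic.pull (mor (f ≫ g))) = (M.map (Pic.pull (mor g))).map (Pic.pull (mor f)) := by
  rw [Multiset.map_map]
  exact Multiset.map_congr rfl fun L _ => Pic.pull_comp (mor g) (mor f) L

theorem Iso.refl (c : Cycle X) : c.Iso c :=
  ⟨CategoryTheory.Iso.refl _, Category.id_comp _, pull_id_bundles _ _⟩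

theorem Iso.symm {c d : Cycle X} (h : c.Iso d) : d.Iso c := by
  obtain ⟨e, h1, h2⟩ := h
  refine ⟨e.symm, ?_, ?_⟩
  · rw [← h1, Iso.symm_hom, Iso.inv_hom_id_assoc]
  · rw [← h2, ← pull_comp_bundles, Iso.symm_hom, Iso.inv_hom_id, pull_id_bundles]

theorem Iso.trans {c d b : Cycle X} (h : c.Iso d) (h' : d.Iso b) : c.Iso b := by
  obtain ⟨e, h1, h2⟩ := h
  obtain ⟨e', h1', h2'⟩ := h'
  refine ⟨e ≪≫ e', ?_, ?_⟩
  · rw [Iso.trans_hom, Category.assoc, h1', h1]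
  · rw [Iso.trans_hom, pull_comp_bundles, h2', h2]

instance setoid (X : QProj k) : Setoid (Cycle X) := ⟨Iso, Iso.refl, Iso.symm, Iso.trans⟩

/-- Composition with a proper morphism. -/
def push (f : X ⟶ Y) (hf : IsProper (mor f)) (c : Cycle X) : Cycle Y where
  src := c.src
  map := c.map ≫ f
  isProper := haveI := c.isProper; inferInstanceAs (IsProper (mor c.map ≫ mor f))
  bundles := c.bundles

/-- Adding a line bundle on the source. -/
def addBundle (c : Cycle X) (L : Pic c.src.sch) : Cycle X where
  src := c.src
  map := c.map
  isProper := c.isProper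
  bundles := L ::ₘ c.bundles

/-- Adding the pullback of a line bundle on the target. -/
def chern (L : Pic X.sch) (c : Cycle X) : Cycle X := c.addBundle (Pic.pull (mor c.map) L)

/-- Restriction along a proper morphism to the source. -/
def restrict (c : Cycle X) {Z : QProj k} (i : Z ⟶ c.src) (hi : IsProper (mor i)) : Cycle X where
  src := Z
  map := i ≫ c.map
  isProper := haveI := c.isProper; inferInstanceAs (IsProper (mor i ≫ mor c.map))
  bundles := c.bundles.map (Pic.pull (mor i))

/-- Base change along a morphism. -/
def baseChange (t : Y ⟶ X) (c : Cycle X) : Cycle Y where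
  src := fibreProd c.map t
  map := fibreProd.snd c.map t
  isProper := MorphismProperty.of_isPullback (P := @IsProper) (fibreProd.isPullback c.map t)
    c.isProper
  bundles := c.bundles.map (Pic.pull (mor (fibreProd.fst c.map t)))

theorem push_congr (f : X ⟶ Y) (hf : IsProper (mor f)) {c d : Cycle X} (h : c.Iso d) :
    (c.push f hf).Iso (d.push f hf) := by
  obtain ⟨e, h1, h2⟩ := h
  exact ⟨e, (Category.assoc _ _ _).symm.trans (congrArg (· ≫ f) h1), h2⟩

theorem chern_congr (L : Pic X.sch) {c d : Cycle X} (h : c.Iso d) :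
    (c.chern L).Iso (d.chern L) := by
  obtain ⟨e, h1, h2⟩ := h
  have h3 : (Pic.pull (mor d.map) L ::ₘ d.bundles).map (Pic.pull (mor e.hom)) =
      Pic.pull (mor c.map) L ::ₘ c.bundles := by
    rw [Multiset.map_cons, h2, ← h1]
    exact congrArg (· ::ₘ c.bundles) (Pic.pull_comp (mor d.map) (mor e.hom) L).symm
  exact ⟨e, h1, h3⟩

theorem baseChange_congr (t : Y ⟶ X) {c d : Cycle X} (h : c.Iso d) :
    (c.baseChange t).Iso (d.baseChange t) := by
  obtain ⟨e, h1, h2⟩ := h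
  have h1' : mor e.hom ≫ mor d.map = mor c.map := congrArg mor h1
  have : IsIso (mor e.hom) := inferInstanceAs
    (IsIso ((Over.forget _).map ((ObjectProperty.ι _).map e.hom)))
  let j : Limits.pullback (mor c.map) (mor t) ≅ Limits.pullback (mor d.map) (mor t) :=
    asIso (Limits.pullback.map _ _ _ _ (mor e.hom) (𝟙 _) (𝟙 _)
      (by rw [Category.comp_id, h1']) (by rw [Category.comp_id, Category.id_comp]))
  have hj1 : j.hom ≫ Limits.pullback.fst _ _ = Limits.pullback.fst _ _ ≫ mor e.hom :=
    Limits.pullback.lift_fst _ _ _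
  have hj2 : j.hom ≫ Limits.pullback.snd _ _ = Limits.pullback.snd _ _ :=
    (Limits.pullback.lift_snd _ _ _).trans (Category.comp_id _)
  let J : fibreProd c.map t ≅ fibreProd d.map t :=
    ObjectProperty.isoMk _ (Over.isoMk j (by
      change j.hom ≫ Limits.pullback.fst _ _ ≫ d.src.str = Limits.pullback.fst _ _ ≫ c.src.str
      rw [← Category.assoc, hj1, Category.assoc, mor_str]))
  have e1 : J.hom ≫ fibreProd.fst d.map t = fibreProd.fst c.map t ≫ e.hom := by
    ext1; ext1; exact hj1
  have e2 : J.hom ≫ fibreProd.snd d.map t = fibreProd.snd c.map t := by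
    ext1; ext1; exact hj2
  have e3 : (d.bundles.map (Pic.pull (mor (fibreProd.fst d.map t)))).map (Pic.pull (mor J.hom)) =
      c.bundles.map (Pic.pull (mor (fibreProd.fst c.map t))) := by
    rw [← pull_comp_bundles, e1, pull_comp_bundles, h2]
  exact ⟨J, e2, e3⟩

end Cycle

/-! ### The Lazard ring -/

/-- The series `u + v + ∑_{i, j ≥ 1} a_{ij} u^i v^j` with indeterminate coefficients; the variable
`(p, q)` stands for `a_{p+1, q+1}`. -/
def genericSeries : MvPowerSeries (Fin 2) (MvPolynomial (ℕ × ℕ) ℤ) := fun n =>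
  if n = Finsupp.single 0 1 ∨ n = Finsupp.single 1 1 then 1
  else if 1 ≤ n 0 ∧ 1 ≤ n 1 then MvPolynomial.X (n 0 - 1, n 1 - 1) else 0

/-- The ideal expressing commutativity and associativity of the generic series. -/
def lazardIdeal : Ideal (MvPolynomial (ℕ × ℕ) ℤ) :=
  Ideal.span
    ({r | ∃ p q : ℕ, r = MvPolynomial.X (p, q) - MvPolynomial.X (q, p)} ∪
      {r | ∃ n : Fin 3 →₀ ℕ, r =
        MvPowerSeries.coeff n (MvPowerSeries.subst (S := MvPolynomial (ℕ × ℕ) ℤ)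
            ![MvPowerSeries.subst ![MvPowerSeries.X (0 : Fin 3), MvPowerSeries.X 1] genericSeries,
              MvPowerSeries.X 2] genericSeries) -
          MvPowerSeries.coeff n (MvPowerSeries.subst (S := MvPolynomial (ℕ × ℕ) ℤ)
            ![MvPowerSeries.X (0 : Fin 3),
              MvPowerSeries.subst ![MvPowerSeries.X 1, MvPowerSeries.X 2] genericSeries]
            genericSeries)})

/-- The Lazard ring, the coefficient ring of the universal commutative formal group law. -/
abbrev Lazard : Type := MvPolynomial (ℕ × ℕ) ℤ ⧸ lazardIdeal

/-- The coefficient of `u^i v^j` in the universal formal group law `F_𝕃(u, v)`. -/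
def lazardCoeff (i j : ℕ) : Lazard :=
  Ideal.Quotient.mk lazardIdeal
    (MvPowerSeries.coeff (Finsupp.single 0 i + Finsupp.single 1 j) genericSeries)

/-- `(∑_{i + j < N} a_{ij} c₁^i c₂^j - c₁₂) α`, for commuting operators `c₁`, `c₂` such that
`c₁^i c₂^j α` is negligible for `i + j ≥ N`. -/
def fglDefect {M : Type*} [AddCommGroup M] (c₁ c₂ c₁₂ : M →+ M) (N : ℕ) (α : M) :
    Lazard ⊗[ℤ] M :=
  (∑ n ∈ Finset.range N, ∑ p ∈ Finset.HasAntidiagonal.antidiagonal n,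
    lazardCoeff p.1 p.2 ⊗ₜ[ℤ] (c₁^[p.1] (c₂^[p.2] α))) - 1 ⊗ₜ[ℤ] c₁₂ α

theorem baseChange_comp_apply {A B C : Type*} [AddCommGroup A] [AddCommGroup B] [AddCommGroup C]
    (φ : A →+ B) (ψ : B →+ C) (χ : A →+ C) (h : ∀ x, ψ (φ x) = χ x) (ρ : Lazard ⊗[ℤ] A) :
    LinearMap.baseChange Lazard ψ.toIntLinearMap
      (LinearMap.baseChange Lazard φ.toIntLinearMap ρ) =
    LinearMap.baseChange Lazard χ.toIntLinearMap ρ := by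
  obtain rfl : χ = ψ.comp φ := AddMonoidHom.ext fun x => (h x).symm
  induction ρ using TensorProduct.induction_on with
  | zero => simp only [map_zero]
  | tmul a b => rfl
  | add a b ha hb => rw [map_add, map_add, map_add, ha, hb]

/-! ### The oriented bivariant theory `OB` -/

section Bivariant

variable {X Y X' Y' Z : QProj k}

/-- Bivariant cobordism cycles for `f : X ⟶ Y`. -/
def BivCycle (f : X ⟶ Y) : Type (u + 1) := {c : Cycle X // Smooth (mor (c.map ≫ f))}

instance BivCycle.setoid (f : X ⟶ Y) : Setoid (BivCycle f) :=
  (Cycle.setoid X).comap Subtype.val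

/-- The free abelian group on isomorphism classes of bivariant cobordism cycles. -/
def OB (f : X ⟶ Y) : Type (u + 1) := FreeAbelianGroup (Quotient (BivCycle.setoid f))

instance (f : X ⟶ Y) : AddCommGroup (OB f) :=
  inferInstanceAs (AddCommGroup (FreeAbelianGroup _))

namespace OB

/-- The class of a bivariant cobordism cycle. -/
def of {f : X ⟶ Y} (c : BivCycle f) : OB f := FreeAbelianGroup.of ⟦c⟧

/-- Bivariant pushforward along a proper morphism `f`, where `g ∘ f = g'`. -/
def push (f : X' ⟶ X) (hf : IsProper (mor f)) {g : X ⟶ Y} {g' : X' ⟶ Y} (w : f ≫ g = g') :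
    OB g' →+ OB g :=
  FreeAbelianGroup.map (Quotient.map (fun c => ⟨c.1.push f hf,
    (congrArg (fun m => Smooth (mor m)) (show c.1.map ≫ g' = (c.1.map ≫ f) ≫ g by
      rw [Category.assoc, w])).mp c.2⟩) fun _ _ h => Cycle.push_congr f hf h)

/-- The first Chern class operator. -/
def chern (f : X ⟶ Y) (L : Pic X.sch) : OB f →+ OB f :=
  FreeAbelianGroup.map (Quotient.map (fun c => ⟨c.1.chern L, c.2⟩)
    fun _ _ h => Cycle.chern_congr L h)

/-- The composition of the first Chern class operators of a list of line bundles. -/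
def cherns (f : X ⟶ Y) (Ls : List (Pic X.sch)) : OB f →+ OB f :=
  Ls.foldr (fun L φ => (chern f L).comp φ) (AddMonoidHom.id _)

/-- Bivariant pullback along a fibre square. -/
def pull {f : X ⟶ Y} {f' : X' ⟶ Y'} {t : X' ⟶ X} {g : Y' ⟶ Y}
    (sq : IsPullback (mor t) (mor f') (mor f) (mor g)) : OB f →+ OB f' :=
  FreeAbelianGroup.map (Quotient.map (fun c => ⟨c.1.baseChange t,
    MorphismProperty.of_isPullback (P := @Smooth)
      ((fibreProd.isPullback c.1.map t).flip.paste_horiz sq.flip).flip c.2⟩)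
    fun _ _ h => Cycle.baseChange_congr t h)

/-- The fundamental class of a smooth morphism. -/
def fund (f : X ⟶ Y) (hf : Smooth (mor f)) : OB f :=
  of ⟨⟨X, 𝟙 X, inferInstanceAs (IsProper (𝟙 X.sch)), 0⟩, by rwa [Category.id_comp]⟩

end OB

/-- A family of sets of relations in `OB`. -/
abbrev BivRel (k : Type u) [Field k] := ∀ {X Y : QProj k} (f : X ⟶ Y), Set (OB f)

/-- The subgroup generated by the elements `f'_* c₁(L₁) ⋯ c₁(L_r) g^* ρ`, where `ρ` is a relation
for `z : Z' ⟶ Z`, `g : Y ⟶ Z` is smooth and equidimensional, `X' = Z' ×_Z Y`, the projection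
`X' ⟶ Y` factors as `f ∘ f'` with `f' : X' ⟶ X` proper, and the `L_i` are line bundles on `X'`. -/
def OB.imposed (R : BivRel k) (f : X ⟶ Y) : AddSubgroup (OB f) :=
  AddSubgroup.closure {x | ∃ (X' Z' Z : QProj k) (f' : X' ⟶ X) (hf' : IsProper (mor f'))
    (q : X' ⟶ Y) (w : f' ≫ f = q) (t : X' ⟶ Z') (z : Z' ⟶ Z) (g : Y ⟶ Z)
    (sq : IsPullback (mor t) (mor q) (mor z) (mor g))
    (_ : ∃ d, SmoothOfRelativeDimension d (mor g)) (Ls : List (Pic X'.sch)) (ρ : OB z),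
    ρ ∈ R z ∧ x = OB.push f' hf' w (OB.cherns q Ls (OB.pull sq ρ))}

/-- The dimension relations: `c₁(L₁) ⋯ c₁(L_r) [X ⟶ Y]` with `X` smooth and `r > dim X`. -/
def OB.relDim : BivRel k := fun {X _} f =>
  {ρ | ∃ (_ : Smooth X.str) (hf : Smooth (mor f)) (Ls : List (Pic X.sch)),
    topologicalKrullDim X.sch < (Ls.length : WithBot ℕ∞) ∧ ρ = OB.cherns f Ls (OB.fund f hf)}

/-- Lifts to `OB` of the section relations `c₁(L) [X ⟶ Y] - i_* [Z ⟶ Y]`, with `X` smooth and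
`i : Z ⟶ X` the zero scheme of a section of `L` transverse to the zero section. -/
def OB.relSect : BivRel k := fun {X _} f =>
  {ρ | ∃ (_ : Smooth X.str) (hf : Smooth (mor f)) (L : LineBundle X.sch) (s : L.Sec)
    (Z : QProj k) (i : Z ⟶ X) (_ : s.IsRegular) (_ : s.IsZeroScheme (mor i)) (_ : Smooth Z.str)
    (hi : IsProper (mor i)) (hZ : Smooth (mor (i ≫ f))),
    ρ = OB.chern f ⟦L⟧ (OB.fund f hf) - OB.push i hi rfl (OB.fund (i ≫ f) hZ)}

/-- The kernel of the projection from `OB` to its quotient by the dimension relations and then by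
the section relations. -/
def OB.preRel (f : X ⟶ Y) : AddSubgroup (OB f) :=
  OB.imposed OB.relDim f ⊔ OB.imposed OB.relSect f

/-- The quotient of `OB` by the dimension and section relations. -/
abbrev PreOB (f : X ⟶ Y) : Type (u + 1) := OB f ⧸ OB.preRel f

/-- Lifts to `𝕃 ⊗ OB` of the formal group law relations
`(F_𝕃(c₁(L₁), c₁(L₂)) - c₁(L₁ ⊗ L₂)) α`. -/
def OB.relFGL (f : X ⟶ Y) : Set (Lazard ⊗[ℤ] OB f) :=
  {ρ | ∃ (_ : Smooth X.str) (L₁ L₂ : Pic X.sch) (α : OB f) (N : ℕ),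
    (∀ i j, N ≤ i + j → (OB.chern f L₁)^[i] ((OB.chern f L₂)^[j] α) ∈ OB.preRel f) ∧
    ρ = fglDefect (OB.chern f L₁) (OB.chern f L₂) (OB.chern f (L₁.tensor L₂)) N α}

/-- The `𝕃`-submodule of `𝕃 ⊗ PreOB` obtained by imposing the formal group law relations. -/
def OB.imposedFGL (f : X ⟶ Y) : Submodule Lazard (Lazard ⊗[ℤ] PreOB f) :=
  Submodule.span Lazard {x | ∃ (X' Z' Z : QProj k) (f' : X' ⟶ X) (hf' : IsProper (mor f'))
    (q : X' ⟶ Y) (w : f' ≫ f = q) (t : X' ⟶ Z') (z : Z' ⟶ Z) (g : Y ⟶ Z)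
    (sq : IsPullback (mor t) (mor q) (mor z) (mor g))
    (_ : ∃ d, SmoothOfRelativeDimension d (mor g)) (Ls : List (Pic X'.sch)),
    ∃ ρ ∈ OB.relFGL z, x = LinearMap.baseChange Lazard
      (((QuotientAddGroup.mk' (OB.preRel f)).comp ((OB.push f' hf' w).comp
        ((OB.cherns q Ls).comp (OB.pull sq)))).toIntLinearMap) ρ}

/-- The oriented bivariant theory `OB1`. -/
abbrev OB1 (f : X ⟶ Y) : Type (u + 1) := (Lazard ⊗[ℤ] PreOB f) ⧸ OB.imposedFGL f


theorem OB.push_push {X Y Z S : QProj k} (f : X ⟶ Y) (hf : IsProper (mor f)) (g : Y ⟶ Z)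
    (hg : IsProper (mor g)) (hfg : IsProper (mor (f ≫ g))) {a : X ⟶ S} {b : Y ⟶ S} {c : Z ⟶ S}
    (w : f ≫ b = a) (w' : g ≫ c = b) (w'' : (f ≫ g) ≫ c = a) (x : OB a) :
    OB.push g hg w' (OB.push f hf w x) = OB.push (f ≫ g) hfg w'' x := by
  have h : (OB.push g hg w').comp (OB.push f hf w) = OB.push (f ≫ g) hfg w'' := by
    refine FreeAbelianGroup.lift_ext _ _ fun q => ?_
    induction q using Quotient.inductionOn with
    | _ d =>
      refine congrArg FreeAbelianGroup.of (Quotient.sound ?_)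
      exact ⟨CategoryTheory.Iso.refl _, (Category.id_comp _).trans (Category.assoc _ _ _).symm,
        Cycle.pull_id_bundles _ _⟩
  exact DFunLike.congr_fun h x

theorem isProper_comp {X Y Z : QProj k} {f : X ⟶ Y} {g : Y ⟶ Z} (hf : IsProper (mor f))
    (hg : IsProper (mor g)) : IsProper (mor (f ≫ g)) :=
  inferInstanceAs (IsProper (mor f ≫ mor g))

theorem OB.imposed_le (R : BivRel k) (f : X' ⟶ X) (hf : IsProper (mor f)) {g : X ⟶ Y}
    {g' : X' ⟶ Y} (w : f ≫ g = g') :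
    OB.imposed R g' ≤ (OB.imposed R g).comap (OB.push f hf w) := by
  refine (AddSubgroup.closure_le _).2 ?_
  rintro _ ⟨U, Z', Z, f', hf', q, w', t, z, h, sq, hh, Ls, ρ, hρ, rfl⟩
  have w'' : (f' ≫ f) ≫ g = q := by rw [Category.assoc, w, w']
  exact AddSubgroup.subset_closure ⟨U, Z', Z, f' ≫ f, isProper_comp hf' hf, q, w'', t, z, h, sq,
    hh, Ls, ρ, hρ, OB.push_push _ _ _ _ _ _ _ _ _⟩

theorem OB.preRel_le (f : X' ⟶ X) (hf : IsProper (mor f)) {g : X ⟶ Y} {g' : X' ⟶ Y}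
    (w : f ≫ g = g') : OB.preRel g' ≤ (OB.preRel g).comap (OB.push f hf w) :=
  sup_le ((OB.imposed_le _ f hf w).trans (AddSubgroup.comap_mono le_sup_left))
    ((OB.imposed_le _ f hf w).trans (AddSubgroup.comap_mono le_sup_right))

/-- Pushforward on the quotient of `OB` by the dimension and section relations. -/
def PreOB.push (f : X' ⟶ X) (hf : IsProper (mor f)) {g : X ⟶ Y} {g' : X' ⟶ Y}
    (w : f ≫ g = g') : PreOB g' →+ PreOB g :=
  QuotientAddGroup.map _ _ (OB.push f hf w) (OB.preRel_le f hf w)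

theorem OB.imposedFGL_le (f : X' ⟶ X) (hf : IsProper (mor f)) {g : X ⟶ Y} {g' : X' ⟶ Y}
    (w : f ≫ g = g') : OB.imposedFGL g' ≤ (OB.imposedFGL g).comap
      (LinearMap.baseChange Lazard (PreOB.push f hf w).toIntLinearMap) := by
  refine Submodule.span_le.2 ?_
  rintro _ ⟨U, Z', Z, f', hf', q, w', t, z, h, sq, hh, Ls, ρ, hρ, rfl⟩
  have w'' : (f' ≫ f) ≫ g = q := by rw [Category.assoc, w, w']
  refine Submodule.subset_span ⟨U, Z', Z, f' ≫ f, isProper_comp hf' hf, q, w'', t, z, h, sq,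
    hh, Ls, ρ, hρ, ?_⟩
  exact baseChange_comp_apply
    ((QuotientAddGroup.mk' (OB.preRel g')).comp ((OB.push f' hf' w').comp
      ((OB.cherns q Ls).comp (OB.pull sq)))) (PreOB.push f hf w)
    ((QuotientAddGroup.mk' (OB.preRel g)).comp ((OB.push (f' ≫ f) (isProper_comp hf' hf) w'').comp
      ((OB.cherns q Ls).comp (OB.pull sq))))
    (fun x => congrArg (QuotientAddGroup.mk' (OB.preRel g))
      (OB.push_push f' hf' f hf (isProper_comp hf' hf) w' w w''
        (OB.cherns q Ls (OB.pull sq x)))) ρ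

/-- Pushforward on `OB1`. -/
def OB1.push (f : X' ⟶ X) (hf : IsProper (mor f)) {g : X ⟶ Y} {g' : X' ⟶ Y} (w : f ≫ g = g') :
    OB1 g' →ₗ[Lazard] OB1 g :=
  Submodule.mapQ _ _ (LinearMap.baseChange Lazard (PreOB.push f hf w).toIntLinearMap)
    (OB.imposedFGL_le f hf w)

theorem toPt_comp {X Y : QProj k} (f : X ⟶ Y) : f ≫ toPt Y = toPt X := by
  ext1; ext1; exact mor_str f

/-- The covariant theory `OB1_*(X) = OB1(X ⟶ pt)` associated with `OB1`. -/
abbrev OB1Cov (X : QProj k) : Type (u + 1) := OB1 (toPt X)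

/-- Pushforward in the covariant theory associated with `OB1`. -/
def OB1Cov.push (f : X ⟶ Y) (hf : IsProper (mor f)) : OB1Cov X →ₗ[Lazard] OB1Cov Y :=
  OB1.push f hf (toPt_comp f)

/-- The class of a bivariant cobordism cycle in `OB1`. -/
def OB1.of {f : X ⟶ Y} (c : BivCycle f) : OB1 f :=
  (OB.imposedFGL f).mkQ (1 ⊗ₜ[ℤ] (QuotientAddGroup.mk' (OB.preRel f) (OB.of c)))

end Bivariant

/-! ### Algebraic bordism -/

section Bordism

variable {X Y Z : QProj k}

/-- Cobordism cycles on `X`: the source is smooth over `k` and integral. -/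
def CobCycle (X : QProj k) : Type (u + 1) :=
  {c : Cycle X // Smooth c.src.str ∧ IsIntegral c.src.sch}

instance CobCycle.setoid (X : QProj k) : Setoid (CobCycle X) :=
  (Cycle.setoid X).comap Subtype.val

/-- The free abelian group on isomorphism classes of cobordism cycles on `X`. -/
def ZCyc (X : QProj k) : Type (u + 1) := FreeAbelianGroup (Quotient (CobCycle.setoid X))

instance (X : QProj k) : AddCommGroup (ZCyc X) :=
  inferInstanceAs (AddCommGroup (FreeAbelianGroup _))

/-- The integral connected components of a scheme. If `W` is smooth over a field, these are all the
connected components of `W`. -/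
def Comp (W : Scheme.{u}) : Type u :=
  {U : W.Opens // IsClosed (U : Set W) ∧ IsIntegral U.toScheme}

/-- A scheme of finite type over a field has only finitely many components. -/
theorem Comp.finite (W : QProj k) : Finite (Comp W.sch) := by
  have h1 := W.property.locallyOfFiniteType
  have h2 := W.property.quasiCompact
  have : IsLocallyNoetherian W.sch := LocallyOfFiniteType.isLocallyNoetherian W.str
  have : CompactSpace W.sch := QuasiCompact.compactSpace_of_compactSpace W.str
  have : IsNoetherian W.sch := {}
  have hf : (irreducibleComponents W.sch).Finite := NoetherianSpace.finite_irreducibleComponents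
  have := hf.to_subtype
  refine Finite.of_injective (β := irreducibleComponents W.sch) (fun U => ⟨U.1, ?_⟩) ?_
  · have hU := U.2.2
    have hirr : IsIrreducible (U.1 : Set W.sch) := by
      rw [isIrreducible_iff_irreducibleSpace]
      exact inferInstanceAs (IrreducibleSpace U.1.toScheme)
    refine ⟨hirr, fun T hT hUT => ?_⟩
    have hcl : IsClopen (U.1 : Set W.sch) := ⟨U.2.1, U.1.isOpen⟩
    exact hT.isPreirreducible.isPreconnected.subset_isClopen hcl
      (hirr.nonempty.mono fun x hx => ⟨hUT hx, hx⟩)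
  · intro U V h
    exact Subtype.ext (Opens.ext (congrArg Subtype.val h))

/-- The restriction of a cycle to a component of its source. -/
def Cycle.comp (c : Cycle X) (U : Comp c.src.sch) : Cycle X :=
  c.restrict (clopenSub.ι c.src U.1 U.2.1)
    (haveI := clopenSub.isClosedImmersion_ι c.src U.1 U.2.1; inferInstance)

namespace ZCyc

/-- The class of a cobordism cycle. -/
def of (c : CobCycle X) : ZCyc X := FreeAbelianGroup.of ⟦c⟧

/-- The class of `(h : W ⟶ X; L₁, …, L_r)` with `W` smooth over `k` but not necessarily connected:
the sum of the classes of its restrictions to the components of `W`. -/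
def ofSmooth (c : Cycle X) (hc : Smooth c.src.str) : ZCyc X :=
  ∑ᶠ U : Comp c.src.sch, of ⟨c.comp U, inferInstanceAs (Smooth (U.1.ι ≫ c.src.str)), U.2.2⟩

theorem ofSmooth_congr {c d : Cycle X} (h : c.Iso d) (hc : Smooth c.src.str)
    (hd : Smooth d.src.str) : ofSmooth c hc = ofSmooth d hd := by
  obtain ⟨e, h1, h2⟩ := h
  have : IsIso (mor e.hom) := inferInstanceAs
    (IsIso ((Over.forget _).map ((ObjectProperty.ι _).map e.hom)))
  let E (U : Comp d.src.sch) : Comp c.src.sch := ⟨mor e.hom ⁻¹ᵁ U.1,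
    U.2.1.preimage (mor e.hom).continuous, by
      have := U.2.2
      have : Nonempty (mor e.hom ⁻¹ᵁ U.1).toScheme :=
        (inferInstance : Nonempty U.1.toScheme).map (inv (mor e.hom ∣_ U.1))
      exact isIntegral_of_isOpenImmersion (mor e.hom ∣_ U.1)⟩
  have hsurj : Function.Surjective (mor e.hom) := (mor e.hom).surjective
  have hE : Function.Bijective E := by
    constructor
    · intro U V hUV
      have h3 : mor e.hom ⁻¹ᵁ U.1 = mor e.hom ⁻¹ᵁ V.1 := congrArg Subtype.val hUV
      refine Subtype.ext (Opens.ext (hsurj.preimage_injective ?_))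
      exact congrArg (fun O : c.src.sch.Opens => (O : Set c.src.sch)) h3
    · intro V
      have hV : (mor e.hom) ⁻¹ᵁ (inv (mor e.hom) ⁻¹ᵁ V.1) = V.1 := by
        rw [← Scheme.Hom.comp_preimage, IsIso.hom_inv_id, Scheme.Hom.id_preimage]
      have hU : IsClosed ((inv (mor e.hom) ⁻¹ᵁ V.1 : d.src.sch.Opens) : Set d.src.sch) :=
        V.2.1.preimage (inv (mor e.hom)).continuous
      have hI : IsIntegral (inv (mor e.hom) ⁻¹ᵁ V.1).toScheme := by
        have := V.2.2
        have : Nonempty (inv (mor e.hom) ⁻¹ᵁ V.1).toScheme :=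
          (inferInstance : Nonempty V.1.toScheme).map (inv (inv (mor e.hom) ∣_ V.1))
        exact isIntegral_of_isOpenImmersion (inv (mor e.hom) ∣_ V.1)
      exact ⟨⟨_, hU, hI⟩, Subtype.ext hV⟩
  refine (finsum_eq_of_bijective E hE fun U => ?_).symm
  refine congrArg FreeAbelianGroup.of (Quotient.sound (Cycle.Iso.symm ?_))
  have hr : IsIso (mor e.hom ∣_ U.1) := inferInstance
  let j : clopenSub c.src (E U).1 (E U).2.1 ≅ clopenSub d.src U.1 U.2.1 :=
    ObjectProperty.isoMk _ (Over.isoMk (@asIso _ _ _ _ (mor e.hom ∣_ U.1) hr) (by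
      change mor e.hom ∣_ U.1 ≫ U.1.ι ≫ d.src.str = (mor e.hom ⁻¹ᵁ U.1).ι ≫ c.src.str
      rw [morphismRestrict_ι_assoc, mor_str]))
  have hj : j.hom ≫ clopenSub.ι d.src U.1 U.2.1 = clopenSub.ι c.src (E U).1 (E U).2.1 ≫ e.hom := by
    ext1; ext1; exact morphismRestrict_ι (mor e.hom) U.1
  refine ⟨j, ?_, ?_⟩
  · change j.hom ≫ clopenSub.ι d.src U.1 U.2.1 ≫ d.map =
      clopenSub.ι c.src (E U).1 (E U).2.1 ≫ c.map
    rw [← Category.assoc, hj, Category.assoc, h1]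
  · change (d.bundles.map (Pic.pull (mor (clopenSub.ι d.src U.1 U.2.1)))).map
      (Pic.pull (mor j.hom)) = c.bundles.map (Pic.pull (mor (clopenSub.ι c.src (E U).1 (E U).2.1)))
    rw [← Cycle.pull_comp_bundles, hj, Cycle.pull_comp_bundles, h2]

/-- Pushforward along a proper morphism. -/
def push (f : X ⟶ Y) (hf : IsProper (mor f)) : ZCyc X →+ ZCyc Y :=
  FreeAbelianGroup.map (Quotient.map (fun c => ⟨c.1.push f hf, c.2⟩)
    fun _ _ h => Cycle.push_congr f hf h)

/-- The first Chern class operator. -/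
def chern (L : Pic X.sch) : ZCyc X →+ ZCyc X :=
  FreeAbelianGroup.map (Quotient.map (fun c => ⟨c.1.chern L, c.2⟩)
    fun _ _ h => Cycle.chern_congr L h)

/-- The composition of the first Chern class operators of a list of line bundles. -/
def cherns (Ls : List (Pic X.sch)) : ZCyc X →+ ZCyc X :=
  Ls.foldr (fun L φ => (chern L).comp φ) (AddMonoidHom.id _)

theorem smooth_baseChange (g : Y ⟶ X) (hg : ∃ d, SmoothOfRelativeDimension d (mor g)) (c : Cycle X)
    (hc : Smooth c.src.str) : Smooth (c.baseChange g).src.str := by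
  obtain ⟨d, hd⟩ := hg
  have : Smooth (mor g) := hd.smooth
  have h : Smooth (mor (fibreProd.fst c.map g)) :=
    MorphismProperty.of_isPullback (P := @Smooth) (fibreProd.isPullback c.map g).flip this
  exact inferInstanceAs (Smooth (mor (fibreProd.fst c.map g) ≫ c.src.str))

/-- Pullback along a smooth equidimensional morphism. -/
def pull (g : Y ⟶ X) (hg : ∃ d, SmoothOfRelativeDimension d (mor g)) : ZCyc X →+ ZCyc Y :=
  FreeAbelianGroup.lift (Quotient.lift
    (fun c : CobCycle X => ofSmooth (c.1.baseChange g) (smooth_baseChange g hg c.1 c.2.1))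
    fun _ _ h => ofSmooth_congr (Cycle.baseChange_congr g h) _ _)

/-- A family of sets of relations in the groups of cobordism cycles. -/
abbrev Rel (k : Type u) [Field k] := ∀ X : QProj k, Set (ZCyc X)

/-- The subgroup generated by the elements `f_* c₁(L₁) ⋯ c₁(L_r) g^* ρ`, where `f : Y ⟶ X` is
proper, the `L_i` are line bundles on `Y`, `g : Y ⟶ W` is smooth and equidimensional and `ρ` is a
relation on `W`. -/
def imposed (R : Rel k) (X : QProj k) : AddSubgroup (ZCyc X) :=
  AddSubgroup.closure {x | ∃ (Y W : QProj k) (f : Y ⟶ X) (hf : IsProper (mor f))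
    (Ls : List (Pic Y.sch)) (g : Y ⟶ W) (hg : ∃ d, SmoothOfRelativeDimension d (mor g))
    (ρ : ZCyc W), ρ ∈ R W ∧ x = push f hf (cherns Ls (pull g hg ρ))}

/-- The dimension relations: `[V ⟶ X; L₁, …, L_r]` with `X` smooth and `r > dim V`. -/
def relDim : Rel k := fun X =>
  {ρ | Smooth X.str ∧ ∃ c : CobCycle X,
    topologicalKrullDim c.1.src.sch < (Multiset.card c.1.bundles : WithBot ℕ∞) ∧ ρ = of c}

/-- Lifts of the section relations `[V ⟶ X; L₁, …, L_r, L] - [Z ⟶ X; i^* L₁, …, i^* L_r]`, with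
`i : Z ⟶ V` the zero scheme of a section of `L` transverse to the zero section. -/
def relSect : Rel k := fun X =>
  {ρ | ∃ (c : CobCycle X) (L : LineBundle c.1.src.sch) (s : L.Sec) (Z : QProj k)
    (i : Z ⟶ c.1.src) (_ : s.IsRegular) (_ : s.IsZeroScheme (mor i)) (hZ : Smooth Z.str)
    (hi : IsProper (mor i)),
    ρ = of ⟨c.1.addBundle ⟦L⟧, c.2⟩ - ofSmooth (c.1.restrict i hi) hZ}

/-- The kernel of the projection from the group of cobordism cycles to the algebraic pre-cobordism
group. -/
def preRel (X : QProj k) : AddSubgroup (ZCyc X) := imposed relDim X ⊔ imposed relSect X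

end ZCyc

/-- The algebraic pre-cobordism group of `X`. -/
abbrev PreBordism (X : QProj k) : Type (u + 1) := ZCyc X ⧸ ZCyc.preRel X

/-- Lifts of the formal group law relations `(F_𝕃(c₁(L₁), c₁(L₂)) - c₁(L₁ ⊗ L₂)) α`, with `X`
smooth. -/
def ZCyc.relFGL (X : QProj k) : Set (Lazard ⊗[ℤ] ZCyc X) :=
  {ρ | ∃ (_ : Smooth X.str) (L₁ L₂ : Pic X.sch) (α : ZCyc X) (N : ℕ),
    (∀ i j, N ≤ i + j → (ZCyc.chern L₁)^[i] ((ZCyc.chern L₂)^[j] α) ∈ ZCyc.preRel X) ∧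
    ρ = fglDefect (ZCyc.chern L₁) (ZCyc.chern L₂) (ZCyc.chern (L₁.tensor L₂)) N α}

/-- The `𝕃`-submodule of `𝕃 ⊗ PreBordism X` obtained by imposing the formal group law
relations. -/
def ZCyc.imposedFGL (X : QProj k) : Submodule Lazard (Lazard ⊗[ℤ] PreBordism X) :=
  Submodule.span Lazard {x | ∃ (Y W : QProj k) (f : Y ⟶ X) (hf : IsProper (mor f))
    (Ls : List (Pic Y.sch)) (g : Y ⟶ W) (hg : ∃ d, SmoothOfRelativeDimension d (mor g)),
    ∃ ρ ∈ ZCyc.relFGL W, x = LinearMap.baseChange Lazard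
      (((QuotientAddGroup.mk' (ZCyc.preRel X)).comp ((ZCyc.push f hf).comp
        ((ZCyc.cherns Ls).comp (ZCyc.pull g hg)))).toIntLinearMap) ρ}

/-- The algebraic bordism group `Ω_*(X)`. -/
abbrev Omega (X : QProj k) : Type (u + 1) :=
  (Lazard ⊗[ℤ] PreBordism X) ⧸ ZCyc.imposedFGL X

theorem ZCyc.push_push (f : X ⟶ Y) (hf : IsProper (mor f)) (g : Y ⟶ Z) (hg : IsProper (mor g))
    (hfg : IsProper (mor (f ≫ g))) (x : ZCyc X) :
    ZCyc.push g hg (ZCyc.push f hf x) = ZCyc.push (f ≫ g) hfg x := by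
  have h : (ZCyc.push g hg).comp (ZCyc.push f hf) = ZCyc.push (f ≫ g) hfg := by
    refine FreeAbelianGroup.lift_ext _ _ fun q => ?_
    induction q using Quotient.inductionOn with
    | _ d =>
      refine congrArg FreeAbelianGroup.of (Quotient.sound ?_)
      exact ⟨CategoryTheory.Iso.refl _, (Category.id_comp _).trans (Category.assoc _ _ _).symm,
        Cycle.pull_id_bundles _ _⟩
  exact DFunLike.congr_fun h x

theorem ZCyc.imposed_le (R : ZCyc.Rel k) (f : X ⟶ Y) (hf : IsProper (mor f)) :
    ZCyc.imposed R X ≤ (ZCyc.imposed R Y).comap (ZCyc.push f hf) := by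
  refine (AddSubgroup.closure_le _).2 ?_
  rintro _ ⟨U, W, f', hf', Ls, g, hg, ρ, hρ, rfl⟩
  exact AddSubgroup.subset_closure ⟨U, W, f' ≫ f, isProper_comp hf' hf, Ls, g, hg, ρ, hρ,
    ZCyc.push_push _ _ _ _ _ _⟩

theorem ZCyc.preRel_le (f : X ⟶ Y) (hf : IsProper (mor f)) :
    ZCyc.preRel X ≤ (ZCyc.preRel Y).comap (ZCyc.push f hf) :=
  sup_le ((ZCyc.imposed_le _ f hf).trans (AddSubgroup.comap_mono le_sup_left))
    ((ZCyc.imposed_le _ f hf).trans (AddSubgroup.comap_mono le_sup_right))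

/-- Pushforward on algebraic pre-cobordism. -/
def PreBordism.push (f : X ⟶ Y) (hf : IsProper (mor f)) : PreBordism X →+ PreBordism Y :=
  QuotientAddGroup.map _ _ (ZCyc.push f hf) (ZCyc.preRel_le f hf)

theorem ZCyc.imposedFGL_le (f : X ⟶ Y) (hf : IsProper (mor f)) :
    ZCyc.imposedFGL X ≤ (ZCyc.imposedFGL Y).comap
      (LinearMap.baseChange Lazard (PreBordism.push f hf).toIntLinearMap) := by
  refine Submodule.span_le.2 ?_
  rintro _ ⟨U, W, f', hf', Ls, g, hg, ρ, hρ, rfl⟩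
  refine Submodule.subset_span ⟨U, W, f' ≫ f, isProper_comp hf' hf, Ls, g, hg, ρ, hρ, ?_⟩
  exact baseChange_comp_apply
    ((QuotientAddGroup.mk' (ZCyc.preRel X)).comp ((ZCyc.push f' hf').comp
      ((ZCyc.cherns Ls).comp (ZCyc.pull g hg)))) (PreBordism.push f hf)
    ((QuotientAddGroup.mk' (ZCyc.preRel Y)).comp ((ZCyc.push (f' ≫ f) (isProper_comp hf' hf)).comp
      ((ZCyc.cherns Ls).comp (ZCyc.pull g hg))))
    (fun x => congrArg (QuotientAddGroup.mk' (ZCyc.preRel Y))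
      (ZCyc.push_push f' hf' f hf (isProper_comp hf' hf) (ZCyc.cherns Ls (ZCyc.pull g hg x)))) ρ

/-- Pushforward on algebraic bordism. -/
def Omega.push (f : X ⟶ Y) (hf : IsProper (mor f)) : Omega X →ₗ[Lazard] Omega Y :=
  Submodule.mapQ _ _ (LinearMap.baseChange Lazard (PreBordism.push f hf).toIntLinearMap)
    (ZCyc.imposedFGL_le f hf)

/-- The class of a cobordism cycle in algebraic bordism. -/
def Omega.of (c : CobCycle X) : Omega X :=
  (ZCyc.imposedFGL X).mkQ (1 ⊗ₜ[ℤ] (QuotientAddGroup.mk' (ZCyc.preRel X) (ZCyc.of c)))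

/-- A cobordism cycle on `X` is a bivariant cobordism cycle for `X ⟶ pt`. -/
def CobCycle.toBiv (c : CobCycle X) : BivCycle (toPt X) :=
  ⟨c.1, by
    have h : mor (c.1.map ≫ toPt X) = c.1.src.str := mor_str c.1.map
    rw [h]
    exact c.2.1⟩

end Bordism

end Bordism
end

/-! Over the point, a bivariant cycle is a cycle whose source is smooth over `k`. The free groups
are therefore compared by `OB.toZ`, which cuts a source into its components, and by `ZCyc.toOB`,
which forgets that a source is integral; `toZ ∘ toOB` is the identity. It remains to see that both
maps respect the relations, and that cutting a source into components does not change its class in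
`OB1`.

From `OB1` to bordism. A relation of `OB1` over `pt` is pulled back along a smooth equidimensional
`g : pt ⟶ Z`. The base change `t : X' ⟶ Z'` of `g` is again smooth and equidimensional, so the
relation is a bordism relation pulled back along `t`, up to a splitting into components
(`OB.toZ_mem_preRel`, `OB.imposedFGL_le_ker`).

From bordism to `OB1` there are two obstacles.

Vanishing: a dimension relation of bordism may be pulled back along any smooth equidimensional `Y ⟶
W`. It then involves more than `dim V` line bundles pulled back from `V` to `V ×_W Y`, which may
have larger dimension than `V`. `prod_mem_relIdeal` shows that such products vanish all the same, by
induction on the number of bundles. If a bundle is generated by finitely many sections, Bertini's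
theorem in characteristic zero (`Generate.exists_transverse`) gives a transverse section, and the
section relation replaces `V` by a smooth zero scheme of smaller dimension. Any `L` satisfies `L ⊗ B
≅ M` with `B`, `M` so generated (`exists_generate`), and the formal group law `c₁(M) = c₁(L) + c₁(B)
+ c₁(L) c₁(B) h` deduces the vanishing for `L` from that for `M` and `B`.

Additivity (`chernPoly_eq_sum`): `W` is the zero scheme of a section of the pullback `L` of `O(1)`
to `W × ℙ¹`. The idempotents of the components of `W` factor `L` into bundles `L_C`, each with a
section that vanishes exactly on `C × {0}`. Products `c₁(L_C) c₁(L_D)` with `C ≠ D` vanish, since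
each bundle is trivial on the zero scheme of the other; so the formal group law gives `c₁(L) = ∑
c₁(L_C)`, and pushing forward to `W` yields `[W] = ∑ [C]`.

Both arguments take place in polynomial rings in first Chern classes, modulo the ideal `relIdeal` of
polynomials whose multiples all kill the fundamental class. -/

noncomputable section

namespace Bordism

open QProj

/-! ### Formal calculus of cycles: base change, projection formula, functoriality. -/

section Formal

variable {k : Type u} [Field k] {X Y Z : QProj k}

theorem QProj.hom_ext {f g : X ⟶ Y} (h : mor f = mor g) : f = g := by
  ext1; ext1; exact h

/-- The isomorphism of quasi-projective schemes given by an isomorphism over `k`. -/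
def QProj.isoMk (e : X.sch ≅ Y.sch) (h : e.hom ≫ Y.str = X.str) : X ≅ Y :=
  ObjectProperty.isoMk _ (Over.isoMk e h)

theorem isProper_of_isPullback {P W : QProj k} {p : P ⟶ W} {q : P ⟶ Y} {h : W ⟶ X} {t : Y ⟶ X}
    (sq : IsPullback (mor p) (mor q) (mor h) (mor t)) (hh : IsProper (mor h)) :
    IsProper (mor q) :=
  MorphismProperty.of_isPullback (P := @IsProper) sq hh

namespace Cycle

theorem iso_of_eq {c d : Cycle X} (h : c = d) : c.Iso d := h ▸ Iso.refl c

/-- The base change of a cycle, computed by an arbitrary fibre square. -/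
theorem iso_baseChange {c : Cycle X} {t : Y ⟶ X} {d : Cycle Y} (p : d.src ⟶ c.src)
    (sq : IsPullback (mor p) (mor d.map) (mor c.map) (mor t))
    (hb : d.bundles = c.bundles.map (Pic.pull (mor p))) : d.Iso (c.baseChange t) := by
  have h1 := sq.isoIsPullback_hom_fst _ _ (fibreProd.isPullback c.map t)
  have h2 := sq.isoIsPullback_hom_snd _ _ (fibreProd.isPullback c.map t)
  let e : d.src ≅ fibreProd c.map t :=
    QProj.isoMk (sq.isoIsPullback _ _ (fibreProd.isPullback c.map t)) (by
      rw [← mor_str (fibreProd.fst c.map t), ← Category.assoc, h1, mor_str])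
  have e1 : e.hom ≫ fibreProd.fst c.map t = p := QProj.hom_ext h1
  have e2 : e.hom ≫ fibreProd.snd c.map t = d.map := QProj.hom_ext h2
  refine ⟨e, e2, ?_⟩
  change (c.bundles.map (Pic.pull (mor (fibreProd.fst c.map t)))).map (Pic.pull (mor e.hom)) = _
  rw [← Cycle.pull_comp_bundles, e1, hb]

theorem baseChange_id (c : Cycle X) : (c.baseChange (𝟙 X)).Iso c :=
  Iso.symm (iso_baseChange (𝟙 c.src) (IsPullback.id_horiz (mor c.map)) (pull_id_bundles _ _).symm)

theorem baseChange_push {P : QProj k} {p : P ⟶ X} {q : P ⟶ Z} {f : X ⟶ Y} {t : Z ⟶ Y}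
    (sq : IsPullback (mor p) (mor q) (mor f) (mor t)) (hf : IsProper (mor f))
    (hq : IsProper (mor q)) (c : Cycle X) :
    ((c.baseChange p).push q hq).Iso ((c.push f hf).baseChange t) :=
  iso_baseChange (c := c.push f hf) (d := (c.baseChange p).push q hq) (fibreProd.fst c.map p)
    ((fibreProd.isPullback c.map p).paste_vert sq) rfl

theorem baseChange_baseChange (t : Y ⟶ X) (s : Z ⟶ Y) (c : Cycle X) :
    ((c.baseChange t).baseChange s).Iso (c.baseChange (s ≫ t)) :=
  iso_baseChange (d := (c.baseChange t).baseChange s)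
    (fibreProd.fst (fibreProd.snd c.map t) s ≫ fibreProd.fst c.map t)
    (((fibreProd.isPullback (fibreProd.snd c.map t) s).flip.paste_vert
      (fibreProd.isPullback c.map t).flip).flip) (pull_comp_bundles _ _ _).symm

theorem baseChange_chern (t : Y ⟶ X) (L : Pic X.sch) (c : Cycle X) :
    (c.chern L).baseChange t = (c.baseChange t).chern (Pic.pull (mor t) L) := by
  have h : mor (fibreProd.fst c.map t) ≫ mor c.map = mor (fibreProd.snd c.map t) ≫ mor t :=
    (fibreProd.isPullback c.map t).w
  have h2 : (Pic.pull (mor c.map) L ::ₘ c.bundles).map (Pic.pull (mor (fibreProd.fst c.map t))) =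
      Pic.pull (mor (fibreProd.snd c.map t)) (Pic.pull (mor t) L) ::ₘ
        c.bundles.map (Pic.pull (mor (fibreProd.fst c.map t))) := by
    rw [Multiset.map_cons, ← Pic.pull_comp, ← Pic.pull_comp, h]
  exact congrArg (Cycle.mk _ _ (c.baseChange t).isProper) h2

theorem chern_push (f : X ⟶ Y) (hf : IsProper (mor f)) (L : Pic Y.sch) (c : Cycle X) :
    (c.push f hf).chern L = (c.chern (Pic.pull (mor f) L)).push f hf :=
  congrArg (fun M => Cycle.mk c.src (c.map ≫ f) (c.push f hf).isProper (M ::ₘ c.bundles))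
    (Pic.pull_comp (mor f) (mor c.map) L)

theorem chern_chern (L M : Pic X.sch) (c : Cycle X) :
    (c.chern L).chern M = (c.chern M).chern L :=
  congrArg (Cycle.mk _ _ c.isProper) (Multiset.cons_swap _ _ _)

theorem restrict_restrict {V W : QProj k} (c : Cycle X) (i : V ⟶ c.src) (hi : IsProper (mor i))
    (j : W ⟶ V) (hj : IsProper (mor j)) (hij : IsProper (mor (j ≫ i))) :
    ((c.restrict i hi).restrict j hj).Iso (c.restrict (j ≫ i) hij) :=
  ⟨CategoryTheory.Iso.refl _, (Category.id_comp _).trans (Category.assoc _ _ _),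
    (pull_id_bundles _ _).trans (pull_comp_bundles _ _ _)⟩

theorem baseChange_restrict {V : QProj k} (t : Y ⟶ X) (c : Cycle X) (i : V ⟶ c.src)
    (hi : IsProper (mor i)) {P : QProj k} {j : P ⟶ (c.baseChange t).src} {r : P ⟶ V}
    (sq : IsPullback (mor r) (mor j) (mor i) (mor (fibreProd.fst c.map t)))
    (hj : IsProper (mor j)) :
    ((c.baseChange t).restrict j hj).Iso ((c.restrict i hi).baseChange t) := by
  have h : r ≫ i = j ≫ fibreProd.fst c.map t := QProj.hom_ext sq.w
  exact iso_baseChange (c := c.restrict i hi) (d := (c.baseChange t).restrict j hj) r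
    (sq.flip.paste_horiz (fibreProd.isPullback c.map t).flip).flip
    ((pull_comp_bundles _ _ _).symm.trans ((congrArg (fun m => c.bundles.map (Pic.pull (mor m)))
      h.symm).trans (pull_comp_bundles _ _ _)))

end Cycle

namespace OB

@[elab_as_elim]
theorem induction {f : X ⟶ Y} {P : OB f → Prop} (x : OB f) (h0 : P 0) (hof : ∀ c, P (of c))
    (hneg : ∀ c, P (of c) → P (-of c)) (hadd : ∀ x y, P x → P y → P (x + y)) : P x := by
  refine FreeAbelianGroup.induction_on x h0 (fun q => ?_) (fun q => ?_) hadd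
  · induction q using Quotient.inductionOn with
    | _ c => exact hof c
  · induction q using Quotient.inductionOn with
    | _ c => exact hneg c

theorem hom_ext {f : X ⟶ Y} {A : Type*} [AddCommGroup A] {φ ψ : OB f →+ A}
    (h : ∀ c, φ (of c) = ψ (of c)) : φ = ψ :=
  FreeAbelianGroup.lift_ext _ _ fun q => by
    induction q using Quotient.inductionOn with
    | _ c => exact h c

theorem of_eq {f : X ⟶ Y} {c d : BivCycle f} (h : c.1.Iso d.1) : of c = of d :=
  congrArg FreeAbelianGroup.of (Quotient.sound h)

/-- The additive map determined by an invariant of bivariant cycles. -/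
def lift {f : X ⟶ Y} {A : Type*} [AddCommGroup A] (F : BivCycle f → A)
    (hF : ∀ c d : BivCycle f, c.1.Iso d.1 → F c = F d) : OB f →+ A :=
  FreeAbelianGroup.lift (Quotient.lift F hF)

theorem lift_of {f : X ⟶ Y} {A : Type*} [AddCommGroup A] (F : BivCycle f → A)
    (hF : ∀ c d : BivCycle f, c.1.Iso d.1 → F c = F d) (c : BivCycle f) :
    lift F hF (of c) = F c := FreeAbelianGroup.lift_apply_of _ _

theorem chern_comm (f : X ⟶ Y) (L M : Pic X.sch) (x : OB f) :
    chern f L (chern f M x) = chern f M (chern f L x) := by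
  refine DFunLike.congr_fun (f := (chern f L).comp (chern f M))
    (g := (chern f M).comp (chern f L)) (hom_ext fun c => ?_) x
  exact of_eq (Cycle.iso_of_eq (Cycle.chern_chern M L c.1))

theorem chern_push (f : X ⟶ Y) (hf : IsProper (mor f)) {g : Y ⟶ Z} {g' : X ⟶ Z}
    (w : f ≫ g = g') (L : Pic Y.sch) (x : OB g') :
    chern g L (push f hf w x) = push f hf w (chern g' (Pic.pull (mor f) L) x) := by
  refine DFunLike.congr_fun (f := (chern g L).comp (push f hf w))
    (g := (push f hf w).comp (chern g' (Pic.pull (mor f) L))) (hom_ext fun c => ?_) x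
  exact of_eq (Cycle.iso_of_eq (Cycle.chern_push f hf L c.1))

theorem cherns_cons (f : X ⟶ Y) (L : Pic X.sch) (Ls : List (Pic X.sch)) (x : OB f) :
    cherns f (L :: Ls) x = chern f L (cherns f Ls x) := rfl

theorem cherns_nil (f : X ⟶ Y) (x : OB f) : cherns f [] x = x := rfl

theorem cherns_append (f : X ⟶ Y) (Ls Ms : List (Pic X.sch)) (x : OB f) :
    cherns f (Ls ++ Ms) x = cherns f Ls (cherns f Ms x) := by
  induction Ls with
  | nil => rfl
  | cons L Ls ih => rw [List.cons_append, cherns_cons, cherns_cons, ih]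

theorem chern_cherns (f : X ⟶ Y) (L : Pic X.sch) (Ls : List (Pic X.sch)) (x : OB f) :
    chern f L (cherns f Ls x) = cherns f Ls (chern f L x) := by
  induction Ls with
  | nil => rfl
  | cons M Ls ih => rw [cherns_cons, cherns_cons, chern_comm, ih]

theorem cherns_push (f : X ⟶ Y) (hf : IsProper (mor f)) {g : Y ⟶ Z} {g' : X ⟶ Z}
    (w : f ≫ g = g') (Ls : List (Pic Y.sch)) (x : OB g') :
    cherns g Ls (push f hf w x) = push f hf w (cherns g' (Ls.map (Pic.pull (mor f))) x) := by
  induction Ls with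
  | nil => rfl
  | cons L Ls ih => rw [List.map_cons, cherns_cons, cherns_cons, ih, chern_push]

theorem cherns_of (f : X ⟶ Y) (Ls : List (Pic X.sch)) (c : BivCycle f) :
    cherns f Ls (of c) = of ⟨⟨c.1.src, c.1.map, c.1.isProper,
      (Ls.map (Pic.pull (mor c.1.map)) : Multiset _) + c.1.bundles⟩, c.2⟩ := by
  induction Ls with
  | nil => exact of_eq (Cycle.iso_of_eq (congrArg (Cycle.mk _ _ c.1.isProper) (zero_add _).symm))
  | cons L Ls ih =>
    rw [cherns_cons, ih]
    refine of_eq (Cycle.iso_of_eq (congrArg (Cycle.mk _ _ c.1.isProper) ?_))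
    exact (Multiset.cons_add _ _ _).symm

variable {X' Y' : QProj k}

theorem pull_chern {f : X ⟶ Y} {f' : X' ⟶ Y'} {t : X' ⟶ X} {g : Y' ⟶ Y}
    (sq : IsPullback (mor t) (mor f') (mor f) (mor g)) (L : Pic X.sch) (x : OB f) :
    pull sq (chern f L x) = chern f' (Pic.pull (mor t) L) (pull sq x) := by
  refine DFunLike.congr_fun (f := (pull sq).comp (chern f L))
    (g := (chern f' (Pic.pull (mor t) L)).comp (pull sq)) (hom_ext fun c => ?_) x
  exact of_eq (Cycle.iso_of_eq (Cycle.baseChange_chern t L c.1))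

theorem pull_cherns {f : X ⟶ Y} {f' : X' ⟶ Y'} {t : X' ⟶ X} {g : Y' ⟶ Y}
    (sq : IsPullback (mor t) (mor f') (mor f) (mor g)) (Ls : List (Pic X.sch)) (x : OB f) :
    pull sq (cherns f Ls x) = cherns f' (Ls.map (Pic.pull (mor t))) (pull sq x) := by
  induction Ls with
  | nil => rfl
  | cons L Ls ih => rw [List.map_cons, cherns_cons, cherns_cons, pull_chern, ih]

theorem pull_push {W W' : QProj k} {f : X ⟶ Y} {f' : X' ⟶ Y'} {t : X' ⟶ X} {g : Y' ⟶ Y}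
    (sq : IsPullback (mor t) (mor f') (mor f) (mor g)) {h : W ⟶ X} {h' : W' ⟶ X'} {s : W' ⟶ W}
    (sq' : IsPullback (mor s) (mor h') (mor h) (mor t)) (hh : IsProper (mor h))
    (hh' : IsProper (mor h')) {e : W ⟶ Y} {e' : W' ⟶ Y'} (w : h ≫ f = e) (w' : h' ≫ f' = e')
    (sq'' : IsPullback (mor s) (mor e') (mor e) (mor g)) (x : OB e) :
    pull sq (push h hh w x) = push h' hh' w' (pull sq'' x) := by
  refine DFunLike.congr_fun (f := (pull sq).comp (push h hh w))
    (g := (push h' hh' w').comp (pull sq'')) (hom_ext fun c => ?_) x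
  exact of_eq (Cycle.baseChange_push sq' hh hh' c.1).symm

theorem pull_pull {X'' Y'' : QProj k} {f : X ⟶ Y} {f' : X' ⟶ Y'} {f'' : X'' ⟶ Y''} {t : X' ⟶ X}
    {g : Y' ⟶ Y} {t' : X'' ⟶ X'} {g' : Y'' ⟶ Y'}
    (sq : IsPullback (mor t) (mor f') (mor f) (mor g))
    (sq' : IsPullback (mor t') (mor f'') (mor f') (mor g'))
    (sq'' : IsPullback (mor (t' ≫ t)) (mor f'') (mor f) (mor (g' ≫ g))) (x : OB f) :
    pull sq' (pull sq x) = pull sq'' x := by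
  refine DFunLike.congr_fun (f := (pull sq').comp (pull sq)) (g := pull sq'')
    (hom_ext fun c => ?_) x
  exact of_eq (Cycle.baseChange_baseChange t t' c.1)

theorem pull_id {f : X ⟶ Y} (sq : IsPullback (mor (𝟙 X)) (mor f) (mor f) (mor (𝟙 Y)))
    (x : OB f) : pull sq x = x := by
  refine DFunLike.congr_fun (f := pull sq) (g := AddMonoidHom.id _) (hom_ext fun c => ?_) x
  exact of_eq (Cycle.baseChange_id c.1)

/-- A morphism that is smooth of some relative dimension. -/
def _root_.Bordism.IsSmoothEquidim (g : X ⟶ Y) : Prop := ∃ d, SmoothOfRelativeDimension d (mor g)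

theorem _root_.Bordism.IsSmoothEquidim.smooth {g : X ⟶ Y} (hg : IsSmoothEquidim g) :
    Smooth (mor g) := by
  obtain ⟨d, hd⟩ := hg
  exact hd.smooth

theorem _root_.Bordism.IsSmoothEquidim.comp {g : X ⟶ Y} {h : Y ⟶ Z} (hg : IsSmoothEquidim g)
    (hh : IsSmoothEquidim h) : IsSmoothEquidim (g ≫ h) := by
  obtain ⟨d, hd⟩ := hg
  obtain ⟨e, he⟩ := hh
  exact ⟨d + e, inferInstanceAs (SmoothOfRelativeDimension (d + e) (mor g ≫ mor h))⟩

theorem _root_.Bordism.IsSmoothEquidim.id (X : QProj k) : IsSmoothEquidim (𝟙 X) :=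
  ⟨0, inferInstanceAs (SmoothOfRelativeDimension 0 (𝟙 X.sch))⟩

theorem _root_.Bordism.IsSmoothEquidim.of_isPullback {g : Y' ⟶ Y} (hg : IsSmoothEquidim g)
    {t : X' ⟶ X} {f' : X' ⟶ Y'} {f : X ⟶ Y}
    (sq : IsPullback (mor t) (mor f') (mor f) (mor g)) : IsSmoothEquidim t := by
  obtain ⟨d, hd⟩ := hg
  have := smoothOfRelativeDimension_isStableUnderBaseChange d
  exact ⟨d, MorphismProperty.of_isPullback (P := @SmoothOfRelativeDimension d) sq.flip hd⟩

theorem _root_.Bordism.smooth_str_of_smooth {g : X ⟶ Y} (hg : Smooth (mor g))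
    (hY : Smooth Y.str) : Smooth X.str := by
  rw [← mor_str g]
  infer_instance

theorem _root_.Bordism.Cycle.smooth_baseChange (g : Y ⟶ X) (hg : Smooth (mor g)) (c : Cycle X)
    (hc : Smooth c.src.str) : Smooth (c.baseChange g).src.str :=
  smooth_str_of_smooth (g := fibreProd.fst c.map g)
    (MorphismProperty.of_isPullback (P := @Smooth) (fibreProd.isPullback c.map g).flip hg) hc

theorem _root_.Bordism.smooth_toPt_iff (c : Cycle X) :
    Smooth (mor (c.map ≫ toPt X)) ↔ Smooth c.src.str := by
  have h : mor (c.map ≫ toPt X) = c.src.str := mor_str c.map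
  exact iff_of_eq (congrArg Smooth h)

/-- The class of a cycle with smooth source in the covariant theory. -/
def ofCyc (c : Cycle X) (hc : Smooth c.src.str) : OB (toPt X) := of ⟨c, (smooth_toPt_iff c).2 hc⟩

theorem ofCyc_congr {c d : Cycle X} (h : c.Iso d) (hc : Smooth c.src.str)
    (hd : Smooth d.src.str) : ofCyc c hc = ofCyc d hd := of_eq h

theorem hom_ext_toPt {A : Type*} [AddCommGroup A] {φ ψ : OB (toPt X) →+ A}
    (h : ∀ c hc, φ (ofCyc c hc) = ψ (ofCyc c hc)) : φ = ψ :=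
  hom_ext fun c => h c.1 ((smooth_toPt_iff c.1).1 c.2)

/-- Covariant pullback along a smooth morphism. -/
def spull (g : Y ⟶ X) (hg : Smooth (mor g)) : OB (toPt X) →+ OB (toPt Y) :=
  lift (fun c => ofCyc (c.1.baseChange g)
    (c.1.smooth_baseChange g hg ((smooth_toPt_iff c.1).1 c.2)))
    fun _ _ h => ofCyc_congr (Cycle.baseChange_congr g h) _ _

theorem spull_of (g : Y ⟶ X) (hg : Smooth (mor g)) (c : Cycle X) (hc : Smooth c.src.str) :
    spull g hg (ofCyc c hc) = ofCyc (c.baseChange g) (c.smooth_baseChange g hg hc) :=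
  lift_of _ _ _

/-- The covariant pullback is not among the bivariant operations. It is the pullback of bordism
before the source is cut into components, so its compatibilities follow from the universal property
of fibre products alone; `ZCyc.pull_eq` later transfers them to `ZCyc`. -/
theorem spull_push {P : QProj k} {p : P ⟶ X} {q : P ⟶ Z} {f : X ⟶ Y} {t : Z ⟶ Y}
    (sq : IsPullback (mor p) (mor q) (mor f) (mor t)) (hf : IsProper (mor f))
    (hq : IsProper (mor q)) (hp : Smooth (mor p)) (ht : Smooth (mor t)) (x : OB (toPt X)) :
    spull t ht (push f hf (toPt_comp f) x) = push q hq (toPt_comp q) (spull p hp x) := by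
  refine DFunLike.congr_fun (f := (spull t ht).comp (push f hf (toPt_comp f)))
    (g := (push q hq (toPt_comp q)).comp (spull p hp)) (hom_ext_toPt fun c hc => ?_) x
  exact of_eq (Cycle.baseChange_push sq hf hq c).symm

theorem spull_cherns (g : Y ⟶ X) (hg : Smooth (mor g)) (Ls : List (Pic X.sch))
    (x : OB (toPt X)) : spull g hg (cherns _ Ls x) =
      cherns _ (Ls.map (Pic.pull (mor g))) (spull g hg x) := by
  induction Ls with
  | nil => rfl
  | cons L Ls ih =>
    rw [List.map_cons, cherns_cons, cherns_cons, ← ih]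
    refine DFunLike.congr_fun (f := (spull g hg).comp (chern _ L))
      (g := (chern _ (Pic.pull (mor g) L)).comp (spull g hg)) (hom_ext_toPt fun c hc => ?_) _
    exact of_eq (Cycle.iso_of_eq (Cycle.baseChange_chern g L c))

theorem spull_spull (g : Y ⟶ X) (hg : Smooth (mor g)) (h : Z ⟶ Y) (hh : Smooth (mor h))
    (hhg : Smooth (mor (h ≫ g))) (x : OB (toPt X)) :
    spull h hh (spull g hg x) = spull (h ≫ g) hhg x := by
  refine DFunLike.congr_fun (f := (spull h hh).comp (spull g hg)) (g := spull _ hhg)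
    (hom_ext_toPt fun c hc => ?_) x
  exact of_eq (Cycle.baseChange_baseChange g h c)

theorem spull_id (h : Smooth (mor (𝟙 X))) (x : OB (toPt X)) : spull (𝟙 X) h x = x := by
  refine DFunLike.congr_fun (f := spull (𝟙 X) h) (g := AddMonoidHom.id _)
    (hom_ext_toPt fun c hc => ?_) x
  exact of_eq (Cycle.baseChange_id c)

end OB
end Formal
end Bordism

namespace Bordism

/-! ### Smooth schemes over a field are disjoint unions of integral ones. -/

section IntegralComponents

/-- A standard étale algebra over a polynomial ring over a field is integrally closed in its
base change to the field of rational functions. -/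
theorem exists_tmul_one_of_isIntegral {R B K : Type*} [CommRing R] [IsDomain R]
    [IsIntegrallyClosed R] [CommRing B] [Algebra R B] [Algebra.Smooth R B] [Field K] [Algebra R K]
    [IsFractionRing R K] {x : B ⊗[R] K} (hx : IsIntegral B x) : ∃ b : B, b ⊗ₜ[R] (1 : K) = x := by
  -- Integral closure commutes with smooth base change, so `x` comes from `B ⊗ integralClosure R K`,
  -- and the integral closure of the normal domain `R` in `K` is `R`.
  obtain ⟨y, hy⟩ := (TensorProduct.toIntegralClosure_bijective_of_smooth
    (R := R) (S := B) (B := K)).2 ⟨x, hx⟩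
  have hy' : Algebra.TensorProduct.map (AlgHom.id B B) (integralClosure R K).val y = x :=
    congrArg Subtype.val hy
  rw [← hy']
  clear hy hy'
  induction y using TensorProduct.induction_on with
  | zero => exact ⟨0, by simp⟩
  | tmul b c =>
    obtain ⟨r, hr⟩ := IsIntegrallyClosed.isIntegral_iff.1 c.2
    refine ⟨r • b, ?_⟩
    rw [TensorProduct.smul_tmul, Algebra.TensorProduct.map_tmul, Algebra.smul_def, mul_one, hr]
    rfl
  | add y z hy hz =>
    obtain ⟨b, hb⟩ := hy
    obtain ⟨c, hc⟩ := hz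
    exact ⟨b + c, by rw [TensorProduct.add_tmul, hb, hc, map_add]⟩

/-- The generic fibre `B ⊗ K` is étale over `K`, hence a finite product of fields, and contains `B`
by flatness. Its primitive idempotents are roots of `X² - X`, so they are integral over `B` and lie
in `B` by normality of `R`. They sum to `1`, so one of them is outside `p`; inverting it leaves a
subring of a single factor. -/
theorem exists_isDomain_away_of_etale {R B : Type*} [CommRing R] [IsDomain R]
    [IsIntegrallyClosed R] [CommRing B] [Algebra R B] [Algebra.Etale R B] (p : Ideal B)
    [p.IsPrime] : ∃ e ∉ p, IsDomain (Localization.Away e) := by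
  let K := FractionRing R
  have : Algebra.Smooth R B := {}
  have : Module.Flat R B := inferInstance
  obtain ⟨I, _, A, _, _, φ, -⟩ := (Algebra.Etale.iff_exists_algEquiv_prod K (K ⊗[R] B)).1
    inferInstance
  classical
  have := Fintype.ofFinite I
  have hB : Nontrivial B := ⟨0, 1, fun h => (Ideal.ne_top_iff_one p).1 ‹p.IsPrime›.ne_top
    (h ▸ p.zero_mem)⟩
  let ψ : B ⊗[R] K ≃+* ∀ i, A i :=
    (Algebra.TensorProduct.comm R B K).toRingEquiv.trans φ.toRingEquiv
  let ι (b : B) : ∀ i, A i := ψ (b ⊗ₜ 1)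
  have hι0 : ι 0 = 0 := by simp [ι]
  have hι1 : ι 1 = 1 := map_one ψ
  have hιm (a b : B) : ι (a * b) = ι a * ι b := by
    simp only [ι, ← map_mul, Algebra.TensorProduct.tmul_mul_tmul, mul_one]
  have hιa (a b : B) : ι (a + b) = ι a + ι b := by
    simp only [ι, ← map_add, TensorProduct.add_tmul]
  have hinj : Function.Injective ι := ψ.injective.comp
    (Algebra.TensorProduct.includeLeft_injective (R := R) (S := R) (A := B) (B := K)
      (IsFractionRing.injective R K))
  have hidem (i : I) : ∃ e : B, ι e = Pi.single i 1 := by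
    have h : IsIntegral B (ψ.symm (Pi.single i 1)) := by
      refine ⟨Polynomial.X ^ 2 - Polynomial.X, Polynomial.monic_X_pow_sub (by rw [Polynomial.degree_X]; norm_num), ?_⟩
      rw [Polynomial.eval₂_sub, Polynomial.eval₂_X_pow, Polynomial.eval₂_X, ← map_pow, pow_two,
        ← Pi.single_mul, mul_one, sub_self]
    obtain ⟨e, he⟩ := exists_tmul_one_of_isIntegral h
    exact ⟨e, by simp only [ι, he, RingEquiv.apply_symm_apply]⟩
  choose e he using hidem
  have hsum : ∑ i, e i = 1 := by
    apply hinj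
    have : ∀ s : Finset I, ι (∑ i ∈ s, e i) = ∑ i ∈ s, ι (e i) := fun s => by
      induction s using Finset.induction_on with
      | empty => simpa using hι0
      | insert a s ha ih => rw [Finset.sum_insert ha, Finset.sum_insert ha, hιa, ih]
    rw [this, hι1]
    simp only [he]
    exact Finset.univ_sum_single 1
  obtain ⟨i, hi⟩ : ∃ i, e i ∉ p := by
    by_contra! h
    exact (Ideal.ne_top_iff_one p).1 ‹p.IsPrime›.ne_top (hsum ▸ p.sum_mem fun i _ => h i)
  refine ⟨e i, hi, ?_⟩
  -- An element with zero `i`-th coordinate is annihilated by `e i`, so it dies in the localization: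
  -- zero divisors there can be tested in the field `A i`.
  have hz (a : B) (ha : ι a i = 0) : algebraMap B (Localization.Away (e i)) a = 0 := by
    refine (IsLocalization.map_eq_zero_iff (Submonoid.powers (e i)) _ a).2
      ⟨⟨e i, Submonoid.mem_powers _⟩, hinj ?_⟩
    rw [hιm, hι0, he]
    ext j
    by_cases h : j = i
    · subst h; simp [ha]
    · simp [h]
  have hpe (n : ℕ) : ι (e i ^ n) i = 1 := by
    induction n with
    | zero => simp [hι1]
    | succ n ih => rw [pow_succ, hιm, Pi.mul_apply, ih, he]; simp
  have hnt : Nontrivial (Localization.Away (e i)) := by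
    refine ⟨⟨1, 0, fun h => hi ?_⟩⟩
    rw [← map_one (algebraMap B _), IsLocalization.map_eq_zero_iff (Submonoid.powers (e i))] at h
    obtain ⟨⟨_, n, rfl⟩, hn⟩ := h
    have h2 := congrFun (congrArg ι hn) i
    rw [mul_one, hι0] at h2
    exact absurd ((hpe n).symm.trans h2) one_ne_zero
  have : NoZeroDivisors (Localization.Away (e i)) := ⟨fun {x y} hxy => by
    obtain ⟨a, s, rfl⟩ := IsLocalization.exists_mk'_eq (Submonoid.powers (e i)) x
    obtain ⟨b, t, rfl⟩ := IsLocalization.exists_mk'_eq (Submonoid.powers (e i)) y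
    rw [← IsLocalization.mk'_mul, IsLocalization.mk'_eq_zero_iff] at hxy
    obtain ⟨⟨_, n, rfl⟩, hn⟩ := hxy
    have h2 := congrFun (congrArg ι hn) i
    rw [hιm, hιm, Pi.mul_apply, hι0] at h2
    rw [hpe n, one_mul] at h2
    rcases mul_eq_zero.1 h2 with h | h
    · left; rw [IsLocalization.mk'_eq_mul_mk'_one, hz a h, zero_mul]
    · right; rw [IsLocalization.mk'_eq_mul_mk'_one, hz b h, zero_mul]⟩
  exact NoZeroDivisors.to_isDomain _

/-- Every point of the spectrum of a smooth algebra over a field has an integral open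
neighbourhood. -/
theorem exists_isOpenImmersion_isIntegral {K A : Type u} [Field K] [CommRing A] [Algebra K A]
    [Algebra.Smooth K A] (p : PrimeSpectrum A) :
    ∃ (D : CommRingCat.{u}) (_ : IsDomain D) (φ : Spec D ⟶ Spec (.of A)), IsOpenImmersion φ ∧
      p ∈ Set.range φ := by
  -- Near `p` a smooth algebra is étale over a polynomial ring, which is a normal domain.
  obtain ⟨f, hf, n, alg, tower, et⟩ :=
    Algebra.IsSmoothAt.exists_isStandardEtale_mvPolynomial (R := K) (p := p.asIdeal)
  let φ₁ : Spec (.of (Localization.Away f)) ⟶ Spec (.of A) :=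
    Spec.map (CommRingCat.ofHom (algebraMap A (Localization.Away f)))
  have h₁ : IsOpenImmersion φ₁ := Scheme.isOpenImmersion_SpecMap_localizationAway (R := .of A) f
  obtain ⟨q, hq⟩ : p ∈ Set.range φ₁ := by
    have := PrimeSpectrum.localization_away_comap_range (Localization.Away f) f
    change p ∈ Set.range (PrimeSpectrum.comap (algebraMap A (Localization.Away f)))
    rw [this]
    exact hf
  have hp : (PrimeSpectrum.asIdeal q).IsPrime := PrimeSpectrum.isPrime q
  obtain ⟨e, he, hD⟩ := exists_isDomain_away_of_etale (R := MvPolynomial (Fin n) K)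
    (B := Localization.Away f) (PrimeSpectrum.asIdeal q)
  let φ₂ : Spec (.of (Localization.Away e)) ⟶ Spec (.of (Localization.Away f)) :=
    Spec.map (CommRingCat.ofHom (algebraMap _ (Localization.Away e)))
  have h₂ : IsOpenImmersion φ₂ := Scheme.isOpenImmersion_SpecMap_localizationAway (R := .of (Localization.Away f)) e
  obtain ⟨r, hr⟩ : q ∈ Set.range φ₂ := by
    have := PrimeSpectrum.localization_away_comap_range (Localization.Away e) e
    change q ∈ Set.range (PrimeSpectrum.comap (algebraMap _ (Localization.Away e)))
    rw [this]
    exact he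
  refine ⟨.of (Localization.Away e), hD, φ₂ ≫ φ₁, inferInstance, r, ?_⟩
  rw [Scheme.Hom.comp_apply, hr, hq]

open QProj

variable {k : Type u} [Field k]

/-- The structure of a `k`-algebra on the ring of functions on an open subset. -/
def QProj.scalars (X : QProj k) (U : X.sch.Opens) : k →+* Γ(X.sch, U) :=
  (X.str.appLE ⊤ U le_top).hom.comp (Scheme.ΓSpecIso (.of k)).inv.hom

theorem QProj.res_scalars (X : QProj k) {U V : X.sch.Opens} (h : V ≤ U) (a : k) :
    res h (X.scalars U a) = X.scalars V a := by
  have := Scheme.Hom.appLE_map X.str (U := ⊤) (V := U) le_top (homOfLE h).op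
  exact congrArg (fun φ => φ.hom ((Scheme.ΓSpecIso (.of k)).inv.hom a)) this

theorem QProj.smooth_scalars (X : QProj k) (hX : Smooth X.str) {U : X.sch.Opens}
    (hU : IsAffineOpen U) : (X.scalars U).Smooth :=
  RingHom.Smooth.respectsIso.2 _ (Scheme.ΓSpecIso (.of k)).symm.commRingCatIsoToRingEquiv
    (X.str.smooth_appLE (isAffineOpen_top _) hU le_top)

theorem QProj.finiteType_scalars (X : QProj k) {U : X.sch.Opens}
    (hU : IsAffineOpen U) : (X.scalars U).FiniteType := by
  have := X.property.locallyOfFiniteType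
  exact RingHom.finiteType_respectsIso.2 _
    (Scheme.ΓSpecIso (.of k)).symm.commRingCatIsoToRingEquiv
    (LocallyOfFiniteType.finiteType_appLE X.str (isAffineOpen_top _) hU le_top)

theorem QProj.exists_isIntegral_nbhd (X : QProj k) (hX : Smooth X.str) (x : X.sch) :
    ∃ U : X.sch.Opens, x ∈ U ∧ IsAffineOpen U ∧ IsIntegral U.toScheme := by
  obtain ⟨_, ⟨V, hV, rfl⟩, hxV, -⟩ :=
    X.sch.isBasis_affineOpens.exists_subset_of_mem_open (Set.mem_univ x) isOpen_univ
  algebraize [X.scalars V]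
  have : Algebra.Smooth k Γ(X.sch, V) := X.smooth_scalars hX hV
  obtain ⟨D, hD, φ, hφ, r, hr⟩ := exists_isOpenImmersion_isIntegral (K := k)
    (hV.primeIdealOf ⟨x, hxV⟩)
  let ψ : Spec D ⟶ X.sch := φ ≫ hV.fromSpec
  have hψ : IsOpenImmersion ψ := by
    have := hV.isOpenImmersion_fromSpec
    exact inferInstanceAs (IsOpenImmersion (φ ≫ hV.fromSpec))
  have hx : ψ r = x := by
    change (φ ≫ hV.fromSpec) r = x
    rw [Scheme.Hom.comp_apply]
    exact (congrArg hV.fromSpec hr).trans (hV.fromSpec_primeIdealOf ⟨x, hxV⟩)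
  have hI : IsIntegral ψ.opensRange.toScheme := by
    have : Nonempty ψ.opensRange.toScheme := ⟨⟨x, r, hx⟩⟩
    exact isIntegral_of_isOpenImmersion (inv (ψ.isoOpensRange.hom))
  exact ⟨ψ.opensRange, ⟨r, hx⟩, isAffineOpen_opensRange ψ, hI⟩

theorem QProj.isReduced (X : QProj k) (hX : Smooth X.str) : IsReduced X.sch := by
  have : ∀ x : X.sch, _root_.IsReduced (X.sch.presheaf.stalk x) := fun x => by
    obtain ⟨U, hxU, -, hI⟩ := X.exists_isIntegral_nbhd hX x
    have e := (U.stalkIso ⟨x, hxU⟩).symm.commRingCatIsoToRingEquiv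
    have := isReduced_of_isIntegral (X := U.toScheme)
    have := isReduced_stalk_of_isReduced (X := U.toScheme) ⟨x, hxU⟩
    exact isReduced_of_injective e.toRingHom e.injective
  exact isReduced_of_isReduced_stalk _

theorem QProj.noetherianSpace (X : QProj k) : NoetherianSpace X.sch := by
  have h1 := X.property.locallyOfFiniteType
  have h2 := X.property.quasiCompact
  have : IsLocallyNoetherian X.sch := LocallyOfFiniteType.isLocallyNoetherian X.str
  have : CompactSpace X.sch := QuasiCompact.compactSpace_of_compactSpace X.str
  have : IsNoetherian X.sch := {}
  infer_instance

/-- The components of a smooth quasi-projective scheme cover it. -/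
theorem QProj.exists_comp (X : QProj k) (hX : Smooth X.str) (x : X.sch) :
    ∃ C : Comp X.sch, x ∈ C.1 := by
  have := X.noetherianSpace
  have := X.isReduced hX
  -- A point has an irreducible open neighbourhood `U`, and an irreducible component through the
  -- point can only be the closure of `U`. So different components are disjoint.
  have key (Z : Set X.sch) (hZ : Z ∈ irreducibleComponents X.sch) (x : X.sch) (hx : x ∈ Z) :
      Z = irreducibleComponent x := by
    obtain ⟨U, hxU, -, hI⟩ := X.exists_isIntegral_nbhd hX x
    have hU : IsIrreducible (U : Set X.sch) := by
      rw [isIrreducible_iff_irreducibleSpace]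
      exact inferInstanceAs (IrreducibleSpace U.toScheme)
    have h (Z : Set X.sch) (hZ : Z ∈ irreducibleComponents X.sch) (hx : x ∈ Z) :
        Z = closure U := by
      have h1 : Z ⊆ closure U := by
        have h2 := subset_closure_inter_of_isPreirreducible_of_isOpen hZ.1.isPreirreducible
          U.isOpen ⟨x, hx, hxU⟩
        exact h2.trans (closure_mono Set.inter_subset_right)
      exact h1.antisymm (hZ.2 hU.closure h1)
    rw [h Z hZ hx, ← h _ (irreducibleComponent_mem_irreducibleComponents x)
      mem_irreducibleComponent]
  -- By disjointness, the complement is the union of the other components, which are closed and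
  -- finite in number.
  have hopen : IsOpen (irreducibleComponent x) := by
    have h : irreducibleComponent x = (⋃₀ (irreducibleComponents X.sch \
        {irreducibleComponent x}))ᶜ := by
      ext y
      simp only [Set.mem_compl_iff, Set.mem_sUnion, not_exists, not_and, Set.mem_sdiff,
        Set.mem_singleton_iff]
      refine ⟨fun hy Z hZ hyZ => hZ.2 ?_, fun hy => ?_⟩
      · rw [key Z hZ.1 y hyZ, ← key _ (irreducibleComponent_mem_irreducibleComponents x) y hy]
      · by_contra h
        refine hy (irreducibleComponent y)
          ⟨irreducibleComponent_mem_irreducibleComponents y, fun e => h ?_⟩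
          mem_irreducibleComponent
        rw [← e]
        exact mem_irreducibleComponent
    rw [h, isOpen_compl_iff]
    rw [Set.sUnion_eq_biUnion]
    exact (NoetherianSpace.finite_irreducibleComponents.subset Set.sdiff_subset).isClosed_biUnion
      fun Z hZ => isClosed_of_mem_irreducibleComponents Z hZ.1
  let U : X.sch.Opens := ⟨irreducibleComponent x, hopen⟩
  have : IrreducibleSpace U.toScheme := by
    have := isIrreducible_iff_irreducibleSpace.1 (isIrreducible_irreducibleComponent (x := x))
    exact this
  exact ⟨⟨U, isClosed_irreducibleComponent, isIntegral_of_irreducibleSpace_of_isReduced _⟩,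
    mem_irreducibleComponent⟩

end IntegralComponents
end Bordism

namespace Bordism

open QProj

/-! ### Splitting cycles along open and closed covers of their source. -/

section Decomposition

variable {k : Type u} [Field k] {X Y Z : QProj k}

theorem range_eq_of_isPullback {P A B S : Scheme.{u}} {p : P ⟶ A} {q : P ⟶ B} {f : A ⟶ S}
    {g : B ⟶ S} (sq : IsPullback p q f g) : Set.range p = f ⁻¹' Set.range g := by
  have h : (sq.isoPullback.hom : P → _) '' Set.univ = Set.univ :=
    Set.image_univ_of_surjective sq.isoPullback.hom.surjective
  rw [← Scheme.Pullback.range_fst, ← sq.isoPullback_hom_fst, Scheme.Hom.comp_base,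
    TopCat.coe_comp, Set.range_comp, ← Set.image_univ (f := sq.isoPullback.hom), h, Set.image_univ]

/-- A family of open and closed immersions with disjoint images covering the target. -/
structure IsDisjointCover {ι : Type*} {W : QProj k} {U : ι → QProj k} (j : ∀ i, U i ⟶ W) :
    Prop where
  isOpenImmersion : ∀ i, IsOpenImmersion (mor (j i))
  isProper : ∀ i, IsProper (mor (j i))
  disjoint : ∀ i i', i ≠ i' → Disjoint (Set.range (mor (j i))) (Set.range (mor (j i')))
  cover : ∀ x, ∃ i, x ∈ Set.range (mor (j i))

theorem IsDisjointCover.of_isPullback {ι : Type*} {W W' : QProj k} {U U' : ι → QProj k}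
    {j : ∀ i, U i ⟶ W} (h : IsDisjointCover j) {j' : ∀ i, U' i ⟶ W'} {s : ∀ i, U' i ⟶ U i}
    {t : W' ⟶ W} (sq : ∀ i, IsPullback (mor (s i)) (mor (j' i)) (mor (j i)) (mor t)) :
    IsDisjointCover j' := by
  have hr (i : ι) : Set.range (mor (j' i)) = mor t ⁻¹' Set.range (mor (j i)) :=
    range_eq_of_isPullback (sq i).flip
  refine ⟨fun i => ?_, fun i => isProper_of_isPullback (sq i) (h.isProper i), fun i i' hi => ?_,
    fun x => ?_⟩
  · exact MorphismProperty.of_isPullback (P := @IsOpenImmersion) (sq i) (h.isOpenImmersion i)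
  · rw [hr, hr]
    exact (h.disjoint i i' hi).preimage _
  · obtain ⟨i, hi⟩ := h.cover (mor t x)
    exact ⟨i, by rw [hr]; exact hi⟩

theorem Cycle.restrict_congr {V V' : QProj k} (c : Cycle X) (i : V ⟶ c.src)
    (hi : IsProper (mor i)) (i' : V' ⟶ c.src) (hi' : IsProper (mor i')) (e : V ≅ V')
    (he : e.hom ≫ i' = i) : (c.restrict i hi).Iso (c.restrict i' hi') := by
  refine ⟨e, ?_, ?_⟩
  · change e.hom ≫ i' ≫ c.map = i ≫ c.map
    rw [← Category.assoc, he]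
  · change (c.bundles.map (Pic.pull (mor i'))).map (Pic.pull (mor e.hom)) =
      c.bundles.map (Pic.pull (mor i))
    rw [← Cycle.pull_comp_bundles, he]

theorem clopenSub.isProper_ι (X : QProj k) (U : X.sch.Opens)
    (hU : IsClosed (U : Set X.sch)) : IsProper (mor (clopenSub.ι X U hU)) :=
  haveI := clopenSub.isClosedImmersion_ι X U hU
  inferInstance

theorem Cycle.smooth_restrict (c : Cycle X) (hc : Smooth c.src.str) {V : QProj k} (i : V ⟶ c.src)
    (hi : IsProper (mor i)) (ho : IsOpenImmersion (mor i)) :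
    Smooth (c.restrict i hi).src.str :=
  smooth_str_of_smooth (X := V) (Y := c.src) (g := i)
    (SmoothOfRelativeDimension.smooth (f := mor i) 0) hc

/-- The image of a component under an open and closed immersion. -/
def Comp.image {U W : QProj k} (j : U ⟶ W) (ho : IsOpenImmersion (mor j))
    (hp : IsProper (mor j)) (C : Comp U.sch) : Comp W.sch :=
  ⟨mor j ''ᵁ C.1, (mor j).isClosedMap _ C.2.1, by
    have := C.2.2
    have : Nonempty (mor j ''ᵁ C.1).toScheme :=
      (inferInstance : Nonempty C.1.toScheme).map ((mor j).isoImage C.1).hom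
    exact isIntegral_of_isOpenImmersion ((mor j).isoImage C.1).inv⟩

theorem Comp.nonempty {W : Scheme.{u}} (C : Comp W) : (C.1 : Set W).Nonempty := by
  have := C.2.2
  obtain ⟨x⟩ := (inferInstance : Nonempty C.1.toScheme)
  exact ⟨x.1, x.2⟩

theorem Comp.isPreconnected {W : Scheme.{u}} (C : Comp W) : _root_.IsPreconnected (C.1 : Set W) := by
  have := C.2.2
  have : IsIrreducible (C.1 : Set W) := by
    rw [isIrreducible_iff_irreducibleSpace]
    exact inferInstanceAs (IrreducibleSpace C.1.toScheme)
  exact this.isPreirreducible.isPreconnected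

theorem Cycle.restrict_comp_iso (c : Cycle X) {U : QProj k} (j : U ⟶ c.src)
    (ho : IsOpenImmersion (mor j)) (hp : IsProper (mor j)) (C : Comp U.sch) :
    ((c.restrict j hp).comp C).Iso (c.comp (C.image j ho hp)) := by
  have h := (mor j).isoImage_hom_ι C.1
  let e : clopenSub U C.1 C.2.1 ≅ clopenSub c.src (C.image j ho hp).1 (C.image j ho hp).2.1 :=
    QProj.isoMk ((mor j).isoImage C.1) (by
      change ((mor j).isoImage C.1).hom ≫ (mor j ''ᵁ C.1).ι ≫ c.src.str = C.1.ι ≫ U.str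
      rw [← Category.assoc, h, Category.assoc, mor_str])
  have he : e.hom ≫ clopenSub.ι c.src (C.image j ho hp).1 (C.image j ho hp).2.1 =
      clopenSub.ι U C.1 C.2.1 ≫ j := QProj.hom_ext h
  exact (Cycle.restrict_restrict c j hp _ _ (isProper_comp (clopenSub.isProper_ι _ _ _) hp)).trans
    (Cycle.restrict_congr c _ _ _ _ e he)

theorem ZCyc.of_congr {c d : CobCycle X} (h : c.1.Iso d.1) : ZCyc.of c = ZCyc.of d :=
  congrArg FreeAbelianGroup.of (Quotient.sound h)

/-- The restriction of a cycle with smooth source to a component, as a cobordism cycle. -/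
def Cycle.cobComp (c : Cycle X) (hc : Smooth c.src.str) (C : Comp c.src.sch) : CobCycle X :=
  ⟨c.comp C, inferInstanceAs (Smooth (C.1.ι ≫ c.src.str)), C.2.2⟩

theorem ZCyc.ofSmooth_def (c : Cycle X) (hc : Smooth c.src.str) [Fintype (Comp c.src.sch)] :
    ofSmooth c hc = ∑ C, of (c.cobComp hc C) := finsum_eq_sum_of_fintype _

/-- A component of the source is connected, so it lies in the one piece that it meets; hence the
components of the pieces are those of the whole. The pieces need not be connected, which makes the
formula usable after a base change. -/
theorem ZCyc.ofSmooth_eq_sum {ι : Type*} [Fintype ι] (c : Cycle X) (hc : Smooth c.src.str)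
    {U : ι → QProj k} {j : ∀ i, U i ⟶ c.src} (h : IsDisjointCover j) :
    ofSmooth c hc = ∑ i, ofSmooth (c.restrict (j i) (h.isProper i))
      (c.smooth_restrict hc _ _ (h.isOpenImmersion i)) := by
  have hfin (i : ι) : Fintype (Comp (U i).sch) := @Fintype.ofFinite _ (Comp.finite (U i))
  have hfin' : Fintype (Comp c.src.sch) := @Fintype.ofFinite _ (Comp.finite c.src)
  let E (p : Σ i, Comp (U i).sch) : Comp c.src.sch :=
    p.2.image (j p.1) (h.isOpenImmersion p.1) (h.isProper p.1)
  have hE : Function.Bijective E := by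
    constructor
    · rintro ⟨i, C⟩ ⟨i', C'⟩ hCC
      have h1 : mor (j i) '' C.1 = mor (j i') '' C'.1 :=
        congrArg (fun D : Comp c.src.sch => (D.1 : Set c.src.sch)) hCC
      obtain ⟨x, hx⟩ := C.nonempty
      by_cases hi : i = i'
      · subst hi
        have := h.isOpenImmersion i
        have h2 := (mor (j i)).isOpenEmbedding.injective.image_injective h1
        exact congrArg (Sigma.mk i) (Subtype.ext (Opens.ext h2))
      · exfalso
        obtain ⟨y, hy, hxy⟩ : mor (j i) x ∈ mor (j i') '' C'.1 := h1 ▸ ⟨x, hx, rfl⟩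
        exact Set.disjoint_left.1 (h.disjoint i i' hi) ⟨x, rfl⟩ ⟨y, hxy⟩
    · intro C
      obtain ⟨x, hx⟩ := C.nonempty
      obtain ⟨i, hi⟩ := h.cover x
      have := h.isOpenImmersion i
      have := h.isProper i
      have hclopen : IsClopen (Set.range (mor (j i))) :=
        ⟨(mor (j i)).isClosedMap.isClosed_range, (mor (j i)).isOpenEmbedding.isOpen_range⟩
      have hsub : (C.1 : Set c.src.sch) ⊆ Set.range (mor (j i)) :=
        C.isPreconnected.subset_isClopen hclopen ⟨x, hx, hi⟩
      have him : mor (j i) ''ᵁ (mor (j i) ⁻¹ᵁ C.1) = C.1 :=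
        Opens.ext (Set.image_preimage_eq_of_subset hsub)
      have hI : IsIntegral (mor (j i) ⁻¹ᵁ C.1).toScheme := by
        have := C.2.2
        have : IsIntegral (mor (j i) ''ᵁ (mor (j i) ⁻¹ᵁ C.1)).toScheme := by rwa [him]
        have : Nonempty (mor (j i) ⁻¹ᵁ C.1).toScheme :=
          (inferInstance : Nonempty (mor (j i) ''ᵁ (mor (j i) ⁻¹ᵁ C.1)).toScheme).map
            ((mor (j i)).isoImage _).inv
        exact isIntegral_of_isOpenImmersion ((mor (j i)).isoImage (mor (j i) ⁻¹ᵁ C.1)).hom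
      exact ⟨⟨i, mor (j i) ⁻¹ᵁ C.1, C.2.1.preimage (mor (j i)).continuous, hI⟩, Subtype.ext him⟩
  have h1 (i : ι) : ofSmooth (c.restrict (j i) (h.isProper i))
      (c.smooth_restrict hc _ _ (h.isOpenImmersion i)) =
      ∑ C : Comp (U i).sch, of ((c.restrict (j i) (h.isProper i)).cobComp
        (c.smooth_restrict hc _ _ (h.isOpenImmersion i)) C) :=
    @ZCyc.ofSmooth_def _ _ _ (c.restrict (j i) (h.isProper i)) _ (hfin i)
  rw [ofSmooth_def, Finset.sum_congr rfl fun i _ => h1 i, ← Fintype.sum_sigma']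
  exact (Fintype.sum_bijective E hE _ _ fun p => ZCyc.of_congr
    (Cycle.restrict_comp_iso c (j p.1) (h.isOpenImmersion p.1) (h.isProper p.1) p.2)).symm

/-- Disjointness only uses that components are connected, open and closed. Covering is where
smoothness enters, since `Comp` lists only the integral components. -/
theorem IsDisjointCover.comp (W : QProj k) (hW : Smooth W.str) :
    IsDisjointCover (fun C : Comp W.sch => clopenSub.ι W C.1 C.2.1) where
  isOpenImmersion C := inferInstanceAs (IsOpenImmersion C.1.ι)
  isProper C := clopenSub.isProper_ι _ _ _
  disjoint C C' hCC := by
    change Disjoint (Set.range C.1.ι) (Set.range C'.1.ι)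
    rw [Scheme.Opens.range_ι, Scheme.Opens.range_ι, Set.disjoint_left]
    intro x hx hx'
    refine hCC (Subtype.ext (Opens.ext ?_))
    exact (C.isPreconnected.subset_isClopen ⟨C'.2.1, C'.1.isOpen⟩ ⟨x, hx, hx'⟩).antisymm
      (C'.isPreconnected.subset_isClopen ⟨C.2.1, C.1.isOpen⟩ ⟨x, hx', hx⟩)
  cover x := by
    obtain ⟨C, hC⟩ := W.exists_comp hW x
    exact ⟨C, (Scheme.Opens.range_ι C.1).symm ▸ hC⟩

/-- The base change of a cycle along the inclusion of a component. -/
theorem IsDisjointCover.baseChange {ι : Type*} (c : Cycle X) {U : ι → QProj k}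
    {j : ∀ i, U i ⟶ c.src} (h : IsDisjointCover j) (t : Y ⟶ X) :
    IsDisjointCover (W := (c.baseChange t).src)
      fun i => fibreProd.snd (j i) (fibreProd.fst c.map t) :=
  h.of_isPullback (s := fun i => fibreProd.fst (j i) (fibreProd.fst c.map t))
    (t := fibreProd.fst c.map t) fun _ => fibreProd.isPullback _ _

theorem ZCyc.pull_of (g : Y ⟶ X) (hg : ∃ d, SmoothOfRelativeDimension d (mor g))
    (c : CobCycle X) :
    pull g hg (of c) = ofSmooth (c.1.baseChange g) (smooth_baseChange g hg c.1 c.2.1) :=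
  FreeAbelianGroup.lift_apply_of _ _

/-- The pullback is defined on integral sources. Base change turns the components of the source into
a disjoint cover whose pieces may break up further, and `ofSmooth_eq_sum` is indifferent to that. -/
theorem ZCyc.pull_ofSmooth (g : Y ⟶ X) (hg : ∃ d, SmoothOfRelativeDimension d (mor g))
    (c : Cycle X) (hc : Smooth c.src.str) :
    pull g hg (ofSmooth c hc) = ofSmooth (c.baseChange g) (smooth_baseChange g hg c hc) := by
  have hfin : Fintype (Comp c.src.sch) := @Fintype.ofFinite _ (Comp.finite c.src)
  have h := IsDisjointCover.comp c.src hc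
  rw [ofSmooth_eq_sum (c.baseChange g) _ (h.baseChange c g)]
  rw [ofSmooth_def, map_sum]
  refine Finset.sum_congr rfl fun C _ => ?_
  rw [pull_of]
  refine ofSmooth_congr (Cycle.Iso.symm ?_) _ _
  exact Cycle.baseChange_restrict g c _ (clopenSub.isProper_ι _ _ _) (fibreProd.isPullback _ _) _

end Decomposition
end Bordism
namespace Bordism

open QProj

/-! ### Regular sections and zero schemes: locality, pullback, existence. -/

section Sections

variable {X Y Z : Scheme.{u}}

theorem germ_res {U V : X.Opens} (h : V ≤ U) (x : X) (hx : x ∈ V) (a : Γ(X, U)) :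
    X.presheaf.germ V x hx (res h a) = X.presheaf.germ U x (h hx) a :=
  X.presheaf.germ_res_apply (homOfLE h) x hx a

namespace LineBundle

theorem res_trans_mul_trans (L : LineBundle X) (x y : X) (V : X.Opens)
    (h : V ≤ L.nbhd x ⊓ L.nbhd y) (h' : V ≤ L.nbhd y ⊓ L.nbhd x) :
    res h (L.trans x y) * res h' (L.trans y x) = 1 := by
  rw [L.cocycle x y x V h h' (le_inf (h.trans inf_le_left) (h.trans inf_le_left)), L.trans_self,
    map_one]

theorem isUnit_res_trans (L : LineBundle X) (x y : X) (V : X.Opens)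
    (h : V ≤ L.nbhd x ⊓ L.nbhd y) : IsUnit (res h (L.trans x y)) :=
  .of_mul_eq_one _ (L.res_trans_mul_trans x y V h (le_inf (h.trans inf_le_right)
    (h.trans inf_le_left)))

variable {L : LineBundle X}

theorem Sec.res_val (s : L.Sec) (x y : X) (V : X.Opens) (hx : V ≤ L.nbhd x) (hy : V ≤ L.nbhd y) :
    res hx (s.val x) = res (le_inf hx hy) (L.trans x y) * res hy (s.val y) := by
  have e := congrArg (res (le_inf hx hy)) (s.compat x y)
  rwa [map_mul, res_res, res_res] at e

/-- The germ of a section at a point, in the trivialisation around that point. -/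
def Sec.germ (s : L.Sec) (x : X) : X.presheaf.stalk x :=
  X.presheaf.germ (L.nbhd x) x (L.mem_nbhd x) (s.val x)

/-- Transition functions are units, so a section has one germ up to units whatever the
trivialisation. This is why regularity and the zero ideal may be checked in a single chart around
each point. -/
theorem Sec.associated_germ (s : L.Sec) (x y : X) (V : X.Opens) (hy : V ≤ L.nbhd y) (hx : x ∈ V) :
    Associated (s.germ x) (X.presheaf.germ V x hx (res hy (s.val y))) := by
  have hxy : x ∈ L.nbhd y ⊓ L.nbhd x := ⟨hy hx, L.mem_nbhd x⟩
  have e := congrArg (X.presheaf.germ (L.nbhd y ⊓ L.nbhd x) x hxy) (s.compat y x)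
  rw [germ_res, map_mul, germ_res] at e
  have hu : IsUnit (X.presheaf.germ (L.nbhd y ⊓ L.nbhd x) x hxy (L.trans y x)) := by
    have h := (L.isUnit_res_trans y x (L.nbhd y ⊓ L.nbhd x) le_rfl).map
      (X.presheaf.germ _ x hxy).hom
    rwa [res_self] at h
  rw [germ_res]
  exact ⟨hu.unit, by rw [mul_comm]; exact e.symm⟩

theorem mem_nonZeroDivisors_of_associated {R : Type*} [CommRing R] {a b : R} (h : Associated a b)
    (ha : a ∈ nonZeroDivisors R) : b ∈ nonZeroDivisors R := by
  obtain ⟨u, rfl⟩ := h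
  exact mul_mem ha u.isUnit.mem_nonZeroDivisors

theorem mem_nonZeroDivisors_of_germ {V : X.Opens} (a : Γ(X, V))
    (h : ∀ x (hx : x ∈ V), X.presheaf.germ V x hx a ∈ nonZeroDivisors (X.presheaf.stalk x)) :
    a ∈ nonZeroDivisors Γ(X, V) := by
  refine mem_nonZeroDivisors_iff_right.2 fun b hb => ?_
  refine TopCat.Presheaf.section_ext X.sheaf V b 0 fun x hx => ?_
  have h1 : X.presheaf.germ V x hx b * X.presheaf.germ V x hx a = 0 := by
    rw [← map_mul, hb, map_zero]
  exact (mem_nonZeroDivisors_iff_right.1 (h x hx) _ h1).trans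
    (map_zero (X.presheaf.germ V x hx).hom).symm

theorem Sec.isRegular_of_germ (s : L.Sec)
    (h : ∀ x, s.germ x ∈ nonZeroDivisors (X.presheaf.stalk x)) : s.IsRegular :=
  fun y V hV => mem_nonZeroDivisors_of_germ _ fun x hx =>
    mem_nonZeroDivisors_of_associated (s.associated_germ x y V.1 hV hx) (h x)

theorem Sec.germ_mem_nonZeroDivisors (s : L.Sec) (x y : X) (V : X.Opens) (hV : IsAffineOpen V)
    (hx : x ∈ V) (hy : V ≤ L.nbhd y) (h : res hy (s.val y) ∈ nonZeroDivisors Γ(X, V)) :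
    s.germ x ∈ nonZeroDivisors _ := by
  refine mem_nonZeroDivisors_of_associated (s.associated_germ x y V hy hx).symm ?_
  let : Algebra Γ(X, V) (X.presheaf.stalk x) := X.presheaf.algebra_section_stalk ⟨x, hx⟩
  have := hV.isLocalization_stalk ⟨x, hx⟩
  exact IsLocalization.map_nonZeroDivisors_le (hV.primeIdealOf ⟨x, hx⟩).asIdeal.primeCompl
    (X.presheaf.stalk x) ⟨_, h, rfl⟩

theorem Sec.IsRegular.germ_mem {s : L.Sec} (h : s.IsRegular) (x : X) :
    s.germ x ∈ nonZeroDivisors _ := by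
  obtain ⟨V, hV, hx, hV'⟩ := exists_isAffineOpen_mem_and_subset (L.mem_nbhd x)
  exact s.germ_mem_nonZeroDivisors x x V hV hx hV' (h x ⟨V, hV⟩ hV')

theorem Sec.isRegular_of_cover (s : L.Sec)
    (h : ∀ x, ∃ (y : X) (V : X.affineOpens) (_ : x ∈ V.1) (hy : V.1 ≤ L.nbhd y),
      res hy (s.val y) ∈ nonZeroDivisors Γ(X, V.1)) : s.IsRegular :=
  s.isRegular_of_germ fun x => by
    obtain ⟨y, V, hx, hy, hV⟩ := h x
    exact s.germ_mem_nonZeroDivisors x y V.1 V.2 hx hy hV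

theorem span_singleton_eq_of_associated {R : Type*} [CommRing R] {a b : R} (h : Associated a b) :
    Ideal.span {a} = Ideal.span {b} := by
  obtain ⟨u, rfl⟩ := h
  exact (Ideal.span_singleton_mul_right_unit u.isUnit a).symm

/-- Ideals of an affine open agree if they agree in all its stalks, and in a stalk a generator
matters only up to a unit. -/
theorem Sec.isZeroScheme_of_cover (s : L.Sec) (i : Z ⟶ X) [IsClosedImmersion i]
    (h : ∀ x, ∃ (y : X) (V : X.affineOpens) (_ : x ∈ V.1) (hy : V.1 ≤ L.nbhd y),
      i.ker.ideal V = Ideal.span {res hy (s.val y)}) : s.IsZeroScheme i := by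
  refine ⟨inferInstance, fun y V hV => ?_⟩
  rw [V.2.ideal_ext_iff]
  intro x hx
  obtain ⟨z, W, hxW, hz, hW⟩ := h x
  obtain ⟨A, hA, hxA, hA'⟩ := exists_isAffineOpen_mem_and_subset
    (show x ∈ V.1 ⊓ W.1 from ⟨hx, hxW⟩)
  have e (U : X.affineOpens) (h : x ∈ U.1) (hAU : A ≤ U.1) :
      (i.ker.ideal U).map (X.presheaf.germ U.1 x h).hom =
        (i.ker.ideal ⟨A, hA⟩).map (X.presheaf.germ A x hxA).hom := by
    rw [← i.ker.map_ideal (U := ⟨A, hA⟩) (V := U) hAU, Ideal.map_map]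
    congr 1
    ext a
    exact (X.presheaf.germ_res_apply (homOfLE hAU) x hxA a).symm
  rw [e V hx (hA'.trans inf_le_left), ← e W hxW (hA'.trans inf_le_right), hW, Ideal.map_span,
    Ideal.map_span, Set.image_singleton, Set.image_singleton]
  exact span_singleton_eq_of_associated
    ((s.associated_germ x z W.1 hz hxW).symm.trans (s.associated_germ x y V.1 hV hx))

/-- The pullback of a section. -/
def Sec.pull (f : Y ⟶ X) (s : L.Sec) : (LineBundle.pull f L).Sec where
  val y := (f.app (L.nbhd (f y))).hom (s.val (f y))
  compat y z := by
    have e := congrArg (f.app (L.nbhd (f y) ⊓ L.nbhd (f z))).hom (s.compat (f y) (f z))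
    exact (app_res f _ _).symm.trans (e.trans ((map_mul _ _ _).trans
      (congrArg₂ (· * ·) rfl (app_res f _ _))))

theorem Sec.germ_pull (f : Y ⟶ X) (s : L.Sec) (y : Y) :
    (s.pull f).germ y = f.stalkMap y (s.germ (f y)) :=
  (Scheme.Hom.germ_stalkMap_apply f _ y (L.mem_nbhd (f y)) _).symm

theorem mem_nonZeroDivisors_of_flat {R S : Type*} [CommRing R] [CommRing S] (f : R →+* S)
    (hf : f.Flat) {a : R} (ha : a ∈ nonZeroDivisors R) : f a ∈ nonZeroDivisors S := by
  algebraize [f]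
  refine mem_nonZeroDivisors_iff_right.2 fun b hb => ?_
  refine Module.Flat.isSMulRegular_of_nonZeroDivisors (M := S) ha ?_
  change a • b = a • 0
  rw [smul_zero, Algebra.smul_def, mul_comm]
  exact hb

theorem Sec.IsRegular.pull {s : L.Sec} (h : s.IsRegular) (f : Y ⟶ X) [Flat f] :
    (s.pull f).IsRegular :=
  (s.pull f).isRegular_of_germ fun y => by
    rw [Sec.germ_pull]
    exact mem_nonZeroDivisors_of_flat _ (Flat.stalkMap f y) (h.germ_mem (f y))

/-- This is right exactness of the tensor product, phrased through the universal property: `B =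
A/(a)` maps to `C/(g a)` compatibly with `C`, so the pushout maps there too, and whatever `j` kills
is a multiple of `g a`. -/
theorem ker_eq_span_of_isPushout {A B C D : CommRingCat.{u}} {f : A ⟶ B} {g : A ⟶ C}
    {h : B ⟶ D} {j : C ⟶ D} (po : IsPushout f g h j) (hf : Function.Surjective f) {a : A}
    (ha : RingHom.ker f.hom = Ideal.span {a}) : RingHom.ker j.hom = Ideal.span {g a} := by
  refine le_antisymm (fun c hc => ?_) ?_
  · let p : C ⟶ .of (C ⧸ Ideal.span {g a}) := CommRingCat.ofHom (Ideal.Quotient.mk _)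
    have hk : RingHom.ker f.hom ≤ RingHom.ker (g ≫ p).hom := by
      rw [ha, Ideal.span_singleton_le_iff_mem]
      exact Ideal.Quotient.eq_zero_iff_mem.2 (Ideal.mem_span_singleton_self _)
    let q : B ⟶ .of (C ⧸ Ideal.span {g a}) :=
      CommRingCat.ofHom (RingHom.liftOfSurjective f.hom hf ⟨(g ≫ p).hom, hk⟩)
    have hq : f ≫ q = g ≫ p := by
      ext b
      exact RingHom.liftOfRightInverse_comp_apply f.hom _ (Function.rightInverse_surjInv hf)
        ⟨(g ≫ p).hom, hk⟩ b
    have h1 : j ≫ po.desc q p hq = p := po.inr_desc _ _ _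
    refine Ideal.Quotient.eq_zero_iff_mem.1 ?_
    change p c = 0
    rw [← h1, CommRingCat.comp_apply, show j c = 0 from hc, map_zero]
  · rw [Ideal.span_singleton_le_iff_mem]
    change j (g a) = 0
    have h1 : f a = 0 := (ha.symm ▸ Ideal.mem_span_singleton_self a : a ∈ RingHom.ker f.hom)
    rw [← CommRingCat.comp_apply, ← po.w, CommRingCat.comp_apply, h1, map_zero]

/-- Over affine opens the fibre square is a pushout of rings, and `ker_eq_span_of_isPushout`
computes the ideal. Unlike regularity, this needs no flatness of `f`. -/
theorem Sec.IsZeroScheme.pull {s : L.Sec} {i : Z ⟶ X} (h : s.IsZeroScheme i) (f : Y ⟶ X)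
    {T : Scheme.{u}} {j : T ⟶ Y} {g : T ⟶ Z} (sq : IsPullback j g f i) :
    (s.pull f).IsZeroScheme j := by
  have := h.1
  have : IsClosedImmersion j := MorphismProperty.of_isPullback sq.flip h.1
  refine Sec.isZeroScheme_of_cover _ _ fun y => ?_
  obtain ⟨V, hV, hx, hV'⟩ := exists_isAffineOpen_mem_and_subset (L.mem_nbhd (f y))
  obtain ⟨W, hW, hy, hW'⟩ := exists_isAffineOpen_mem_and_subset (show y ∈ f ⁻¹ᵁ V from hx)
  refine ⟨y, ⟨W, hW⟩, hy, hW'.trans (f.preimage_mono hV'), ?_⟩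
  have hker := h.2 (f y) ⟨V, hV⟩ hV'
  rw [Scheme.Hom.ker_apply] at hker ⊢
  have hjW : j ⁻¹ᵁ W ≤ g ⁻¹ᵁ (i ⁻¹ᵁ V) := by
    rw [← Scheme.Hom.comp_preimage, ← sq.w, Scheme.Hom.comp_preimage]
    exact j.preimage_mono hW'
  have hU : j ⁻¹ᵁ W = g ⁻¹ᵁ (i ⁻¹ᵁ V) ⊓ j ⁻¹ᵁ W := (inf_eq_right.2 hjW).symm
  have hiV : IsAffineOpen (i ⁻¹ᵁ V) := hV.preimage i
  have po := (isIso_pushoutSection_iff sq.flip hW' le_rfl hU).1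
    (isIso_pushoutSection_of_isAffineOpen sq.flip hW' le_rfl hU hV hW hiV)
  rw [Scheme.Hom.appLE_eq_app, Scheme.Hom.appLE_eq_app] at po
  refine (ker_eq_span_of_isPushout po (i.app_surjective V hV) hker).trans ?_
  congr 2
  exact (congrArg (res hW') (app_res f hV' _)).trans (res_res _ _ _)

end LineBundle

variable {k : Type u} [Field k]

theorem QProj.isAffineHom_ι (X : QProj k) {W : X.sch.Opens} (hW : IsAffineOpen W) :
    IsAffineHom W.ι := by
  have := X.property.isSeparated
  have : IsAffine W.toScheme := hW
  exact IsAffineHom.of_comp _ X.str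

/-- The ideal sheaf is the intersection, over finitely many affine trivialising opens `W x` covering
`X`, of the ideals of functions that become multiples of `s` on `W x`. On `W x` itself the condition
attached to `W x` already implies the others. -/
theorem LineBundle.Sec.exists_isZeroScheme {X : QProj k} {L : LineBundle X.sch} (s : L.Sec) :
    ∃ (Z : QProj k) (i : Z ⟶ X), s.IsZeroScheme (mor i) := by
  have := X.property.quasiCompact
  have : CompactSpace X.sch := QuasiCompact.compactSpace_of_compactSpace X.str
  choose W hW hxW hWL' using fun x => exists_isAffineOpen_mem_and_subset (L.mem_nbhd x)
  have hWL (x : X.sch) : W x ≤ L.nbhd x := hWL' x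
  obtain ⟨t, ht⟩ := isCompact_univ.elim_finite_subcover (fun x => (W x : Set X.sch))
    (fun x => (W x).isOpen) fun x _ => Set.mem_iUnion.2 ⟨x, hxW x⟩
  have hι (x : X.sch) : IsAffineHom (W x).ι := X.isAffineHom_ι (hW x)
  let a (x : X.sch) : Γ((W x).toScheme, ⊤) :=
    res (V := ⊤) (by rw [← (W x).ι_preimage_self]; exact (W x).ι.preimage_mono (hWL x))
      ((W x).ι.app (L.nbhd x) (s.val x))
  let J (x : X.sch) : X.sch.IdealSheafData :=
    (Scheme.IdealSheafData.ofIdealTop (Ideal.span {a x})).map (W x).ι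
  have hJ (x : X.sch) (V : X.sch.affineOpens) (b : Γ(X.sch, V.1)) :
      b ∈ (J x).ideal V ↔ (W x).ι.app V.1 b ∈ Ideal.span {res le_top (a x)} := by
    rw [Scheme.IdealSheafData.ideal_map_of_isAffineHom, Ideal.mem_comap,
      Scheme.IdealSheafData.ofIdealTop_ideal, Ideal.map_span, Set.image_singleton]
    rfl
  have ha (x : X.sch) (V : X.sch.Opens) (h : V ≤ W x) : res le_top (a x) =
      (W x).ι.app V (res (h.trans (hWL x)) (s.val x)) :=
    (res_res _ _ _).trans (app_res (W x).ι (h.trans (hWL x)) _).symm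
  let I : X.sch.IdealSheafData := ⨅ x : t, J x
  let i : I.subscheme ⟶ X.sch := I.subschemeι
  let Z : QProj k := ⟨Over.mk (i ≫ X.str), isQuasiProjective_of_isClosedImmersion X i⟩
  refine ⟨Z, homMk i rfl, ?_⟩
  have : IsClosedImmersion i := inferInstance
  refine LineBundle.Sec.isZeroScheme_of_cover s i fun z => ?_
  obtain ⟨x, hx, hz⟩ := Set.mem_iUnion₂.1 (ht (Set.mem_univ z))
  refine ⟨x, ⟨W x, hW x⟩, hz, hWL x, ?_⟩
  rw [Scheme.IdealSheafData.ker_subschemeι, Scheme.IdealSheafData.ideal_iInf, iInf_apply]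
  refine le_antisymm (fun b hb => ?_) ?_
  · have h1 := (hJ x _ b).1 (Ideal.mem_iInf.1 hb ⟨x, hx⟩)
    rw [ha x _ le_rfl] at h1
    obtain ⟨c, hc⟩ := Ideal.mem_span_singleton'.1 h1
    have : IsIso ((W x).ι.app (W x)) := (W x).ι.isIso_app _ (by rw [Scheme.Opens.opensRange_ι])
    have hbij := ConcreteCategory.bijective_of_isIso ((W x).ι.app (W x))
    obtain ⟨c, rfl⟩ := hbij.2 c
    refine Ideal.mem_span_singleton'.2 ⟨c, hbij.1 ?_⟩
    rw [← hc, map_mul]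
  -- The conditions attached to the other members of the cover: on an overlap the equation of `s`
  -- around `x` is a transition function times the one around `y`.
  · rw [Ideal.span_singleton_le_iff_mem]
    refine Ideal.mem_iInf.2 fun y => (hJ y _ _).2 ?_
    have hV : W x ⊓ W y ≤ W x := inf_le_left
    have hV' : W x ⊓ W y ≤ W y := inf_le_right
    have e := s.res_val x y (W x ⊓ W y) (hV.trans (hWL x)) (hV'.trans (hWL y))
    have h2 : (W y).ι ⁻¹ᵁ W x ≤ (W y).ι ⁻¹ᵁ (W x ⊓ W y) := fun z hz => ⟨hz, z.2⟩
    have e' := congrArg (fun b => res h2 ((W y).ι.app _ b)) e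
    have e1 : res h2 ((W y).ι.app (W x ⊓ W y) (res (hV.trans (hWL x)) (s.val x))) =
        (W y).ι.app (W x) (res (hWL x) (s.val x)) := by
      refine Eq.trans ?_ ((congrArg (res h2) (app_res (W y).ι hV (res (hWL x) (s.val x)))).trans
        ((res_res _ _ _).trans (res_self _ _)))
      rw [res_res]
    refine Ideal.mem_span_singleton.2 ⟨res h2 ((W y).ι.app _
      (res (le_inf (hV.trans (hWL x)) (hV'.trans (hWL y))) (L.trans x y))), ?_⟩
    rw [mul_comm]
    refine e1.symm.trans (e'.trans ?_)
    refine (congrArg (res h2) (map_mul ((W y).ι.app _).hom _ _)).trans ((map_mul _ _ _).trans ?_)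
    congr 1
    refine (congrArg (res h2) (ha y _ hV').symm).trans (res_res _ _ _)

end Sections
end Bordism
namespace Bordism

/-! ### The algebra of Bertini's theorem. -/

section BertiniAlgebra

/-- In characteristic zero `F` is formally smooth over the field of rational functions, hence over
the polynomial ring. So `F ⊗ Ω[k[X]/k] ⟶ Ω[F/k]` is injective, splits because `F` is a field, and
the linear form defining `∂/∂X_i` extends along it. -/
theorem exists_derivation_extending {k ι F : Type*} [Field k] [CharZero k] [Field F] [Algebra k F]
    [Algebra.EssFiniteType k F] [Algebra (MvPolynomial ι k) F] [IsScalarTower k (MvPolynomial ι k) F]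
    (hinj : Function.Injective (algebraMap (MvPolynomial ι k) F)) (i : ι) :
    ∃ δ : Derivation k F F, ∀ p : MvPolynomial ι k,
      δ (algebraMap _ F p) = algebraMap _ F (MvPolynomial.pderiv i p) := by
  have : FaithfulSMul (MvPolynomial ι k) F := (faithfulSMul_iff_algebraMap_injective _ _).2 hinj
  let K := FractionRing (MvPolynomial ι k)
  let : Algebra K F := FractionRing.liftAlgebra _ F
  have : IsScalarTower (MvPolynomial ι k) K F := inferInstance
  have : IsScalarTower k K F := .of_algebraMap_eq fun x => by
    rw [IsScalarTower.algebraMap_apply k (MvPolynomial ι k) F,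
      IsScalarTower.algebraMap_apply k (MvPolynomial ι k) K,
      IsScalarTower.algebraMap_apply (MvPolynomial ι k) K F]
  have : Algebra.EssFiniteType K F := .of_comp k K F
  have : CharZero K := charZero_of_injective_algebraMap (algebraMap k K).injective
  have : Algebra.FormallySmooth K F := inferInstance
  have : Algebra.FormallySmooth (MvPolynomial ι k) K := .of_isLocalization (nonZeroDivisors _)
  have : Algebra.FormallySmooth (MvPolynomial ι k) F := .comp _ K _
  let m := KaehlerDifferential.mapBaseChange k (MvPolynomial ι k) F
  have hm : Function.Injective m := by
    rw [← LinearMap.ker_eq_bot, (LinearMap.exact_iff.1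
      (Algebra.H1Cotangent.exact_δ_mapBaseChange k (MvPolynomial ι k) F))]
    exact LinearMap.range_eq_bot.2 (LinearMap.ext fun x => by
      rw [Subsingleton.elim x 0, map_zero, map_zero])
  obtain ⟨r, hr⟩ := m.exists_leftInverse_of_injective (LinearMap.ker_eq_bot.2 hm)
  let d : Derivation k (MvPolynomial ι k) F :=
    (Algebra.linearMap (MvPolynomial ι k) F).compDer (MvPolynomial.pderiv i)
  let l : F ⊗[MvPolynomial ι k] Ω[MvPolynomial ι k⁄k] →ₗ[F] F :=
    d.liftKaehlerDifferential.liftBaseChange F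
  refine ⟨(l ∘ₗ r).compDer (KaehlerDifferential.D k F), fun p => ?_⟩
  have h1 : m (1 ⊗ₜ KaehlerDifferential.D k _ p) = KaehlerDifferential.D k F (algebraMap _ F p) := by
    rw [KaehlerDifferential.mapBaseChange_tmul, one_smul, KaehlerDifferential.map_D]
  change l (r (KaehlerDifferential.D k F _)) = _
  rw [← h1, show r (m _) = _ from LinearMap.congr_fun hr _]
  change (1 : F) • d.liftKaehlerDifferential _ = _
  rw [one_smul, Derivation.liftKaehlerDifferential_comp_D]
  rfl

/-- The ideal generated by `a` and by its derivatives. -/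
def jacobianIdeal (k : Type*) {R : Type*} [CommRing k] [CommRing R] [Algebra k R] (a : R) :
    Ideal R :=
  Ideal.span {a} ⊔ LinearMap.range (Module.Dual.eval R (Ω[R⁄k]) (KaehlerDifferential.D k R a))

/-- The hypothesis reads `u a + φ(da) = 1`. The form `φ` then sends `da` to `1` modulo `a`, so it
yields a retraction of the conormal map `I/I² ⟶ S ⊗ Ω[R/k]`, which is the Jacobian criterion. -/
theorem formallySmooth_of_jacobianIdeal {k R : Type*} [CommRing k] [CommRing R] [Algebra k R]
    [Algebra.FormallySmooth k R] (a : R) (ha : jacobianIdeal k a = ⊤) :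
    Algebra.FormallySmooth k (R ⧸ Ideal.span {a}) := by
  obtain ⟨x, hx, y, ⟨φ, rfl⟩, h⟩ := Submodule.mem_sup.1 ((Ideal.eq_top_iff_one _).1 ha)
  obtain ⟨u, rfl⟩ := Ideal.mem_span_singleton'.1 hx
  let S := R ⧸ Ideal.span {a}
  refine (Algebra.FormallySmooth.iff_split_injection (P := R)
    (Ideal.Quotient.mk_surjective (I := Ideal.span {a}))).2 ?_
  let I := RingHom.ker (algebraMap R S)
  have hI (r : R) : r ∈ I ↔ r ∈ Ideal.span {a} := Ideal.Quotient.eq_zero_iff_mem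
  let a' : I := ⟨a, (hI a).2 (Ideal.mem_span_singleton_self a)⟩
  have hsmul (r : R) (hr : r ∈ I) (y : I.Cotangent) : r • y = 0 := by
    obtain ⟨y, rfl⟩ := I.toCotangent_surjective y
    rw [← map_smul, Ideal.toCotangent_eq_zero, sq]
    exact Ideal.mul_mem_mul hr y.2
  let p : S →ₗ[R] I.Cotangent := Submodule.liftQ _ (LinearMap.toSpanSingleton R _ (I.toCotangent a'))
    fun r hr => hsmul r ((hI r).2 hr) _
  let l : S ⊗[R] Ω[R⁄k] →ₗ[R] I.Cotangent :=
    p ∘ₗ (TensorProduct.rid R S).toLinearMap ∘ₗ LinearMap.lTensor S φ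
  refine ⟨l, LinearMap.ext fun y => ?_⟩
  obtain ⟨⟨y, hy⟩, rfl⟩ := I.toCotangent_surjective y
  obtain ⟨x, rfl⟩ := Ideal.mem_span_singleton'.1 ((hI y).1 hy)
  have e : (⟨x * a, hy⟩ : I) = x • a' := rfl
  have h1 : l (1 ⊗ₜ KaehlerDifferential.D k R a) =
      φ (KaehlerDifferential.D k R a) • I.toCotangent a' := by
    change p (φ _ • (1 : S)) = _
    rw [map_smul]
    exact congrArg _ (one_smul R (I.toCotangent a'))
  rw [e, map_smul, map_smul]
  congr 1
  change l (1 ⊗ₜ KaehlerDifferential.D k R a) = I.toCotangent a'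
  have h2 : φ (KaehlerDifferential.D k R a) = 1 - u * a := eq_sub_of_add_eq' h
  rw [h1, h2, sub_smul, one_smul, hsmul _ (I.mul_mem_left u a'.2), sub_zero]

/-- The point `χ` would be a singular zero of the combination `∑ γ_j f_j` with generic coefficients.
Apply to `∑ γ_j χ(f_j) = 0` a derivation `δ` of `F` that extends `∂/∂γ_i`. The derivatives of the
coefficients contribute `χ(f_i) = 1`. The rest is `∑ γ_j δ(χ(f_j))`; as `δ ∘ χ` is a derivation of
`R` and `Ω[R/k]` is finite projective, it is a combination of the sums in `h'`, so it vanishes. -/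
theorem false_of_algebraicIndependent_of_jacobian {k R ι F : Type*} [Field k] [CharZero k]
    [CommRing R] [Algebra k R] [Module.Finite R (Ω[R⁄k])] [Module.Projective R (Ω[R⁄k])] [Fintype ι]
    (f : ι → R) (i : ι) (hi : f i = 1) [Field F] [Algebra k F] [Algebra.EssFiniteType k F]
    (χ : R →ₐ[k] F) (γ : ι → F) (hγ : AlgebraicIndependent k γ) (h : ∑ j, γ j * χ (f j) = 0)
    (h' : ∀ φ : Module.Dual R (Ω[R⁄k]), ∑ j, γ j * χ (φ (KaehlerDifferential.D k R (f j))) = 0) :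
    False := by
  classical
  let : Algebra (MvPolynomial ι k) F := (MvPolynomial.aeval γ).toAlgebra
  have : IsScalarTower k (MvPolynomial ι k) F :=
    .of_algebraMap_eq fun x => ((MvPolynomial.aeval γ).commutes x).symm
  obtain ⟨δ, hδ⟩ := exists_derivation_extending (k := k) (F := F) hγ i
  have hδγ (j : ι) : δ (γ j) = if j = i then 1 else 0 := by
    have h1 := hδ (MvPolynomial.X j)
    rw [MvPolynomial.pderiv_X, show algebraMap (MvPolynomial ι k) F (MvPolynomial.X j) = γ j from
      MvPolynomial.aeval_X γ j] at h1
    rw [h1]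
    by_cases hj : j = i
    · subst hj
      simp
    · rw [if_neg hj, Pi.single_eq_of_ne' (fun h => hj h.symm), map_zero]
  let : Algebra R F := χ.toAlgebra
  have : IsScalarTower k R F := .of_algebraMap_eq fun x => (χ.commutes x).symm
  let d : Derivation k R F := δ.compAlgebraMap R
  have hd (r : R) : δ (χ r) = d.liftKaehlerDifferential (KaehlerDifferential.D k R r) := by
    rw [Derivation.liftKaehlerDifferential_comp_D]
    rfl
  obtain ⟨n, π, hπ⟩ := Module.Finite.exists_fin' R (Ω[R⁄k])
  obtain ⟨σ, hσ⟩ := Module.projective_lifting_property π LinearMap.id hπ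
  let φ (l : Fin n) : Module.Dual R (Ω[R⁄k]) := LinearMap.proj l ∘ₗ σ
  obtain ⟨v, hω⟩ : ∃ v : Fin n → F, ∀ ω : Ω[R⁄k], d.liftKaehlerDifferential ω =
      ∑ l, χ (φ l ω) * v l := by
    refine ⟨fun l => d.liftKaehlerDifferential (π (Pi.single l 1)), fun ω => ?_⟩
    have e : ω = π (∑ l, Pi.single l (σ ω l)) := by
      rw [Finset.univ_sum_single]
      exact (LinearMap.congr_fun hσ ω).symm
    refine (congrArg d.liftKaehlerDifferential e).trans ?_
    rw [map_sum, map_sum]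
    refine Finset.sum_congr rfl fun l _ => ?_
    have : Pi.single l (σ ω l) = (φ l ω) • (Pi.single l 1 : Fin n → R) := by
      rw [← Pi.single_smul, smul_eq_mul, mul_one]
      rfl
    rw [this, map_smul, map_smul]
    rfl
  have h1 := congrArg δ h
  rw [map_zero, map_sum] at h1
  simp only [Derivation.leibniz, hδγ, hd, hω, smul_eq_mul] at h1
  rw [Finset.sum_add_distrib] at h1
  simp only [mul_ite, mul_one, mul_zero, Finset.sum_ite_eq', Finset.mem_univ, if_true, hi,
    map_one] at h1
  simp only [Finset.mul_sum, ← mul_assoc] at h1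
  rw [Finset.sum_comm] at h1
  simp only [← Finset.sum_mul, h', zero_mul, Finset.sum_const_zero, zero_add] at h1
  exact one_ne_zero h1

/-- Form the generic combination of the `f j` over `R[c]` and its Jacobian ideal `J` relative to
`k[c]`. A nonzero polynomial of `k[c]` in `J` becomes, wherever it does not vanish, a unit in the
specialised ideal. If there were none, a prime containing `J` and avoiding `k[c] \ {0}` would give
the situation excluded by `false_of_algebraicIndependent_of_jacobian`. -/
theorem exists_mvPolynomial_jacobianIdeal {k R ι : Type*} [Field k] [CharZero k] [CommRing R]
    [Algebra k R] [Algebra.FiniteType k R] [Module.Projective R (Ω[R⁄k])] [Fintype ι] (f : ι → R)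
    (i : ι) (hi : f i = 1) : ∃ P : MvPolynomial ι k, P ≠ 0 ∧ ∀ c : ι → k,
      MvPolynomial.eval c P ≠ 0 → jacobianIdeal k (∑ j, c j • f j) = ⊤ := by
  classical
  let T : MvPolynomial ι R := ∑ j, MvPolynomial.X j * MvPolynomial.C (f j)
  let G (φ : Module.Dual R (Ω[R⁄k])) : MvPolynomial ι R :=
    ∑ j, MvPolynomial.X j * MvPolynomial.C (φ (KaehlerDifferential.D k R (f j)))
  let J : Ideal (MvPolynomial ι R) := Ideal.span {T} ⊔ Ideal.span (Set.range G)
  let m : MvPolynomial ι k →+* MvPolynomial ι R := MvPolynomial.map (algebraMap k R)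
  suffices h : ∃ P, P ≠ 0 ∧ m P ∈ J by
    obtain ⟨P, hP, hPJ⟩ := h
    refine ⟨P, hP, fun c hc => ?_⟩
    let ev : MvPolynomial ι R →+* R := MvPolynomial.eval fun j => algebraMap k R (c j)
    have h1 : ev (m P) = algebraMap k R (MvPolynomial.eval c P) := by
      rw [MvPolynomial.eval_map]
      exact (MvPolynomial.eval₂_comp (algebraMap k R) c P).symm
    refine Ideal.eq_top_of_isUnit_mem _ ?_ (h1 ▸ (isUnit_iff_ne_zero.2 hc).map (algebraMap k R) :
      IsUnit (ev (m P)))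
    suffices J ≤ (jacobianIdeal k (∑ j, c j • f j)).comap ev from this hPJ
    have hT : ev T = ∑ j, c j • f j := by
      simp [T, ev, Algebra.smul_def]
    refine sup_le ((Ideal.span_singleton_le_iff_mem _).2 ?_) (Ideal.span_le.2 ?_)
    · rw [Ideal.mem_comap, hT]
      exact Ideal.mem_sup_left (Ideal.mem_span_singleton_self _)
    · rintro _ ⟨φ, rfl⟩
      refine Ideal.mem_sup_right ⟨φ, ?_⟩
      simp [G, ev, Algebra.smul_def, map_sum, Module.Dual.eval]
  by_contra! hJ
  have hdis : Disjoint (J : Set (MvPolynomial ι R)) ((nonZeroDivisors _).map m) := by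
    rw [Set.disjoint_left]
    rintro _ hx ⟨P, hP, rfl⟩
    exact hJ P (nonZeroDivisors.ne_zero hP) hx
  -- Since `p` meets `k[c]` only in `0`, the coefficients stay algebraically independent in the
  -- fraction field of `R[c]/p`.
  obtain ⟨p, hp, hJp, hdp⟩ := Ideal.exists_le_prime_disjoint J _ hdis
  let A := MvPolynomial ι R ⧸ p
  let F := FractionRing A
  let ψ : MvPolynomial ι R →ₐ[k] F := (Algebra.ofId A F).restrictScalars k |>.comp
    (Ideal.Quotient.mkₐ k p)
  have hψ (x) : ψ x = 0 ↔ x ∈ p := by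
    change algebraMap A F (Ideal.Quotient.mk p x) = 0 ↔ _
    rw [FaithfulSMul.algebraMap_eq_zero_iff, Ideal.Quotient.eq_zero_iff_mem]
  have : Algebra.EssFiniteType A F := .of_isLocalization _ (nonZeroDivisors A)
  have : Algebra.EssFiniteType k F := .comp k A F
  let χ : R →ₐ[k] F := ψ.comp (Algebra.ofId R (MvPolynomial ι R) |>.restrictScalars k)
  let γ (j : ι) : F := ψ (MvPolynomial.X j)
  have hm (P : MvPolynomial ι k) : MvPolynomial.aeval γ P = ψ (m P) := by
    have : MvPolynomial.aeval γ = ψ.comp (MvPolynomial.mapAlgHom (Algebra.ofId k R)) :=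
      MvPolynomial.algHom_ext fun j => by simp [γ]
    exact DFunLike.congr_fun this P
  refine false_of_algebraicIndependent_of_jacobian f i hi χ γ ?_ ?_ fun φ => ?_
  · refine (injective_iff_map_eq_zero _).2 fun P hP => ?_
    by_contra h0
    rw [hm, hψ] at hP
    exact Set.disjoint_left.1 hdp hP ⟨P, mem_nonZeroDivisors_of_ne_zero h0, rfl⟩
  · have h1 : ψ T = 0 := (hψ T).2 (hJp (Ideal.mem_sup_left (Ideal.mem_span_singleton_self _)))
    simp only [T, map_sum, map_mul] at h1
    exact h1
  · have h1 : ψ (G φ) = 0 := (hψ _).2 (hJp (Ideal.mem_sup_right (Ideal.subset_span ⟨φ, rfl⟩)))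
    simp only [G, map_sum, map_mul] at h1
    exact h1

end BertiniAlgebra
end Bordism
namespace Bordism

open QProj

/-! ### Bertini's theorem for finitely many sections without common zero. -/

section Bertini

variable {k : Type u} [Field k]

theorem QProj.app_scalars {X Z : QProj k} (i : Z ⟶ X) (U : X.sch.Opens) (a : k) :
    (mor i).app U (X.scalars U a) = Z.scalars (mor i ⁻¹ᵁ U) a := by
  have h : X.str.appLE ⊤ U le_top ≫ (mor i).app U = Z.str.appLE ⊤ (mor i ⁻¹ᵁ U) le_top := by
    simp only [← mor_str i, Scheme.Hom.app_eq_appLE]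
    exact Scheme.Hom.appLE_comp_appLE _ _ _ _ _ _ _
  exact congrArg (fun φ => φ.hom ((Scheme.ΓSpecIso (.of k)).inv.hom a)) h

theorem QProj.smooth_of_scalars (X : QProj k)
    (h : ∀ x : X.sch, ∃ U : X.sch.affineOpens, x ∈ U.1 ∧ (X.scalars U.1).Smooth) :
    Smooth X.str := by
  choose U hx hU using h
  refine HasRingHomProperty.of_iSup_eq_top (P := @Smooth) U ?_ fun x => ?_
  · exact top_le_iff.1 fun x _ => Opens.mem_iSup.2 ⟨x, hx x⟩
  · have h1 := RingHom.Smooth.respectsIso.2 _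
      (Scheme.ΓSpecIso (.of k)).commRingCatIsoToRingEquiv (hU x)
    convert h1 using 1
    ext a
    change _ = (X.str.appLE ⊤ (U x).1 le_top).hom
      ((Scheme.ΓSpecIso (.of k)).inv.hom ((Scheme.ΓSpecIso (.of k)).hom.hom a))
    congr 1
    exact (Iso.hom_inv_id_apply (Scheme.ΓSpecIso (.of k)) a).symm

theorem QProj.smooth_scalars_of_jacobianIdeal {X Z : QProj k} (hX : Smooth X.str) (i : Z ⟶ X)
    [IsClosedImmersion (mor i)] (V : X.sch.affineOpens) (a : Γ(X.sch, V.1))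
    (hi : (mor i).ker.ideal V = Ideal.span {a})
    (ha : letI := (X.scalars V.1).toAlgebra; jacobianIdeal k a = ⊤) :
    (Z.scalars (mor i ⁻¹ᵁ V.1)).Smooth := by
  let := (X.scalars V.1).toAlgebra
  have : Algebra.Smooth k Γ(X.sch, V.1) := X.smooth_scalars hX V.2
  have := formallySmooth_of_jacobianIdeal a ha
  let S := Γ(X.sch, V.1) ⧸ Ideal.span {a}
  have : Algebra.FinitePresentation k S := Algebra.FinitePresentation.of_finiteType.1 inferInstance
  have h1 : (algebraMap k S).Smooth := by
    rw [RingHom.smooth_algebraMap]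
    exact {}
  rw [Scheme.Hom.ker_apply] at hi
  let e : S ≃+* Γ(Z.sch, mor i ⁻¹ᵁ V.1) := (Ideal.quotEquivOfEq hi.symm).trans
    (RingHom.quotientKerEquivOfSurjective ((mor i).app_surjective V.1 V.2))
  have h2 := RingHom.Smooth.respectsIso.1 _ e h1
  convert h2 using 1
  ext a
  exact (app_scalars i V.1 a).symm

variable {X : QProj k} {L : LineBundle X.sch}

/-- A linear combination of sections of a line bundle. -/
def LineBundle.Sec.linComb {ι : Type*} [Fintype ι] (s : ι → L.Sec) (c : ι → k) : L.Sec where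
  val x := ∑ i, X.scalars (L.nbhd x) (c i) * (s i).val x
  compat x y := by
    simp only [map_sum, map_mul, res_scalars, (s _).compat x y, Finset.mul_sum]
    exact Finset.sum_congr rfl fun i _ => mul_left_comm _ _ _

/-- The sections have no common zero. -/
def LineBundle.Generate {X : Scheme.{u}} {L : LineBundle X} {ι : Type*} (s : ι → L.Sec) : Prop :=
  ∀ x, ∃ i, x ∈ (s i).locus

theorem exists_isDomain_chart (hX : Smooth X.str) (x : X.sch) (O : X.sch.Opens) (hx : x ∈ O) :
    ∃ U : X.sch.affineOpens, x ∈ U.1 ∧ U.1 ≤ O ∧ IsDomain Γ(X.sch, U.1) := by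
  obtain ⟨U, hxU, hU, hI⟩ := X.exists_isIntegral_nbhd hX x
  obtain ⟨V, hV, hxV, hV'⟩ := exists_isAffineOpen_mem_and_subset (show x ∈ U ⊓ O from ⟨hxU, hx⟩)
  have hVU : V ≤ U := fun y hy => (hV' hy).1
  refine ⟨⟨V, hV⟩, hxV, fun y hy => (hV' hy).2, ?_⟩
  have : Nonempty V := ⟨⟨x, hxV⟩⟩
  have : IsIntegral V.toScheme := isIntegral_of_isOpenImmersion (X.sch.homOfLE hVU)
  exact V.topIso.symm.commRingCatIsoToRingEquiv.injective.isDomain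
    V.topIso.symm.commRingCatIsoToRingEquiv.toRingHom

/-- Near `x` some section `s i` generates `L`. Dividing all sections by it gives functions `f j`
with `f i = 1`, which is the normalisation required by `exists_mvPolynomial_jacobianIdeal`. -/
theorem LineBundle.Generate.exists_mvPolynomial [CharZero k] (hX : Smooth X.str) {ι : Type*}
    [Fintype ι] {s : ι → L.Sec} (hs : Generate s) (x : X.sch) :
    ∃ (V : X.sch.affineOpens) (_ : x ∈ V.1) (h : V.1 ≤ L.nbhd x) (P : MvPolynomial ι k), P ≠ 0 ∧
      IsDomain Γ(X.sch, V.1) ∧ ∀ c : ι → k, MvPolynomial.eval c P ≠ 0 →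
      ∃ a, Associated a (res h ((Sec.linComb s c).val x)) ∧ a ≠ 0 ∧
        letI := (X.scalars V.1).toAlgebra; jacobianIdeal k a = ⊤ := by
  obtain ⟨i, hi⟩ := hs x
  rw [(s i).mem_locus x x (L.mem_nbhd x)] at hi
  obtain ⟨V, hx, hV, hD⟩ := exists_isDomain_chart hX x _ hi
  have h : V.1 ≤ L.nbhd x := hV.trans (X.sch.basicOpen_le _)
  let := (X.scalars V.1).toAlgebra
  have : Algebra.Smooth k Γ(X.sch, V.1) := X.smooth_scalars hX V.2
  have hu : IsUnit (res h ((s i).val x)) := by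
    have h1 : IsUnit (res (X.sch.basicOpen_le _) ((s i).val x)) :=
      RingedSpace.isUnit_res_basicOpen X.sch.toRingedSpace ((s i).val x)
    have h2 := h1.map (res hV)
    rwa [res_res] at h2
  obtain ⟨u, hu⟩ := hu
  let f (j : ι) : Γ(X.sch, V.1) := ↑u⁻¹ * res h ((s j).val x)
  obtain ⟨P, hP, hPc⟩ := exists_mvPolynomial_jacobianIdeal (k := k) f i (by simp [f, ← hu])
  refine ⟨V, hx, h, P, hP, hD, fun c hc => ⟨_, ⟨u, ?_⟩, ?_, hPc c hc⟩⟩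
  · simp only [LineBundle.Sec.linComb, map_sum, map_mul, res_scalars, Finset.sum_mul, f,
      Algebra.smul_def]
    refine Finset.sum_congr rfl fun j _ => ?_
    rw [mul_assoc, mul_right_comm, Units.inv_mul, one_mul]
    rfl
  -- If `a` were `0`, its Jacobian ideal would be zero and not the whole ring.
  · intro h0
    have h1 := hPc c hc
    rw [h0, jacobianIdeal, map_zero, map_zero, LinearMap.range_zero, sup_bot_eq,
      Ideal.span_singleton_eq_top] at h1
    exact not_isUnit_zero h1

/-- Finitely many charts suffice, and the product of their exceptional polynomials is nonzero. Since
`k` is infinite, some coefficient vector avoids its zeros and is good on all charts at once. -/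
theorem LineBundle.Generate.exists_transverse [CharZero k] (hX : Smooth X.str) {ι : Type*}
    [Fintype ι] {s : ι → L.Sec} (hs : Generate s) : ∃ t : L.Sec, t.IsRegular ∧
      ∀ (Z : QProj k) (i : Z ⟶ X), t.IsZeroScheme (mor i) → Smooth Z.str := by
  have := X.property.quasiCompact
  have : CompactSpace X.sch := QuasiCompact.compactSpace_of_compactSpace X.str
  choose V hx h P hP hD hc using hs.exists_mvPolynomial hX
  obtain ⟨t, ht⟩ := isCompact_univ.elim_finite_subcover (fun x => ((V x).1 : Set X.sch))
    (fun x => (V x).1.isOpen) fun x _ => Set.mem_iUnion.2 ⟨x, hx x⟩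
  obtain ⟨c, hPc⟩ : ∃ c : ι → k, MvPolynomial.eval c (∏ x ∈ t, P x) ≠ 0 := by
    by_contra! h0
    exact Finset.prod_ne_zero_iff.2 (fun x _ => hP x)
      (MvPolynomial.funext fun c => (h0 c).trans (map_zero _).symm)
  rw [map_prod, Finset.prod_ne_zero_iff] at hPc
  refine ⟨Sec.linComb s c, Sec.isRegular_of_cover _ fun y => ?_, fun Z i hZ => ?_⟩
  · obtain ⟨x, hxt, hy⟩ := Set.mem_iUnion₂.1 (ht (Set.mem_univ y))
    obtain ⟨a, ha, ha0, -⟩ := hc x c (hPc x hxt)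
    have := hD x
    exact ⟨x, V x, hy, h x, mem_nonZeroDivisors_of_associated ha (mem_nonZeroDivisors_of_ne_zero ha0)⟩
  · refine QProj.smooth_of_scalars Z fun z => ?_
    obtain ⟨x, hxt, hy⟩ := Set.mem_iUnion₂.1 (ht (Set.mem_univ (mor i z)))
    obtain ⟨a, ha, -, haJ⟩ := hc x c (hPc x hxt)
    have := hZ.1
    refine ⟨⟨mor i ⁻¹ᵁ (V x).1, (V x).2.preimage (mor i)⟩, hy,
      smooth_scalars_of_jacobianIdeal hX i (V x) a ?_ haJ⟩
    rw [hZ.2 x (V x) (h x)]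
    exact (span_singleton_eq_of_associated ha).symm

end Bertini
end Bordism
namespace Bordism

open QProj

/-! ### Every line bundle is a difference of two bundles generated by finitely many sections. -/

section Generation

variable {X : Scheme.{u}}

theorem isQuasiSeparated_of_noetherianSpace [NoetherianSpace X] (U : X.Opens) :
    IsQuasiSeparated U.1 := fun _ _ _ _ _ _ _ _ => NoetherianSpace.isCompact _

theorem exists_res_eq_pow_mul [NoetherianSpace X] {U V : X.Opens} (hVU : V ≤ U) (f : Γ(X, U))
    (hV : V = X.basicOpen f) (a : Γ(X, V)) :
    ∃ (n : ℕ) (b : Γ(X, U)), res hVU b = res hVU f ^ n * a := by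
  subst hV
  obtain ⟨n, b, h⟩ := exists_eq_pow_mul_of_isCompact_of_isQuasiSeparated X U
    (NoetherianSpace.isCompact _) (isQuasiSeparated_of_noetherianSpace U) f a
  exact ⟨n, b, h⟩

theorem exists_pow_mul_eq_zero [NoetherianSpace X] {U V : X.Opens} (hVU : V ≤ U) (f : Γ(X, U))
    (hV : V = X.basicOpen f) (a : Γ(X, U)) (ha : res hVU a = 0) : ∃ n : ℕ, f ^ n * a = 0 := by
  subst hV
  exact exists_pow_mul_eq_zero_of_res_basicOpen_eq_zero_of_isCompact X (U := U)
    (NoetherianSpace.isCompact _) a f ha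

namespace LineBundle

/-- The line bundle obtained by using, around `x`, the trivialisation of `L` around `r x`. -/
def refine (L : LineBundle X) (r : X → X) (h : ∀ x, x ∈ L.nbhd (r x)) : LineBundle X where
  nbhd x := L.nbhd (r x)
  mem_nbhd := h
  trans x y := L.trans (r x) (r y)
  trans_self x := L.trans_self (r x)
  cocycle x y z := L.cocycle (r x) (r y) (r z)

theorem refine_iso (L : LineBundle X) (r : X → X) (h : ∀ x, x ∈ L.nbhd (r x)) :
    (L.refine r h).Iso L := by
  have key (x : X) (V : X.Opens) (h1 : V ≤ L.nbhd x ⊓ L.nbhd (r x))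
      (h2 : V ≤ L.nbhd (r x) ⊓ L.nbhd x) := L.res_trans_mul_trans (r x) x V h2 h1
  let c (x : X) : Γ(X, L.nbhd (r x) ⊓ L.nbhd x)ˣ := ⟨L.trans (r x) x,
    res (by rw [inf_comm]) (L.trans x (r x)),
    by have := key x _ (by rw [inf_comm]) le_rfl; rwa [res_self] at this,
    by have := key x _ (by rw [inf_comm]) le_rfl; rwa [res_self, mul_comm] at this⟩
  refine ⟨fun x => L.nbhd (r x) ⊓ L.nbhd x, fun x => ⟨h x, L.mem_nbhd x⟩, fun x => inf_le_left,
    fun x => inf_le_right, c, fun x y => ?_⟩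
  let V := (L.nbhd (r x) ⊓ L.nbhd x) ⊓ (L.nbhd (r y) ⊓ L.nbhd y)
  have hV1 : V ≤ L.nbhd (r x) := inf_le_left.trans inf_le_left
  have hV2 : V ≤ L.nbhd x := inf_le_left.trans inf_le_right
  have hV3 : V ≤ L.nbhd (r y) := inf_le_right.trans inf_le_left
  have hV4 : V ≤ L.nbhd y := inf_le_right.trans inf_le_right
  have e1 := L.cocycle (r x) x y V (le_inf hV1 hV2) (le_inf hV2 hV4) (le_inf hV1 hV4)
  have e2 := L.cocycle (r x) (r y) y V (le_inf hV1 hV3) (le_inf hV3 hV4) (le_inf hV1 hV4)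
  exact e1.trans e2.symm

variable {M A : LineBundle X}

theorem Sec.locus_inf (s : A.Sec) (y : X) (O : X.Opens) (hO : O ≤ A.nbhd y) :
    O ⊓ s.locus = X.basicOpen (res hO (s.val y)) := by
  rw [res, X.basicOpen_res]
  ext x
  exact and_congr_right fun hx => s.mem_locus x y (hO hx)

theorem res_pow_trans {n : ℕ} {x y : X} {V : X.Opens} (h : V ≤ (A.pow n).nbhd x)
    (h' : V ≤ (A.pow n).nbhd y) : res (le_inf h h') ((A.pow n).trans x y) =
      res (le_inf h h' : V ≤ A.nbhd x ⊓ A.nbhd y) (A.trans x y) ^ n := map_pow _ _ _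

/-- A local section `e` of `M` over the locus of `s` extends globally after multiplication by a
power of `s`. One power clears the denominators on each trivialising open, a further one makes the
extensions agree on overlaps. Both can be chosen uniformly because `r` selects only finitely many
opens. The strict inequality `N₀ < N` leaves a spare factor `s`, so the extension vanishes off the
locus of `s`. -/
theorem exists_extension [NoetherianSpace X] (r : X → X) (hr : (Set.range r).Finite)
    (hM : ∀ x, x ∈ M.nbhd (r x)) (hA : ∀ x, x ∈ A.nbhd (r x)) (m : ℕ) (s : (A.pow m).Sec)
    (e : ∀ y, Γ(X, M.nbhd y ⊓ s.locus))
    (he : ∀ (y z : X) (V : X.Opens) (hy : V ≤ M.nbhd y) (hz : V ≤ M.nbhd z) (hV : V ≤ s.locus),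
      res (le_inf hy hV) (e y) = res (le_inf hy hz) (M.trans y z) * res (le_inf hz hV) (e z)) :
    ∃ N₀ : ℕ, ∀ N, N₀ < N → ∃ t : ((M.refine r hM).tensor ((A.refine r hA).pow (m * N))).Sec,
      ∀ x, x ∈ t.locus ↔ x ∈ s.locus ∧ ∀ (hx : x ∈ M.nbhd (r x) ⊓ s.locus),
        IsUnit (X.presheaf.germ _ x hx (e (r x))) := by
  let O (y : X) : X.Opens := M.nbhd y ⊓ A.nbhd y
  have hOM (y : X) : O y ≤ M.nbhd y := inf_le_left
  have hOA (y : X) : O y ≤ A.nbhd y := inf_le_right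
  have hOs (y : X) : O y ⊓ s.locus ≤ M.nbhd y ⊓ s.locus := inf_le_inf_right _ (hOM y)
  have h1 (y : X) : O y ⊓ s.locus ≤ O y := inf_le_left
  let σ (y : X) : Γ(X, O y) := res (hOA y) (s.val y)
  have hσ (y z : X) (V : X.Opens) (hy : V ≤ O y) (hz : V ≤ O z) : res hy (σ y) =
      res (le_inf (hy.trans (hOA y)) (hz.trans (hOA z))) (A.trans y z) ^ m * res hz (σ z) := by
    have e1 := s.res_val y z V (hy.trans (hOA y)) (hz.trans (hOA z))
    rw [res_pow_trans (hy.trans (hOA y)) (hz.trans (hOA z))] at e1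
    exact (res_res _ _ _).trans (e1.trans (congrArg (_ * ·) (res_res _ _ _).symm))
  -- `g y` is `s ^ n y * e` extended over the whole of `O y`; below, `g'` brings all exponents to
  -- the common value `n₁`.
  choose n g hg using fun y => exists_res_eq_pow_mul (h1 y) (σ y) (s.locus_inf y (O y) (hOA y))
    (res (hOs y) (e y))
  obtain ⟨n₁, hn₁⟩ := (hr.image n).bddAbove
  replace hn₁ (x : X) : n (r x) ≤ n₁ := hn₁ ⟨r x, ⟨x, rfl⟩, rfl⟩
  let g' (y : X) : Γ(X, O y) := σ y ^ (n₁ - n y) * g y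
  have hg' (x : X) : res (h1 (r x)) (g' (r x)) =
      res (h1 (r x)) (σ (r x)) ^ n₁ * res (hOs (r x)) (e (r x)) := by
    rw [map_mul, hg, map_pow, ← mul_assoc, ← pow_add, Nat.sub_add_cancel (hn₁ x)]
  -- The discrepancy of the local extensions on an overlap. It vanishes on the locus of `s`, so a
  -- power of `s` annihilates it.
  let d (y z : X) : Γ(X, O y ⊓ O z) := res inf_le_left (g' y) -
    res (inf_le_inf (hOM y) (hOM z)) (M.trans y z) *
      res (inf_le_inf (hOA y) (hOA z)) (A.trans y z) ^ (m * n₁) * res inf_le_right (g' z)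
  have hd (x y : X) : ∃ n₂ : ℕ, res inf_le_left (σ (r x)) ^ n₂ * d (r x) (r y) = 0 := by
    have hV : O (r x) ⊓ O (r y) ⊓ s.locus ≤ O (r x) := inf_le_left.trans inf_le_left
    have hV' : O (r x) ⊓ O (r y) ⊓ s.locus ≤ O (r y) := inf_le_left.trans inf_le_right
    have hVs : O (r x) ⊓ O (r y) ⊓ s.locus ≤ s.locus := inf_le_right
    refine exists_pow_mul_eq_zero (inf_le_left : O (r x) ⊓ O (r y) ⊓ s.locus ≤ _) _ ?_ _ ?_
    · refine Eq.trans ?_ (congrArg X.basicOpen (res_res (hOA (r x)) inf_le_left _).symm)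
      exact s.locus_inf (r x) _ (inf_le_left.trans (hOA _))
    · have e1 := congrArg (res (le_inf hV hVs)) (hg' x)
      have e2 := congrArg (res (le_inf hV' hVs)) (hg' y)
      simp only [map_mul, map_pow, res_res] at e1 e2
      simp only [d, map_sub, map_mul, map_pow, res_res, e1, e2]
      rw [hσ (r x) (r y) _ hV hV', he (r x) (r y) _ (hV.trans (hOM _)) (hV'.trans (hOM _)) hVs]
      ring
  choose n₂ hn₂ using hd
  -- The exponents `n₂` are indexed by points, of which there are infinitely many. A bound comes
  -- from choosing one representative for each of the finitely many values of `r`.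
  obtain ⟨n₃, hn₃⟩ : ∃ n₃ : ℕ, ∀ x y, res inf_le_left (σ (r x)) ^ n₃ * d (r x) (r y) = 0 := by
    have hfin : (Set.range fun p : Set.range r × Set.range r => n₂ p.1.2.choose p.2.2.choose).Finite :=
      have := hr.to_subtype
      Set.finite_range _
    obtain ⟨n₃, hn₃⟩ := hfin.bddAbove
    refine ⟨n₃, fun x y => ?_⟩
    have h2 (x : X) : r (⟨r x, x, rfl⟩ : Set.range r).2.choose = r x :=
      (⟨r x, x, rfl⟩ : Set.range r).2.choose_spec
    have h3 := hn₃ ⟨(⟨r x, x, rfl⟩, ⟨r y, y, rfl⟩), rfl⟩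
    have h4 := hn₂ (⟨r x, x, rfl⟩ : Set.range r).2.choose (⟨r y, y, rfl⟩ : Set.range r).2.choose
    obtain ⟨a, ha⟩ := Nat.exists_eq_add_of_le h3
    rw [ha, add_comm, pow_add, mul_assoc]
    dsimp only at h4 ⊢
    generalize n₂ _ _ = q at h4 ⊢
    rw [h2, h2] at h4
    rw [h4, mul_zero]
  refine ⟨n₁ + n₃, fun N hN => ?_⟩
  obtain ⟨a, rfl⟩ := Nat.exists_eq_add_of_lt hN
  let t : ((M.refine r hM).tensor ((A.refine r hA).pow (m * (n₁ + n₃ + a + 1)))).Sec :=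
    { val x := σ (r x) ^ (n₃ + a + 1) * g' (r x)
      compat x y := by
        have e1 := hn₃ x y
        have e2 := hσ (r x) (r y) (O (r x) ⊓ O (r y)) inf_le_left inf_le_right
        change res (inf_le_left : O (r x) ⊓ O (r y) ≤ _) (σ (r x) ^ (n₃ + a + 1) * g' (r x)) =
          (res (inf_le_inf (hOM _) (hOM _)) (M.trans (r x) (r y)) *
          res (inf_le_inf (hOA _) (hOA _)) (A.trans (r x) (r y) ^ (m * (n₁ + n₃ + a + 1)))) *
          res (inf_le_right : O (r x) ⊓ O (r y) ≤ _) (σ (r y) ^ (n₃ + a + 1) * g' (r y))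
        have e3 : res inf_le_left (σ (r x)) ^ (n₃ + a + 1) =
            res (inf_le_inf (hOA _) (hOA _)) (A.trans (r x) (r y)) ^ (m * (n₃ + a + 1)) *
              res inf_le_right (σ (r y)) ^ (n₃ + a + 1) := by rw [e2, mul_pow, pow_mul]
        simp only [map_mul, map_pow, d] at e1 ⊢
        linear_combination (res inf_le_left (σ (r x)) ^ (a + 1)) * e1 +
          (res (inf_le_inf (hOM _) (hOM _)) (M.trans (r x) (r y)) *
            res (inf_le_inf (hOA _) (hOA _)) (A.trans (r x) (r y)) ^ (m * n₁) *
            res inf_le_right (g' (r y))) * e3 }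
  refine ⟨t, fun x => ?_⟩
  have hxO : x ∈ O (r x) := ⟨hM x, hA x⟩
  have e1 : x ∈ t.locus ↔ x ∈ X.basicOpen (σ (r x) ^ (n₃ + a + 1) * g' (r x)) :=
    t.mem_locus x x hxO
  have e2 : x ∈ s.locus ↔ x ∈ X.basicOpen (σ (r x)) := by
    have e3 := s.locus_inf (r x) _ (hOA (r x))
    exact ⟨fun h => e3.le ⟨hxO, h⟩, fun h => (e3.ge h).2⟩
  rw [e1, X.basicOpen_mul, X.basicOpen_pow _ (by omega)]
  refine ⟨fun h => ⟨e2.2 h.1, fun hx => ?_⟩, fun h => ⟨e2.1 h.1, ?_⟩⟩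
  · have h2 := (X.mem_basicOpen _ _ hxO).1 h.2
    have hx' : x ∈ O (r x) ⊓ s.locus := ⟨hxO, hx.2⟩
    have h3 := congrArg (X.presheaf.germ (O (r x) ⊓ s.locus) x hx') (hg' x)
    rw [germ_res, map_mul (X.presheaf.germ (O (r x) ⊓ s.locus) x hx').hom, germ_res (hOs (r x))] at h3
    exact isUnit_of_mul_isUnit_right (h3 ▸ h2)
  · have h2 := h.2 ⟨hM x, h.1⟩
    have hx' : x ∈ O (r x) ⊓ s.locus := ⟨hxO, h.1⟩
    have h3 := congrArg (X.presheaf.germ (O (r x) ⊓ s.locus) x hx') (hg' x)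
    rw [germ_res, map_mul (X.presheaf.germ (O (r x) ⊓ s.locus) x hx').hom,
      map_pow (X.presheaf.germ (O (r x) ⊓ s.locus) x hx').hom, germ_res, germ_res (hOs (r x))] at h3
    refine (X.mem_basicOpen _ _ hxO).2 ?_
    rw [h3]
    exact (((X.mem_basicOpen _ _ hxO).1 (e2.1 h.1)).pow _).mul h2

/-- Sections of a power of `A` are sections of the corresponding power of a refinement. -/
theorem exists_sec_of_refine_trivial (r : X → X) (hr : ∀ x, x ∈ (trivial X).nbhd (r x)) (n : ℕ)
    (t : (((trivial X).refine r hr).tensor (A.pow n)).Sec) :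
    ∃ t' : (A.pow n).Sec, t'.locus = t.locus := by
  have h (x : X) : (⊤ ⊓ A.nbhd x : X.Opens) = A.nbhd x := top_inf_eq _
  let t' : (A.pow n).Sec :=
    { val x := res (h x).ge (t.val x)
      compat x y := by
        have e := t.res_val x y ((A.pow n).nbhd x ⊓ (A.pow n).nbhd y)
          (inf_le_left.trans (h x).ge) (inf_le_right.trans (h y).ge)
        rw [res_tensor] at e
        refine (res_res _ _ _).trans (e.trans ?_)
        refine congrArg₂ (· * ·) ?_ (res_res _ _ _).symm
        exact (congrArg₂ (· * ·) (map_one (res _)) (res_self _ _)).trans (one_mul _) }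
  refine ⟨t', ?_⟩
  ext x
  have h1 := t'.mem_locus x x (A.mem_nbhd x)
  have h2 := t.mem_locus x x ⟨_root_.trivial, A.mem_nbhd x⟩
  have h3 : X.basicOpen (t'.val x) = A.nbhd x ⊓ X.basicOpen (t.val x) :=
    X.basicOpen_res (t.val x) (homOfLE (h x).ge).op
  rw [h3] at h1
  exact ⟨fun hx => h2.2 (h1.1 hx).2, fun hx => h1.2 ⟨A.mem_nbhd x, h2.1 hx⟩⟩

theorem exists_finite_refinement [CompactSpace X] (O : X → X.Opens) (hO : ∀ x, x ∈ O x) :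
    ∃ r : X → X, (Set.range r).Finite ∧ ∀ x, x ∈ O (r x) := by
  obtain ⟨t, ht⟩ := isCompact_univ.elim_finite_subcover (fun x => (O x : Set X))
    (fun x => (O x).isOpen) fun x _ => Set.mem_iUnion.2 ⟨x, hO x⟩
  choose r hrt hr using fun x => Set.mem_iUnion₂.1 (ht (Set.mem_univ x))
  exact ⟨r, t.finite_toSet.subset (Set.range_subset_iff.2 hrt), hr⟩

/-- Ampleness provides an affine locus around `x`, inside which a function `f` cuts out a smaller
neighbourhood contained in `O`. Extending `f` times a power of `s`, as in `exists_extension` for the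
trivial bundle, makes that neighbourhood the locus of a section. -/
theorem IsAmple.exists_locus_le [NoetherianSpace X] (hA : A.IsAmple) (r : X → X)
    (hr : (Set.range r).Finite) (hrA : ∀ x, x ∈ A.nbhd (r x)) (x : X) (O : X.Opens) (hx : x ∈ O) :
    ∃ m, 0 < m ∧ ∃ s : ((A.refine r hrA).pow m).Sec, x ∈ s.locus ∧ s.locus ≤ O := by
  obtain ⟨m, hm, s, hs, haff⟩ := hA x
  obtain ⟨f, hf, hxf⟩ := haff.exists_basicOpen_le (⟨x, hx⟩ : O) hs
  obtain ⟨N, hN⟩ := exists_extension (M := trivial X) r hr (fun _ => _root_.trivial) hrA m s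
    (fun y => res inf_le_right f) fun y z V hy hz hV => by
      rw [res_res, res_res]
      exact ((congrArg (· * _) (map_one (res _))).trans (one_mul _)).symm
  obtain ⟨t, ht⟩ := hN (N + 1) (Nat.lt_succ_self N)
  obtain ⟨t', ht'⟩ := exists_sec_of_refine_trivial r _ _ t
  have key (y : X) (h : y ∈ (trivial X).nbhd (r y) ⊓ s.locus) :
      IsUnit (X.presheaf.germ ((trivial X).nbhd (r y) ⊓ s.locus) y h (res inf_le_right f)) ↔
        y ∈ X.basicOpen f := by
    rw [germ_res, X.mem_basicOpen f y h.2]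
  refine ⟨m * (N + 1), Nat.mul_pos hm (Nat.succ_pos N), t', ?_, ?_⟩
  · rw [ht', ht]
    exact ⟨hs, fun h => (key x h).2 hxf⟩
  · intro y hy
    rw [ht', ht] at hy
    exact hf ((key y ⟨_root_.trivial, hy.1⟩).1 (hy.2 ⟨_root_.trivial, hy.1⟩))

/-- The power of a section. -/
def Sec.pow {m : ℕ} (s : (A.pow m).Sec) (n : ℕ) : (A.pow (m * n)).Sec where
  val x := s.val x ^ n
  compat x y := by
    have h := congrArg (· ^ n) (s.compat x y)
    refine (map_pow _ _ _).trans (h.trans ((mul_pow _ _ _).trans ?_))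
    exact congrArg₂ (· * ·) (pow_mul (A.trans x y) m n).symm (map_pow _ _ _).symm

theorem Sec.locus_pow {m n : ℕ} (hn : 0 < n) (s : (A.pow m).Sec) : (s.pow n).locus = s.locus := by
  ext x
  have h1 := (s.pow n).mem_locus x x (A.mem_nbhd x)
  have h2 := s.mem_locus x x (A.mem_nbhd x)
  have h3 : X.basicOpen ((s.pow n).val x) = X.basicOpen (s.val x) := X.basicOpen_pow _ hn
  rw [h3] at h1
  exact h1.trans h2.symm

/-- Around each point choose a section of a power of the ample bundle whose locus lies in a
trivialising open of `L`. Its powers, and its powers times the trivialising section of `L`, become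
global sections of `B = A'^E` and of a bundle isomorphic to `L ⊗ B`. Finitely many of the loci
cover. -/
theorem exists_generate (L : LineBundle X) [NoetherianSpace X] (hA : A.IsAmple) :
    ∃ (ι : Type u) (_ : Finite ι) (M B : LineBundle X) (s : ι → M.Sec) (t : ι → B.Sec),
      (L.tensor B).Iso M ∧ Generate s ∧ Generate t := by
  obtain ⟨r, hr, hrA⟩ := exists_finite_refinement A.nbhd A.mem_nbhd
  let A' := A.refine r hrA
  obtain ⟨r', hr', hrL⟩ := exists_finite_refinement (L.tensor A').nbhd (L.tensor A').mem_nbhd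
  have h1 (x : X) : x ∈ L.nbhd (r' x) := (hrL x).1
  have h2 (x : X) : x ∈ A'.nbhd (r' x) := (hrL x).2
  choose m hm s hxs hs using fun x => hA.exists_locus_le r hr hrA x (L.nbhd x) (L.mem_nbhd x)
  -- The functions `L.trans y x` describe, in all charts, the generator of `L` over `L.nbhd x`.
  have key (x : X) := exists_extension r' hr' h1 h2 (m x) (s x)
    (fun y => res (inf_le_inf_left _ (hs x)) (L.trans y x)) fun y z V hy hz hV => by
      rw [res_res, res_res]
      exact (L.cocycle y z x V (le_inf hy hz) (le_inf hz (hV.trans (hs x))) _).symm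
  choose N hN using key
  obtain ⟨F, hF⟩ := isCompact_univ.elim_finite_subcover (fun x => ((s x).locus : Set X))
    (fun x => (s x).locus.isOpen) fun x _ => Set.mem_iUnion.2 ⟨x, hxs x⟩
  obtain ⟨E, hE⟩ : ∃ E, ∀ x ∈ F, ∃ n, N x < n ∧ E = m x * n := by
    classical
    -- All sections must lie in the same power of `A'`. This exponent is a multiple of each `m x`,
    -- and the second factor makes the quotient larger than each bound `N x`.
    refine ⟨(∏ x ∈ F, m x) * (∑ x ∈ F, N x + 1), fun x hx => ?_⟩
    rw [← Finset.mul_prod_erase F m hx, mul_assoc]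
    refine ⟨_, ?_, rfl⟩
    have h3 : 1 ≤ ∏ y ∈ F.erase x, m y := Finset.one_le_prod' fun y _ => hm y
    have h4 := Finset.single_le_sum (f := N) (fun y _ => Nat.zero_le _) hx
    nlinarith
  choose n hn hE using fun x : F => hE x x.2
  have ht (x : F) : ∃ t : ((L.refine r' h1).tensor ((A'.refine r' h2).pow E)).Sec,
      (s x).locus ≤ t.locus := by
    rw [hE x]
    obtain ⟨t, ht⟩ := hN x (n x) (hn x)
    refine ⟨t, fun y hy => (ht y).2 ⟨hy, fun hy' => ?_⟩⟩
    rw [germ_res]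
    have hy'' : y ∈ L.nbhd (r' y) ⊓ L.nbhd x := ⟨hy'.1, hs x hy⟩
    have h3 := (L.isUnit_res_trans (r' y) x _ le_rfl).map
      (X.presheaf.germ (L.nbhd (r' y) ⊓ L.nbhd x) y hy'').hom
    rwa [res_self] at h3
  have ht' (x : F) : ∃ t : (A'.pow E).Sec, (s x).locus = t.locus := by
    rw [hE x]
    exact ⟨(s x).pow (n x), ((s x).locus_pow (Nat.zero_lt_of_lt (hn x))).symm⟩
  choose t ht using ht
  choose t' ht' using ht'
  have hcov (y : X) : ∃ x : F, y ∈ (s x).locus := by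
    obtain ⟨x, hx, hy⟩ := Set.mem_iUnion₂.1 (hF (Set.mem_univ y))
    exact ⟨⟨x, hx⟩, hy⟩
  refine ⟨F, inferInstance, _, A'.pow E, t, t', ?_, fun y => ?_, fun y => ?_⟩
  · exact tensor_congr (L.refine_iso r' h1).symm ((A'.pow E).refine_iso r' h2).symm
  · obtain ⟨x, hx⟩ := hcov y
    exact ⟨x, ht x hx⟩
  · obtain ⟨x, hx⟩ := hcov y
    exact ⟨x, ht' x ▸ hx⟩

end LineBundle
end Generation
end Bordism

namespace Bordism

open QProj

/-! ### Finiteness of dimension, and its drop on zero schemes of regular sections. -/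

section Dimension

variable {k : Type u} [Field k]

theorem ringKrullDim_lt_of_finiteType {A : Type u} [CommRing A] (f : k →+* A)
    (hf : f.FiniteType) : ∃ n : ℕ, ringKrullDim A ≤ n := by
  algebraize [f]
  obtain ⟨n, g, hg⟩ := Algebra.FiniteType.iff_quotient_mvPolynomial''.1 ‹Algebra.FiniteType k A›
  refine ⟨n, (ringKrullDim_le_of_surjective g.toRingHom hg).trans (le_of_eq ?_)⟩
  rw [MvPolynomial.ringKrullDim_of_isNoetherianRing, ringKrullDim_eq_zero_of_field, zero_add,
    Nat.card_fin]

theorem topologicalKrullDim_eq_of_isAffineOpen {X : Scheme.{u}} {U : X.Opens}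
    (hU : IsAffineOpen U) : topologicalKrullDim U = ringKrullDim Γ(X, U) := by
  rw [← PrimeSpectrum.topologicalKrullDim_eq_ringKrullDim Γ(X, U)]
  exact IsHomeomorph.topologicalKrullDim_eq _ hU.isoSpec.hom.homeomorph.isHomeomorph

/-- The dimension is the supremum of the coheights of irreducible closed subsets, and a coheight may
be computed in any open set that the subset meets. So a finite affine cover bounds it. -/
theorem QProj.exists_topologicalKrullDim_lt (X : QProj k) :
    ∃ n : ℕ, topologicalKrullDim X.sch < n := by
  have := X.property.quasiCompact
  have : CompactSpace X.sch := QuasiCompact.compactSpace_of_compactSpace X.str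
  have h (x : X.sch) : ∃ U : X.sch.affineOpens, x ∈ U.1 ∧ ∃ n : ℕ, topologicalKrullDim U.1 ≤ n := by
    obtain ⟨_, ⟨U, hU, rfl⟩, hx, -⟩ :=
      X.sch.isBasis_affineOpens.exists_subset_of_mem_open (Set.mem_univ x) isOpen_univ
    obtain ⟨n, hn⟩ := ringKrullDim_lt_of_finiteType _ (QProj.finiteType_scalars X hU)
    exact ⟨⟨U, hU⟩, hx, n, (topologicalKrullDim_eq_of_isAffineOpen hU).trans_le hn⟩
  choose U hx n hn using h
  obtain ⟨t, ht⟩ := isCompact_univ.elim_finite_subcover (fun x => ((U x).1 : Set X.sch))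
    (fun x => (U x).1.isOpen) fun x _ => Set.mem_iUnion.2 ⟨x, hx x⟩
  refine ⟨t.sup n + 1, lt_of_le_of_lt (b := ((t.sup n : ℕ) : WithBot ℕ∞)) ?_ ?_⟩
  · rw [topologicalKrullDim, Order.krullDim_eq_iSup_coheight]
    refine iSup_le fun T => ?_
    obtain ⟨y, hy⟩ := T.isIrreducible.nonempty
    obtain ⟨x, hxt, hyx⟩ := Set.mem_iUnion₂.1 (ht (Set.mem_univ y))
    have hemb : Topology.IsOpenEmbedding ((↑) : (U x).1 → X.sch) :=
      (U x).1.isOpen.isOpenEmbedding_subtypeVal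
    obtain ⟨T', hT'⟩ : ∃ T', IrreducibleCloseds.map _ hemb.continuous T' = T := by
      have h1 : (((↑) : (U x).1 → X.sch) ⁻¹' T).Nonempty := ⟨⟨y, hyx⟩, hy⟩
      exact ⟨(IrreducibleCloseds.orderIsoOfIsOpenEmbedding _ hemb).symm ⟨T, h1⟩, congrArg
        Subtype.val ((IrreducibleCloseds.orderIsoOfIsOpenEmbedding _ hemb).apply_symm_apply _)⟩
    rw [← hT', hemb.coheight_map]
    refine (Order.coheight_le_krullDim T').trans ((hn x).trans ?_)
    exact_mod_cast Finset.le_sup (f := n) hxt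
  · exact_mod_cast Nat.lt_succ_self _

/-- The zero scheme of a regular section contains no component of a smooth scheme. -/
theorem LineBundle.Sec.IsRegular.not_subset_range {X Z : QProj k} (hX : Smooth X.str)
    {L : LineBundle X.sch} {s : L.Sec} (hs : s.IsRegular) {i : Z ⟶ X}
    (hi : s.IsZeroScheme (mor i)) {C : X.sch.Opens} (hC : (C : Set X.sch).Nonempty) :
    ¬ (C : Set X.sch) ⊆ Set.range (mor i) := by
  intro hsub
  obtain ⟨x, hx⟩ := hC
  obtain ⟨_, ⟨V, hV, rfl⟩, hxV, hVC⟩ := X.sch.isBasis_affineOpens.exists_subset_of_mem_open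
    (show x ∈ C ⊓ L.nbhd x from ⟨hx, L.mem_nbhd x⟩) (C ⊓ L.nbhd x).isOpen
  have hVL : V ≤ L.nbhd x := fun y hy => (hVC hy).2
  have hreg := hs x ⟨V, hV⟩ hVL
  have := hi.1
  -- If the zero scheme contained `C`, the local equation would vanish at all points of `V`; as `X`
  -- is reduced it would be `0`, which is not regular.
  have hz : X.sch.basicOpen (res hVL (s.val x)) = ⊥ := by
    have hmem : res hVL (s.val x) ∈ (mor i).ker.ideal ⟨V, hV⟩ :=
      hi.2 x ⟨V, hV⟩ hVL ▸ Ideal.mem_span_singleton_self _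
    rw [Scheme.Hom.ker_apply] at hmem
    refine le_bot_iff.1 fun y hy => ?_
    obtain ⟨z, rfl⟩ := hsub (hVC (X.sch.basicOpen_le _ hy)).1
    have hz : z ∈ mor i ⁻¹ᵁ X.sch.basicOpen (res hVL (s.val x)) := hy
    rw [Scheme.preimage_basicOpen, RingHom.mem_ker.1 hmem, Scheme.basicOpen_zero] at hz
    exact hz
  have := QProj.isReduced X hX
  have h0 : res hVL (s.val x) = 0 := basicOpen_eq_bot_iff _ |>.1 hz
  have : Nontrivial Γ(X.sch, V) := by
    have : Nonempty V := ⟨⟨x, hxV⟩⟩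
    infer_instance
  exact nonZeroDivisors.ne_zero hreg h0

/-- A chain of length `r` in `Z`, pushed into `X`, can be lengthened by the component of `X` that
contains its top: the zero scheme contains no component, so the inclusion is strict. -/
theorem LineBundle.Sec.IsRegular.topologicalKrullDim_lt {X Z : QProj k} (hX : Smooth X.str)
    {L : LineBundle X.sch} {s : L.Sec} (hs : s.IsRegular) {i : Z ⟶ X}
    (hi : s.IsZeroScheme (mor i)) {r : ℕ} (h : topologicalKrullDim X.sch < (r + 1 : ℕ)) :
    topologicalKrullDim Z.sch < r := by
  by_contra! h0
  obtain ⟨l, hl⟩ := Order.le_krullDim_iff.1 h0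
  have := hi.1
  have hemb := (mor i).isClosedEmbedding
  let m := l.map _ (IrreducibleCloseds.map_strictMono_of_isInducing hemb.isInducing)
  obtain ⟨z, hz⟩ := l.last.isIrreducible.nonempty
  obtain ⟨C, hC⟩ := X.exists_comp hX (mor i z)
  have hirr : IsIrreducible (C.1 : Set X.sch) := by
    have := C.2.2
    rw [isIrreducible_iff_irreducibleSpace]
    exact inferInstanceAs (IrreducibleSpace C.1.toScheme)
  have hlt : m.last < ⟨C.1, hirr, C.2.1⟩ := by
    refine lt_of_le_of_ne ?_ ?_
    · have h1 : mor i z ∈ (m.last : Set X.sch) := subset_closure ⟨z, hz, rfl⟩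
      exact m.last.isIrreducible.isPreirreducible.isPreconnected.subset_isClopen
        ⟨C.2.1, C.1.isOpen⟩ ⟨_, h1, hC⟩
    · intro h1
      refine hs.not_subset_range hX hi ⟨_, hC⟩ ?_
      have h2 : (m.last : Set X.sch) = C.1 := congrArg (fun T : IrreducibleCloseds _ => (T : Set X.sch)) h1
      rw [← h2]
      exact closure_minimal (Set.image_subset_range _ _) hemb.isClosed_range
  refine h.not_ge (Order.le_krullDim_iff.2 ⟨m.snoc _ hlt, ?_⟩)
  simp [m, hl]

end Dimension
end Bordism

namespace Bordism

open QProj HomogeneousLocalization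

namespace ProjLine

/-! ### The charts of the projective line as polynomial rings. -/

section Ring

variable (k : Type u) [Field k]

/-- The grading of `k[X₀, X₁]` by degree. -/
abbrev grading : ℕ → Submodule k (MvPolynomial (Fin 2) k) :=
  MvPolynomial.homogeneousSubmodule (Fin 2) k

instance : GradedAlgebra (grading k) := MvPolynomial.gradedAlgebra

/-- The degree zero part of `k[X₀, X₁]` localized at `X_i`. -/
abbrev Chart (i : Fin 2) : Type u := Away (grading k) (MvPolynomial.X i : MvPolynomial (Fin 2) k)

/-- The localization of `k[X₀, X₁]` at `X_i`. -/
abbrev Loc (i : Fin 2) : Type u := Localization.Away (MvPolynomial.X i : MvPolynomial (Fin 2) k)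

variable {k}

/-- The localization map. -/
abbrev toLoc (i : Fin 2) : MvPolynomial (Fin 2) k →+* Loc k i := algebraMap _ _

/-- The inverse of `X_i` in the localization. -/
def invX (i : Fin 2) : Loc k i :=
  IsLocalization.Away.invSelf (MvPolynomial.X i : MvPolynomial (Fin 2) k)

theorem toLoc_mul_invX (i : Fin 2) : toLoc i (MvPolynomial.X i) * invX (k := k) i = 1 :=
  IsLocalization.Away.mul_invSelf (MvPolynomial.X i : MvPolynomial (Fin 2) k)

theorem X_mem (i : Fin 2) : (MvPolynomial.X i : MvPolynomial (Fin 2) k) ∈ grading k 1 :=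
  MvPolynomial.isHomogeneous_X k i

/-- The fraction `X_l / X_i`. -/
def frac (i l : Fin 2) : Chart k i :=
  Away.mk (grading k) (X_mem i) 1 (MvPolynomial.X l) (by simpa using X_mem l)

/-- The constants in the homogeneous localization at `X_i`. -/
def const (i : Fin 2) : k →+* Chart k i :=
  (fromZeroRingHom (grading k) _).comp (algebraMap k (grading k 0))

theorem val_mk_mul (i : Fin 2) (n : ℕ) (a : MvPolynomial (Fin 2) k) (ha : a ∈ grading k (n • 1)) :
    toLoc i (MvPolynomial.X i) ^ n *
      (Away.mk (grading k) (X_mem i) n a ha : Chart k i).val = toLoc i a := by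
  rw [Away.val_mk, Localization.mk_eq_mk', mul_comm, ← map_pow]
  exact IsLocalization.mk'_spec (Loc k i) a
    (⟨MvPolynomial.X i ^ n, n, rfl⟩ : Submonoid.powers (MvPolynomial.X i : MvPolynomial (Fin 2) k))

theorem val_frac (i l : Fin 2) : (frac i l : Chart k i).val =
    invX i * toLoc i (MvPolynomial.X l) := by
  have h := val_mk_mul (k := k) i 1 (MvPolynomial.X l) (by simpa using X_mem l)
  rw [← h, pow_one, ← mul_assoc, mul_comm (invX i), toLoc_mul_invX, one_mul]
  rfl

theorem val_const (i : Fin 2) (c : k) :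
    (const i c).val = toLoc i (MvPolynomial.C c) :=
  Localization.mk_one_eq_algebraMap _

theorem frac_self (i : Fin 2) : (frac i i : Chart k i) = 1 := by
  apply HomogeneousLocalization.val_injective
  rw [val_frac, val_one, mul_comm]
  exact toLoc_mul_invX i

theorem eval₂_mul_of_isHomogeneous {R S σ : Type*} [CommSemiring R] [CommSemiring S] (f : R →+* S)
    (g : σ → S) (u : S) {a : MvPolynomial σ R} {n : ℕ} (ha : a.IsHomogeneous n) :
    MvPolynomial.eval₂ f (fun l => u * g l) a = u ^ n * MvPolynomial.eval₂ f g a := by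
  rw [MvPolynomial.eval₂_eq, MvPolynomial.eval₂_eq, Finset.mul_sum]
  refine Finset.sum_congr rfl fun d hd => ?_
  have h1 : ∑ i ∈ d.support, d i = n := by
    have := ha (MvPolynomial.mem_support_iff.1 hd)
    simpa [Finsupp.weight_apply, Finsupp.sum] using this
  simp only [mul_pow, Finset.prod_mul_distrib, Finset.prod_pow_eq_pow_sum, h1]
  ring

/-- For `a` homogeneous of degree `n`, the fraction `a / X_i ^ n` is `a` evaluated at the fractions
`X_l / X_i`. -/
theorem mk_eq_eval₂ (i : Fin 2) (n : ℕ) (a : MvPolynomial (Fin 2) k) (ha : a ∈ grading k (n • 1)) :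
    Away.mk (grading k) (X_mem i) n a ha = MvPolynomial.eval₂ (const i) (frac i) a := by
  apply HomogeneousLocalization.val_injective
  have h1 : (MvPolynomial.eval₂ (const i) (frac i) a).val = MvPolynomial.eval₂
      ((toLoc i).comp MvPolynomial.C)
      (fun l => invX i * toLoc i (MvPolynomial.X l)) a := by
    refine (MvPolynomial.hom_eval₂ a (const i) (algebraMap (Chart k i) (Loc k i)) _).trans ?_
    have h0 : (algebraMap (Chart k i) (Loc k i)).comp (const i) =
        (toLoc i).comp MvPolynomial.C := RingHom.ext fun c => val_const i c
    rw [h0]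
    exact congrArg (fun g => MvPolynomial.eval₂ ((toLoc i).comp MvPolynomial.C) g a)
      (funext (val_frac i))
  have h2 : MvPolynomial.eval₂ ((toLoc i).comp MvPolynomial.C)
      (fun l => toLoc i (MvPolynomial.X l)) a = toLoc i a := by
    conv_rhs => rw [← MvPolynomial.eval₂_eta a, MvPolynomial.hom_eval₂]
  rw [h1, eval₂_mul_of_isHomogeneous _ _ _ ha, h2, ← val_mk_mul i n a ha, smul_eq_mul, mul_one,
    ← mul_assoc, ← mul_pow, mul_comm (invX i), toLoc_mul_invX, one_pow, one_mul]

/-- The homomorphism from the localization at `X_i` to polynomials in one variable with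
`X_i ↦ 1`. -/
def locHom (i : Fin 2) : Loc k i →+* Polynomial k :=
  IsLocalization.Away.lift (S := Loc k i) (MvPolynomial.X i : MvPolynomial (Fin 2) k)
    (g := MvPolynomial.eval₂Hom (Polynomial.C) (fun l => if l = i then 1 else Polynomial.X))
    (by simp)

theorem locHom_toLoc (i : Fin 2) (a : MvPolynomial (Fin 2) k) : locHom i (toLoc i a) =
    MvPolynomial.eval₂Hom (Polynomial.C) (fun l => if l = i then 1 else Polynomial.X) a :=
  IsLocalization.Away.lift_eq _ _ a

/-- The homomorphism from the homogeneous localization at `X_i` to polynomials in one variable. -/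
def dehom (i : Fin 2) : Chart k i →+* Polynomial k :=
  (locHom i).comp (algebraMap (Chart k i) (Loc k i))

theorem dehom_frac (i l : Fin 2) :
    dehom i (frac i l : Chart k i) = if l = i then 1 else Polynomial.X := by
  have h := congrArg (locHom i)
    (val_mk_mul (k := k) i 1 (MvPolynomial.X l) (by simpa using X_mem l))
  rw [pow_one, map_mul, locHom_toLoc, locHom_toLoc, MvPolynomial.eval₂Hom_X',
    MvPolynomial.eval₂Hom_X', if_pos rfl, one_mul] at h
  exact h

theorem dehom_const (i : Fin 2) (c : k) : dehom i (const i c) = Polynomial.C c :=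
  (congrArg (locHom i) (val_const i c)).trans
    ((locHom_toLoc i _).trans (MvPolynomial.eval₂Hom_C _ _ _))

theorem bijective_dehom (i : Fin 2) : Function.Bijective (dehom (k := k) i) := by
  -- In `Fin 2` the index `i + 1` is the other index, so the variable goes to the only nontrivial
  -- coordinate fraction.
  let inv : Polynomial k →+* Chart k i := Polynomial.eval₂RingHom (const i) (frac i (i + 1))
  have h1 : (dehom i).comp inv = RingHom.id _ := by
    refine Polynomial.ringHom_ext (fun c => ?_) ?_
    · simp [inv, dehom_const]
    · simp [inv, dehom_frac]
  have h2 (x) : inv (dehom i x) = x := by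
    obtain ⟨n, a, ha, rfl⟩ := Away.mk_surjective (grading k) (X_mem i) x
    rw [mk_eq_eval₂]
    have h3 : (inv.comp (dehom i)).comp (MvPolynomial.eval₂Hom (const i) (frac i)) =
        MvPolynomial.eval₂Hom (const i) (frac i) := by
      refine MvPolynomial.ringHom_ext (fun c => ?_) fun l => ?_
      · simp [inv, dehom_const]
      · simp only [RingHom.comp_apply, MvPolynomial.eval₂Hom_X', dehom_frac]
        split_ifs with h
        · rw [map_one, h, frac_self]
        · have : l = i + 1 := by omega
          simp [inv, this]
    exact DFunLike.congr_fun h3 a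
  exact Function.bijective_iff_has_inverse.2 ⟨inv, h2, DFunLike.congr_fun h1⟩

theorem smooth_const (i : Fin 2) : (const (k := k) i).Smooth := by
  let e : Polynomial k ≃+* Chart k i := (RingEquiv.ofBijective _ (bijective_dehom i)).symm
  have h : const (k := k) i = e.toRingHom.comp Polynomial.C := by
    refine RingHom.ext fun c => ?_
    exact e.symm.injective ((dehom_const i c).trans (e.symm_apply_apply _).symm)
  have hC : (Polynomial.C (R := k)).Smooth := by
    have : Algebra.Smooth k (Polynomial k) := ⟨inferInstance, inferInstance⟩
    exact RingHom.smooth_algebraMap.2 this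
  rw [h]
  exact RingHom.Smooth.respectsIso.1 _ e hC

theorem frac_mem_nonZeroDivisors (i l : Fin 2) :
    (frac i l : Chart k i) ∈ nonZeroDivisors (Chart k i) := by
  have : IsDomain (Chart k i) := Function.Injective.isDomain (dehom i) (bijective_dehom i).1
  refine mem_nonZeroDivisors_of_ne_zero fun h => ?_
  have h1 := dehom_frac (k := k) i l
  rw [h, map_zero] at h1
  split_ifs at h1
  · exact zero_ne_one h1
  · exact Polynomial.X_ne_zero h1.symm

/-- Evaluation at the point where `X₁` vanishes. -/
def evalZero : Chart k 0 →+* k := (Polynomial.evalRingHom 0).comp (dehom 0)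

theorem evalZero_const (c : k) : evalZero (const 0 c) = c := by
  simp [evalZero, dehom_const]

theorem ker_evalZero : RingHom.ker (evalZero (k := k)) = Ideal.span {frac 0 1} := by
  let e := RingEquiv.ofBijective _ (bijective_dehom (k := k) 0)
  ext x
  rw [Ideal.mem_span_singleton, RingHom.mem_ker, ← map_dvd_iff e]
  have h : e (frac 0 1) = Polynomial.X := dehom_frac 0 1
  rw [h, Polynomial.X_dvd_iff, Polynomial.coeff_zero_eq_eval_zero]
  rfl

end Ring

end ProjLine
end Bordism

namespace Bordism

open QProj HomogeneousLocalization

theorem mem_nonZeroDivisors_of_bijective {R S : Type*} [CommRing R] [CommRing S] (f : R →+* S)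
    (hf : Function.Bijective f) {a : R} (ha : a ∈ nonZeroDivisors R) :
    f a ∈ nonZeroDivisors S := by
  refine mem_nonZeroDivisors_iff_right.2 fun z hz => ?_
  obtain ⟨w, rfl⟩ := hf.2 z
  rw [← map_mul, map_eq_zero_iff _ hf.1] at hz
  rw [mem_nonZeroDivisors_iff_right.1 ha w hz, map_zero]

theorem LineBundle.Sec.isRegular_of_val {X : Scheme.{u}} {L : LineBundle X} (s : L.Sec)
    (hL : ∀ x, IsAffineOpen (L.nbhd x)) (hs : ∀ x, s.val x ∈ nonZeroDivisors Γ(X, L.nbhd x)) :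
    s.IsRegular :=
  s.isRegular_of_cover fun x => ⟨x, ⟨_, hL x⟩, L.mem_nbhd x, le_rfl,
    Set.mem_of_eq_of_mem (res_self _ _) (hs x)⟩

theorem LineBundle.Sec.isZeroScheme_of_val {X Z : Scheme.{u}} {L : LineBundle X} (s : L.Sec)
    (i : Z ⟶ X) [IsClosedImmersion i] (hL : ∀ x, IsAffineOpen (L.nbhd x))
    (hs : ∀ x, RingHom.ker (i.app (L.nbhd x)).hom = Ideal.span {s.val x}) : s.IsZeroScheme i :=
  s.isZeroScheme_of_cover i fun x => ⟨x, ⟨_, hL x⟩, L.mem_nbhd x, le_rfl,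
    (i.ker_apply _).trans ((hs x).trans
      (congrArg (fun z => Ideal.span {z}) (res_self _ _).symm))⟩

namespace ProjLine

/-! ### The projective line, the bundle `O(1)`, and the origin as the zero scheme of a coordinate.
-/

section Geometry

variable (k : Type u) [Field k]

/-- The underlying scheme of the projective line. -/
abbrev line : Scheme.{u} := Proj (grading k)

variable {k}

/-- The standard affine open subsets. -/
abbrev chart (i : Fin 2) : (line k).Opens :=
  Proj.basicOpen (grading k) (MvPolynomial.X i : MvPolynomial (Fin 2) k)

theorem isAffineOpen_chart (i : Fin 2) : IsAffineOpen (chart (k := k) i) :=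
  Proj.isAffineOpen_basicOpen (grading k) _ (X_mem i) one_pos

theorem iSup_chart : ⨆ i, chart (k := k) i = ⊤ := by
  refine Proj.iSup_basicOpen_eq_top' (grading k) _ (fun i => ⟨1, X_mem i⟩) ?_
  refine top_le_iff.1 fun p _ => ?_
  induction p using MvPolynomial.induction_on with
  | C c =>
    exact (Algebra.adjoin (grading k 0) _).algebraMap_mem (⟨MvPolynomial.C c, MvPolynomial.isHomogeneous_C _ c⟩ : grading k 0)
  | add p q hp hq => exact add_mem (hp trivial) (hq trivial)
  | mul_X p i hp => exact mul_mem (hp trivial) (Algebra.subset_adjoin ⟨i, rfl⟩)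

theorem exists_mem_chart (x : line k) : ∃ i, x ∈ chart i :=
  Opens.mem_iSup.1 (iSup_chart (k := k) ▸ (trivial : x ∈ (⊤ : (line k).Opens)))

/-- The inclusion of a chart. -/
abbrev chartι (i : Fin 2) : Spec (.of (Chart k i)) ⟶ line k :=
  Proj.awayι (grading k) (MvPolynomial.X i) (X_mem i) one_pos

/-- The function on a chart given by a fraction. -/
abbrev fn (i : Fin 2) : Chart k i →+* Γ(line k, chart i) :=
  (Proj.awayToSection (grading k) (MvPolynomial.X i)).hom

theorem bijective_fn (i : Fin 2) : Function.Bijective (fn (k := k) i) :=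
  (Proj.basicOpenIsoAway (grading k) (MvPolynomial.X i) (X_mem i)
    one_pos).commRingCatIsoToRingEquiv.bijective

/-- The identity `(X_j / X_i) (X_l / X_j) = X_l / X_i`: it underlies both the cocycle condition of
`O(1)` and the compatibility of its coordinate sections. -/
theorem awayMap_frac_mul (i j l : Fin 2) :
    awayMap (grading k) (X_mem j) (rfl : MvPolynomial.X i * MvPolynomial.X j = _) (frac i j) *
      awayMap (grading k) (X_mem i)
        (mul_comm (MvPolynomial.X i : MvPolynomial (Fin 2) k) (MvPolynomial.X j)) (frac j l) =
      awayMap (grading k) (X_mem j) rfl (frac i l) := by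
  ext
  simp only [frac, awayMap_mk, val_mul, Away.val_mk, Localization.mk_mul]
  rw [Localization.mk_eq_mk_iff, Localization.r_iff_exists]
  refine ⟨1, ?_⟩
  simp only [Submonoid.coe_one, Submonoid.coe_mul]
  ring

theorem res_fn (i j : Fin 2) {x : MvPolynomial (Fin 2) k}
    (hx : x = MvPolynomial.X i * MvPolynomial.X j) (z : Chart k i)
    (h : Proj.basicOpen (grading k) x ≤ chart i) :
    res h (fn i z) = (Proj.awayToSection (grading k) x).hom
      (awayMap (grading k) (X_mem j) hx z) :=
  (DFunLike.congr_fun (congrArg CommRingCat.Hom.hom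
    (Proj.awayMap_awayToSection (grading k) (X_mem j) hx)) z).symm

theorem fn_mul_fn (i j l : Fin 2) :
    res (inf_le_left : chart i ⊓ chart j ≤ _) (fn i (frac i j)) *
      res (inf_le_right : chart (k := k) i ⊓ chart j ≤ _) (fn j (frac j l)) =
      res inf_le_left (fn i (frac i l)) := by
  have key (W : (line k).Opens)
      (hW : W = Proj.basicOpen (grading k) (MvPolynomial.X i * MvPolynomial.X j))
      (h1 : W ≤ chart i) (h2 : W ≤ chart j) :
      res h1 (fn i (frac i j)) * res h2 (fn j (frac j l)) = res h1 (fn i (frac i l)) := by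
    subst hW
    rw [res_fn i j rfl, res_fn i j rfl, res_fn j i (mul_comm _ _), ← map_mul, awayMap_frac_mul]
  exact key _ (Proj.basicOpen_mul (grading k) _ _).symm _ _

theorem chartι_le (i : Fin 2) : ⊤ ≤ chartι (k := k) i ⁻¹ᵁ chart i := by
  have h := Proj.opensRange_awayι (grading k) (MvPolynomial.X i) (X_mem i) one_pos
  rw [chart, ← h]
  exact fun x _ => ⟨x, rfl⟩

theorem appLE_fn (i : Fin 2) (x : Chart k i) :
    ((chartι i).appLE (chart i) ⊤ (chartι_le i)).hom (fn i x) =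
      (Scheme.ΓSpecIso (.of (Chart k i))).inv.hom x := by
  let e := Proj.basicOpenIsoSpec (grading k) (MvPolynomial.X i) (X_mem i) one_pos
  have h1 : (Scheme.ΓSpecIso (.of (Chart k i))).inv ≫ e.hom.app ⊤ =
      Proj.awayToSection (grading k) (MvPolynomial.X i) ≫ (chart i).topIso.inv := by
    refine (congrArg (_ ≫ ·) (Proj.basicOpenToSpec_app_top (grading k) _)).trans ?_
    exact Iso.inv_hom_id_assoc _ _
  have h2 : Proj.awayToSection (grading k) (MvPolynomial.X i) ≫
      (chartι i).appLE (chart i) ⊤ (chartι_le i) = (Scheme.ΓSpecIso (.of (Chart k i))).inv := by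
    have h4 : e.hom ≫ chartι i = (chart i).ι := Iso.hom_inv_id_assoc _ _
    rw [← cancel_mono (e.hom.app ⊤), h1, Category.assoc]
    congr 1
    rw [← Scheme.Hom.appLE_eq_app, Scheme.Hom.appLE_comp_appLE]
    simp only [h4]
    rw [Scheme.Opens.ι_appLE]
    rfl
  exact DFunLike.congr_fun (congrArg CommRingCat.Hom.hom h2) x

theorem chartι_preimage_chart (i l : Fin 2) :
    chartι i ⁻¹ᵁ chart (k := k) l = PrimeSpectrum.basicOpen (frac i l : Chart k i) := by
  rw [chartι, Proj.awayι_preimage_basicOpen (grading k) (X_mem i) one_pos (X_mem l) one_pos]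
  congr 1
  refine HomogeneousLocalization.val_injective _ ?_
  simp only [frac, Away.val_mk, pow_one]

theorem basicOpen_fn_frac (i l : Fin 2) :
    (line k).basicOpen (fn i (frac i l)) = chart i ⊓ chart l := by
  have h1 : chartι (k := k) i ⁻¹ᵁ (line k).basicOpen (fn i (frac i l)) =
      chartι i ⁻¹ᵁ chart (k := k) l := by
    have h := Scheme.basicOpen_appLE (chartι (k := k) i) ⊤ (chart i) (chartι_le i) (fn i (frac i l))
    rw [appLE_fn, top_inf_eq] at h
    rw [← h, chartι_preimage_chart]
    exact basicOpen_eq_of_affine _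
  have h3 : (chartι (k := k) i).opensRange = chart i :=
    Proj.opensRange_awayι (grading k) _ (X_mem i) one_pos
  refine le_antisymm (fun x hx => ?_) fun x hx => ?_
  · have hxi := (line k).basicOpen_le _ hx
    obtain ⟨y, rfl⟩ : x ∈ (chartι (k := k) i).opensRange := h3 ▸ hxi
    have hy : y ∈ chartι (k := k) i ⁻¹ᵁ (line k).basicOpen (fn i (frac i l)) := hx
    rw [h1] at hy
    exact ⟨hxi, hy⟩
  · obtain ⟨y, rfl⟩ : x ∈ (chartι (k := k) i).opensRange := h3 ▸ hx.1
    have hy : y ∈ (chartι i) ⁻¹ᵁ chart (k := k) l := hx.2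
    rw [← h1] at hy
    exact hy

variable (k) in
/-- The structure morphism of the projective line. -/
def str : line k ⟶ Spec (.of k) :=
  Proj.toSpecZero (grading k) ≫ Spec.map (CommRingCat.ofHom (algebraMap k (grading k 0)))

theorem chartι_str (i : Fin 2) : chartι i ≫ str k = Spec.map (CommRingCat.ofHom (const i)) := by
  rw [str, Proj.awayι_toSpecZero_assoc, ← Spec.map_comp]
  rfl

instance : IsProper (str k) := by
  -- Properness is available over the degree zero part of the graded ring, which here consists of
  -- the constants.
  have h : Function.Bijective (algebraMap k (grading k 0)) := by
    refine ⟨fun a b hab => MvPolynomial.C_injective (Fin 2) k (congrArg Subtype.val hab),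
      fun p => ?_⟩
    have hp : p.1 ∈ (1 : Submodule k (MvPolynomial (Fin 2) k)) :=
      (MvPolynomial.homogeneousSubmodule_zero (σ := Fin 2) (R := k)) ▸ p.2
    obtain ⟨c, hc⟩ := Submodule.mem_one.1 hp
    exact ⟨c, Subtype.ext hc⟩
  have : IsIso (CommRingCat.ofHom (algebraMap k (grading k 0))) :=
    (RingEquiv.ofBijective _ h).toCommRingCatIso.isIso_hom
  have : IsScalarTower k (grading k 0) (MvPolynomial (Fin 2) k) :=
    .of_algebraMap_eq (R := k) (S := grading k 0) (A := MvPolynomial (Fin 2) k) fun _ => rfl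
  have : Algebra.FiniteType (grading k 0) (MvPolynomial (Fin 2) k) :=
    .of_restrictScalars_finiteType k _ _
  rw [str]
  infer_instance

instance : Smooth (str k) := by
  let U : (line k).AffineOpenCover :=
    { I₀ := Fin 2
      X := fun i => .of (Chart k i)
      f := chartι
      idx := fun x => (exists_mem_chart x).choose
      covers := fun x => by
        have h := Proj.opensRange_awayι (grading k) (MvPolynomial.X (exists_mem_chart x).choose)
          (X_mem _) one_pos
        have h2 := (exists_mem_chart x).choose_spec
        rw [chart, ← h] at h2
        exact h2 }
  have (i : U.openCover.I₀) : IsAffine (U.openCover.X i) := inferInstanceAs (IsAffine (Spec _))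
  have h (i : Fin 2) : (chartι i ≫ str k).appTop.hom.Smooth := by
    rw [chartι_str]
    exact (HasRingHomProperty.iff_of_isAffine (P := @Smooth)).1
      ((HasRingHomProperty.Spec_iff (P := @Smooth)).2 (smooth_const i))
  exact (HasRingHomProperty.iff_of_source_openCover (P := @Smooth) U.openCover).2 fun i => h i

/-- The index of a chart around a point. -/
def idx (x : line k) : Fin 2 := (exists_mem_chart x).choose

theorem mem_chart_idx (x : line k) : x ∈ chart (idx x) := (exists_mem_chart x).choose_spec

variable (k) in
/-- The line bundle `O(1)`. -/
def twist : LineBundle (line k) where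
  nbhd x := chart (idx x)
  mem_nbhd := mem_chart_idx
  trans x y := res inf_le_left (fn (idx x) (frac (idx x) (idx y)))
  trans_self x := by rw [frac_self, map_one, map_one]
  cocycle x y z V hxy hyz hxz := by
    have h := congrArg (res hxy) (fn_mul_fn (idx x) (idx y) (idx z))
    rw [map_mul, res_res, res_res, res_res] at h
    rw [res_res, res_res, res_res]
    exact h

/-- The sections of `O(1)` given by the coordinates. -/
def sec (l : Fin 2) : (twist k).Sec where
  val x := fn (idx x) (frac (idx x) l)
  compat x y := (fn_mul_fn (idx x) (idx y) l).symm

theorem isAmple_twist : (twist k).IsAmple := fun x => by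
  let s : ((twist k).pow 1).Sec :=
    { val := (sec (idx x)).val
      compat := fun y z => ((sec (idx x)).compat y z).trans
        (congrArg (· * _) (pow_one ((twist k).trans y z)).symm) }
  have hs : s.locus = chart (idx x) := by
    refine le_antisymm (iSup_le fun y => ?_) fun y hy => Opens.mem_iSup.2 ⟨y, ?_⟩
    · exact (basicOpen_fn_frac (idx y) (idx x)).trans_le inf_le_right
    · exact (basicOpen_fn_frac (idx y) (idx x)).ge ⟨mem_chart_idx y, hy⟩
  exact ⟨1, one_pos, s, hs ▸ mem_chart_idx x, hs ▸ isAffineOpen_chart _⟩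

theorem fn_frac_mem_nonZeroDivisors (i l : Fin 2) :
    fn i (frac i l) ∈ nonZeroDivisors Γ(line k, chart i) :=
  mem_nonZeroDivisors_of_bijective (fn i) (bijective_fn i) (frac_mem_nonZeroDivisors i l)

theorem isRegular_sec (l : Fin 2) : (sec (k := k) l).IsRegular :=
  (sec l).isRegular_of_val (fun x => isAffineOpen_chart (idx x))
    fun x => fn_frac_mem_nonZeroDivisors (idx x) l

variable (k) in
/-- The origin of the projective line. -/
def zero : Spec (.of k) ⟶ line k := Spec.map (CommRingCat.ofHom evalZero) ≫ chartι 0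

theorem zero_str : zero k ≫ str k = 𝟙 _ := by
  have h : (evalZero (k := k)).comp (const 0) = RingHom.id k := RingHom.ext evalZero_const
  rw [zero, Category.assoc, chartι_str, ← Spec.map_comp, ← CommRingCat.ofHom_comp, h]
  exact Spec.map_id _

instance : IsClosedImmersion (zero k) := by
  have : IsClosedImmersion (zero k ≫ str k) := by
    rw [zero_str]
    infer_instance
  exact IsClosedImmersion.of_comp _ (str k)

theorem appLE_zero (h : ⊤ ≤ zero k ⁻¹ᵁ chart 0) (x : Chart k 0) :
    ((zero k).appLE (chart 0) ⊤ h).hom (fn 0 x) =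
      (Scheme.ΓSpecIso (.of k)).inv.hom (evalZero x) := by
  have h1 : (zero k).appLE (chart 0) ⊤ h = (chartι 0).appLE (chart 0) ⊤ (chartι_le 0) ≫
      (Spec.map (CommRingCat.ofHom (evalZero (k := k)))).appLE ⊤ ⊤ le_top :=
    (Scheme.Hom.appLE_comp_appLE _ _ _ _ _ _ _).symm
  rw [h1]
  have h2 : (Spec.map (CommRingCat.ofHom (evalZero (k := k)))).appLE ⊤ ⊤ le_top =
      (Spec.map (CommRingCat.ofHom (evalZero (k := k)))).app ⊤ := Scheme.Hom.appLE_eq_app _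
  refine (congrArg ((Spec.map (CommRingCat.ofHom (evalZero (k := k)))).appLE ⊤ ⊤ le_top).hom
    (appLE_fn 0 x)).trans ?_
  rw [h2]
  exact (DFunLike.congr_fun (congrArg CommRingCat.Hom.hom (Scheme.ΓSpecIso_inv_naturality
    (CommRingCat.ofHom (evalZero (k := k))))) x).symm

theorem zero_preimage_chart_zero : zero k ⁻¹ᵁ chart 0 = ⊤ := by
  have h : chartι 0 ⁻¹ᵁ chart (k := k) 0 = ⊤ := top_le_iff.1 (chartι_le 0)
  rw [zero, Scheme.Hom.comp_preimage, h]
  rfl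

theorem zero_preimage_chart_one : zero k ⁻¹ᵁ chart 1 = ⊥ := by
  refine le_bot_iff.1 fun x hx => ?_
  have h2 : Spec.map (CommRingCat.ofHom evalZero) x ∈ chartι 0 ⁻¹ᵁ chart (k := k) 1 := hx
  rw [chartι_preimage_chart] at h2
  refine h2 ?_
  change evalZero (frac 0 1) ∈ x.asIdeal
  have h3 : frac 0 1 ∈ RingHom.ker (evalZero (k := k)) :=
    ker_evalZero (k := k) ▸ Ideal.mem_span_singleton_self _
  rw [RingHom.mem_ker.1 h3]
  exact zero_mem _

theorem ker_zero_app_zero :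
    RingHom.ker ((zero k).app (chart 0)).hom = Ideal.span {fn 0 (frac 0 1)} := by
  have h2 (W : (Spec (.of k)).Opens) (hW : W = ⊤) (e : W ≤ zero k ⁻¹ᵁ chart 0) :
      RingHom.ker ((zero k).appLE (chart 0) W e).hom = Ideal.span {fn 0 (frac 0 1)} := by
    subst hW
    have h3 := congrArg (Ideal.map (fn (k := k) 0)) ker_evalZero
    rw [Ideal.map_span, Set.image_singleton] at h3
    rw [← h3]
    refine le_antisymm (fun z hz => ?_) (Ideal.map_le_iff_le_comap.2 fun x hx => ?_)
    · obtain ⟨x, rfl⟩ := (bijective_fn 0).2 z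
      refine Ideal.mem_map_of_mem _ ?_
      rw [RingHom.mem_ker, appLE_zero] at hz
      exact (map_eq_zero_iff _ (Scheme.ΓSpecIso
        (.of k)).symm.commRingCatIsoToRingEquiv.injective).1 hz
    · rw [Ideal.mem_comap, RingHom.mem_ker, appLE_zero, RingHom.mem_ker.1 hx, map_zero]
  rw [← Scheme.Hom.appLE_eq_app]
  exact h2 _ zero_preimage_chart_zero le_rfl

/-- The origin is given by `X₁ = 0` and misses this chart, in agreement with the equation `X₁ / X₁ =
1`. -/
theorem ker_zero_app_one :
    RingHom.ker ((zero k).app (chart 1)).hom = Ideal.span {fn 1 (frac 1 1)} := by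
  have h2 (W : (Spec (.of k)).Opens) (hW : W = ⊥) (e : W ≤ zero k ⁻¹ᵁ chart 1) :
      RingHom.ker ((zero k).appLE (chart 1) W e).hom = Ideal.span {fn 1 (frac 1 1)} := by
    subst hW
    rw [frac_self, map_one, Ideal.span_singleton_one, Ideal.eq_top_iff_one, RingHom.mem_ker]
    exact Subsingleton.elim _ _
  rw [← Scheme.Hom.appLE_eq_app]
  exact h2 _ zero_preimage_chart_one le_rfl

theorem isZeroScheme_zero : (sec (k := k) 1).IsZeroScheme (zero k) := by
  have key (i : Fin 2) : RingHom.ker ((zero k).app (chart i)).hom =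
      Ideal.span {fn i (frac i 1)} := by
    fin_cases i
    · exact ker_zero_app_zero
    · exact ker_zero_app_one
  exact (sec 1).isZeroScheme_of_val _ (fun x => isAffineOpen_chart (idx x)) fun x => key (idx x)

end Geometry

end ProjLine

section ProjectiveLine

open ProjLine

variable (k : Type u) [Field k]

/-- The projective line. -/
def projLine : QProj k :=
  ⟨Over.mk (ProjLine.str k), inferInstanceAs (LocallyOfFiniteType (ProjLine.str k)),
    inferInstanceAs (QuasiCompact (ProjLine.str k)),
    inferInstanceAs (IsSeparated (ProjLine.str k)), twist k, isAmple_twist⟩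

theorem smooth_projLine : Smooth (projLine k).str := inferInstanceAs (Smooth (ProjLine.str k))

theorem isProper_projLine : IsProper (mor (toPt (projLine k))) :=
  inferInstanceAs (IsProper (ProjLine.str k))

/-- The origin of the projective line. -/
def projLine.origin : pt k ⟶ projLine k := homMk (zero k) zero_str

end ProjectiveLine
end Bordism

namespace Bordism

open QProj

/-! ### Classes in `OB1` and the relations among them. -/

section Classes

variable {k : Type u} [Field k] {X Y Z T : QProj k}

/-- A family `(id : T ⟶ T; L₁, …, L_r)`. -/
def Cycle.self (T : QProj k) (M : Multiset (Pic T.sch)) : Cycle T :=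
  ⟨T, 𝟙 T, inferInstanceAs (IsProper (𝟙 T.sch)), M⟩

theorem Cycle.self_push_iso (c : Cycle X) :
    ((Cycle.self c.src c.bundles).push c.map c.isProper).Iso c :=
  ⟨CategoryTheory.Iso.refl _, Category.id_comp _ |>.trans (Category.id_comp _).symm,
    Cycle.pull_id_bundles _ _⟩

theorem isProper_id (X : QProj k) : IsProper (mor (𝟙 X)) := inferInstanceAs (IsProper (𝟙 X.sch))

namespace OB

theorem push_id (f : X ⟶ Y) (h : IsProper (mor (𝟙 X))) (w : 𝟙 X ≫ f = f) (x : OB f) :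
    push (𝟙 X) h w x = x := by
  refine DFunLike.congr_fun (f := push (𝟙 X) h w) (g := AddMonoidHom.id _) (hom_ext fun c => ?_) x
  exact of_eq ⟨CategoryTheory.Iso.refl _,
    (Category.id_comp _).trans (Category.comp_id _).symm, Cycle.pull_id_bundles _ _⟩

/-- The case of an imposed relation in which both the smooth pullback and the proper pushforward are
identities. -/
theorem mem_imposed {R : BivRel k} {f : X ⟶ Y} {ρ : OB f} (hρ : ρ ∈ R f)
    (Ls : List (Pic X.sch)) : cherns f Ls ρ ∈ imposed R f := by
  have sq : IsPullback (mor (𝟙 X)) (mor f) (mor f) (mor (𝟙 Y)) := IsPullback.id_horiz (mor f)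
  refine AddSubgroup.subset_closure ⟨X, X, Y, 𝟙 X, isProper_id X, f, Category.id_comp f, 𝟙 X, f,
    𝟙 Y, sq, IsSmoothEquidim.id Y, Ls, ρ, hρ, ?_⟩
  rw [pull_id, push_id]

theorem cherns_ofCyc_self (hT : Smooth T.str) (Ls : List (Pic T.sch)) (M : Multiset (Pic T.sch)) :
    cherns _ Ls (ofCyc (Cycle.self T M) hT) = ofCyc (Cycle.self T (Ls + M)) hT := by
  refine (cherns_of _ Ls _).trans (of_eq (Cycle.iso_of_eq (congrArg (Cycle.mk T (𝟙 T) _) ?_)))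
  rw [← Multiset.map_coe]
  exact congrArg (· + M) (Cycle.pull_id_bundles T Ls)

theorem fund_toPt (hT : Smooth T.str) (h : Smooth (mor (toPt T))) :
    fund (toPt T) h = ofCyc (Cycle.self T 0) hT := rfl

theorem cherns_fund (hT : Smooth T.str) (h : Smooth (mor (toPt T))) (Ls : List (Pic T.sch)) :
    cherns _ Ls (fund (toPt T) h) = ofCyc (Cycle.self T Ls) hT := by
  rw [fund_toPt hT, cherns_ofCyc_self, add_zero]

theorem push_ofCyc_self (c : Cycle X) (hc : Smooth c.src.str) :
    push c.map c.isProper (toPt_comp _) (ofCyc (Cycle.self c.src c.bundles) hc) = ofCyc c hc :=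
  of_eq c.self_push_iso

end OB

theorem map_fglDefect {A B : Type*} [AddCommGroup A] [AddCommGroup B] [Module Lazard B]
    (F : Lazard ⊗[ℤ] A →ₗ[Lazard] B) (c₁ c₂ c₁₂ : A →+ A) (N : ℕ) (α : A) :
    F (fglDefect c₁ c₂ c₁₂ N α) =
      (∑ n ∈ Finset.range N, ∑ p ∈ Finset.HasAntidiagonal.antidiagonal n,
        lazardCoeff p.1 p.2 • F (1 ⊗ₜ (c₁^[p.1] (c₂^[p.2] α)))) - F (1 ⊗ₜ c₁₂ α) := by
  have h (a : Lazard) (x : A) : F (a ⊗ₜ x) = a • F (1 ⊗ₜ x) := by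
    rw [← map_smul, TensorProduct.smul_tmul', smul_eq_mul, mul_one]
  simp only [fglDefect, map_sub, map_sum, h (lazardCoeff _ _)]

/-- The projection to `OB1`. -/
def OB1.mk (f : X ⟶ Y) : OB f →+ OB1 f where
  toFun x := (OB.imposedFGL f).mkQ (1 ⊗ₜ[ℤ] (QuotientAddGroup.mk' (OB.preRel f) x))
  map_zero' := by rw [map_zero, TensorProduct.tmul_zero, map_zero]
  map_add' x y := by rw [map_add, TensorProduct.tmul_add, map_add]

theorem OB1.mk_eq_zero {f : X ⟶ Y} {x : OB f} (hx : x ∈ OB.preRel f) : OB1.mk f x = 0 := by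
  have h : QuotientAddGroup.mk' (OB.preRel f) x = 0 := (QuotientAddGroup.eq_zero_iff x).2 hx
  change (OB.imposedFGL f).mkQ (1 ⊗ₜ[ℤ] (QuotientAddGroup.mk' (OB.preRel f) x)) = 0
  rw [h, TensorProduct.tmul_zero, map_zero]

theorem OB1.push_mk (f : X ⟶ Y) (hf : IsProper (mor f)) {g : Y ⟶ Z} {g' : X ⟶ Z}
    (w : f ≫ g = g') (x : OB g') : OB1.push f hf w (OB1.mk g' x) = OB1.mk g (OB.push f hf w x) :=
  rfl

theorem OB1.hom_ext {f : X ⟶ Y} {B : Type*} [AddCommGroup B] [Module Lazard B]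
    {F G : OB1 f →ₗ[Lazard] B} (h : ∀ x, F (OB1.mk f x) = G (OB1.mk f x)) : F = G := by
  refine Submodule.linearMap_qext _ (TensorProduct.AlgebraTensorModule.curry_injective
    (LinearMap.ext_ring (LinearMap.ext fun x => ?_)))
  induction x using QuotientAddGroup.induction_on with
  | H x => exact h x

/-- The formal group law relations in `OB1`. -/
theorem OB1.fgl {f : X ⟶ Y} (hX : Smooth X.str) (L₁ L₂ : Pic X.sch) (α : OB f) (N : ℕ)
    (hN : ∀ i j, N ≤ i + j → (OB.chern f L₁)^[i] ((OB.chern f L₂)^[j] α) ∈ OB.preRel f)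
    (Ls : List (Pic X.sch)) :
    ∑ n ∈ Finset.range N, ∑ p ∈ Finset.HasAntidiagonal.antidiagonal n, lazardCoeff p.1 p.2 •
      OB1.mk f (OB.cherns f Ls ((OB.chern f L₁)^[p.1] ((OB.chern f L₂)^[p.2] α))) =
      OB1.mk f (OB.cherns f Ls (OB.chern f (L₁.tensor L₂) α)) := by
  have sq : IsPullback (mor (𝟙 X)) (mor f) (mor f) (mor (𝟙 Y)) := IsPullback.id_horiz (mor f)
  have h : LinearMap.baseChange Lazard (((QuotientAddGroup.mk' (OB.preRel f)).comp
      ((OB.push (𝟙 X) (isProper_id X) (Category.id_comp f)).comp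
        ((OB.cherns f Ls).comp (OB.pull sq)))).toIntLinearMap)
      (fglDefect (OB.chern f L₁) (OB.chern f L₂) (OB.chern f (L₁.tensor L₂)) N α) ∈
        OB.imposedFGL f :=
    Submodule.subset_span ⟨X, X, Y, 𝟙 X, isProper_id X, f, Category.id_comp f, 𝟙 X, f, 𝟙 Y, sq,
      IsSmoothEquidim.id Y, Ls, _, ⟨hX, L₁, L₂, α, N, hN, rfl⟩, rfl⟩
  have h1 := (Submodule.Quotient.mk_eq_zero (OB.imposedFGL f)).2 h
  rw [← Submodule.mkQ_apply, ← LinearMap.comp_apply, map_fglDefect, sub_eq_zero] at h1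
  have h2 (x : OB f) : OB.push (𝟙 X) (isProper_id X) (Category.id_comp f)
      (OB.cherns f Ls (OB.pull sq x)) = OB.cherns f Ls x := by rw [OB.pull_id, OB.push_id]
  have h3 (x : OB f) : OB1.mk f (OB.cherns f Ls x) = ((OB.imposedFGL f).mkQ ∘ₗ
      LinearMap.baseChange Lazard (((QuotientAddGroup.mk' (OB.preRel f)).comp
      ((OB.push (𝟙 X) (isProper_id X) (Category.id_comp f)).comp
        ((OB.cherns f Ls).comp (OB.pull sq)))).toIntLinearMap)) (1 ⊗ₜ x) :=
    congrArg (OB1.mk f) (h2 x).symm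
  simp only [h3]
  exact h1

end Classes
end Bordism

namespace Bordism

open QProj

/-! ### Ideals of polynomials all of whose multiples are killed by a linear map. -/

section Polynomials

theorem MvPolynomial.prod_X_eq_basisMonomials {σ R : Type*} [DecidableEq σ] [CommSemiring R]
    (l : List σ) : (l.map MvPolynomial.X).prod =
      MvPolynomial.basisMonomials σ R (Multiset.toFinsupp (l : Multiset σ)) := by
  induction l with
  | nil => rfl
  | cons L Ls ih =>
    rw [List.map_cons, List.prod_cons, ih, MvPolynomial.coe_basisMonomials, MvPolynomial.X,
      MvPolynomial.monomial_mul, one_mul, ← Multiset.cons_coe, ← Multiset.singleton_add, map_add,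
      Multiset.toFinsupp_singleton]

theorem MvPolynomial.linearMap_ext_prod {σ R M : Type*} [CommSemiring R] [AddCommMonoid M]
    [Module R M] {F G : MvPolynomial σ R →ₗ[R] M}
    (h : ∀ l : List σ, F (l.map MvPolynomial.X).prod = G (l.map MvPolynomial.X).prod) : F = G := by
  classical
  refine (MvPolynomial.basisMonomials σ R).ext fun m => ?_
  have e := MvPolynomial.prod_X_eq_basisMonomials (R := R) (Finsupp.toMultiset m).toList
  rw [Multiset.coe_toList, Finsupp.toMultiset_toFinsupp] at e
  rw [← e, h]

theorem MvPolynomial.map_mul_eq_of_prod {σ τ R M : Type*} [CommSemiring R] [AddCommMonoid M]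
    [Module R M] {F : MvPolynomial σ R →ₗ[R] M} {G : MvPolynomial τ R →ₗ[R] M}
    (p : MvPolynomial σ R) (f : σ → τ) (h : ∀ l : List σ, F (p * (l.map MvPolynomial.X).prod) =
      G ((l.map f).map MvPolynomial.X).prod) (q : MvPolynomial σ R) :
    F (p * q) = G (MvPolynomial.rename f q) := by
  refine DFunLike.congr_fun (MvPolynomial.linearMap_ext_prod (F := F ∘ₗ LinearMap.mulLeft R p)
    (G := G ∘ₗ (MvPolynomial.rename f).toLinearMap) fun l => (h l).trans ?_) q
  refine congrArg G (Eq.symm ?_)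
  change MvPolynomial.rename f (l.map MvPolynomial.X).prod = _
  rw [map_list_prod, List.map_map, List.map_map]
  exact congrArg List.prod (List.map_congr_left fun a _ => MvPolynomial.rename_X f a)

/-- The largest ideal on which a linear map vanishes. -/
def MvPolynomial.annIdeal {σ R M : Type*} [CommSemiring R] [AddCommMonoid M] [Module R M]
    (F : MvPolynomial σ R →ₗ[R] M) : Ideal (MvPolynomial σ R) where
  carrier := {p | ∀ q, F (q * p) = 0}
  zero_mem' q := by rw [mul_zero, map_zero]
  add_mem' hp hp' q := by rw [mul_add, map_add, hp, hp', add_zero]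
  smul_mem' r p hp q := by
    rw [smul_eq_mul, ← mul_assoc]
    exact hp _

theorem MvPolynomial.map_eq_zero_of_mem_annIdeal {σ R M : Type*} [CommSemiring R]
    [AddCommMonoid M] [Module R M] {F : MvPolynomial σ R →ₗ[R] M} {p : MvPolynomial σ R}
    (hp : p ∈ annIdeal F) : F p = 0 := by
  have h := hp 1
  rwa [one_mul] at h

theorem MvPolynomial.mem_annIdeal {σ R M : Type*} [CommSemiring R]
    [AddCommMonoid M] [Module R M] {F : MvPolynomial σ R →ₗ[R] M} {p : MvPolynomial σ R}
    (h : ∀ l : List σ, F (p * (l.map MvPolynomial.X).prod) = 0) : p ∈ annIdeal F := fun q => by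
  rw [mul_comm]
  exact MvPolynomial.map_mul_eq_of_prod (G := 0) p id h q

/-- In the application `h` is the section relation `c₁(L) q = i_* i^* q`. A product `c₁(L) q` is
then negligible as soon as the restriction of `q` to the zero scheme is. -/
theorem MvPolynomial.mul_mem_annIdeal {σ τ R M N : Type*} [CommSemiring R] [AddCommMonoid M]
    [Module R M] [AddCommMonoid N] [Module R N] {F : MvPolynomial σ R →ₗ[R] M}
    {G : MvPolynomial τ R →ₗ[R] N} {φ : N →ₗ[R] M} {p : MvPolynomial σ R} {f : σ → τ}
    (h : ∀ q, F (p * q) = φ (G (MvPolynomial.rename f q))) {q : MvPolynomial σ R}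
    (hq : MvPolynomial.rename f q ∈ annIdeal G) : p * q ∈ annIdeal F := fun r => by
  rw [mul_left_comm, h, map_mul, hq, map_zero]

/-- Only the shape `x + y + x y h` of a formal group law is ever needed. The truncation must keep
the linear terms, hence `2 ≤ N`. -/
theorem exists_sum_antidiagonal_eq {R A : Type*} [CommRing R] [CommRing A] [Algebra R A]
    {c : ℕ → ℕ → R} (hr : ∀ i, c i 0 = if i = 1 then 1 else 0)
    (hl : ∀ i, c 0 i = if i = 1 then 1 else 0) (x y : A) {N : ℕ} (hN : 2 ≤ N) :
    ∃ h : A, ∑ n ∈ Finset.range N, ∑ p ∈ Finset.HasAntidiagonal.antidiagonal n,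
      c p.1 p.2 • (x ^ p.1 * y ^ p.2) = x + y + x * y * h := by
  have h1 (p : ℕ × ℕ) : ∃ h : A, c p.1 p.2 • (x ^ p.1 * y ^ p.2) =
      (if p = (1, 0) then x else 0) + (if p = (0, 1) then y else 0) + x * y * h := by
    obtain ⟨_ | i, _ | j⟩ := p
    · refine ⟨0, ?_⟩
      rw [hr, if_neg zero_ne_one, zero_smul]
      simp
    · refine ⟨0, ?_⟩
      rw [hl]
      obtain _ | j := j
      · rw [if_pos rfl, one_smul]
        simp
      · rw [if_neg (by simp), zero_smul]
        simp
    · refine ⟨0, ?_⟩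
      rw [hr]
      obtain _ | i := i
      · rw [if_pos rfl, one_smul]
        simp
      · rw [if_neg (by simp), zero_smul]
        simp
    · refine ⟨c (i + 1) (j + 1) • (x ^ i * y ^ j), ?_⟩
      rw [if_neg (by simp), if_neg (by simp), zero_add, zero_add, mul_smul_comm]
      congr 1
      ring
  choose h hh using h1
  refine ⟨∑ n ∈ Finset.range N, ∑ p ∈ Finset.HasAntidiagonal.antidiagonal n, h p, ?_⟩
  have h2 (a : ℕ × ℕ) (ha : a.1 + a.2 < N) (z : A) : ∑ n ∈ Finset.range N,
      ∑ p ∈ Finset.HasAntidiagonal.antidiagonal n, (if p = a then z else 0) = z := by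
    simp only [Finset.sum_ite_eq', Finset.HasAntidiagonal.mem_antidiagonal]
    rw [Finset.sum_ite_eq, if_pos (Finset.mem_range.2 ha)]
  simp only [hh, Finset.sum_add_distrib, ← Finset.mul_sum]
  rw [h2 (1, 0) (by simp; omega), h2 (0, 1) (by simp; omega)]

theorem MvPolynomial.exists_sub_mem_annIdeal {σ R M : Type*} [CommRing R] [AddCommGroup M]
    [Module R M] {F : MvPolynomial σ R →ₗ[R] M} {c : ℕ → ℕ → R}
    (hr : ∀ i, c i 0 = if i = 1 then 1 else 0) (hl : ∀ i, c 0 i = if i = 1 then 1 else 0)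
    (x y z : MvPolynomial σ R) {N : ℕ} (hN : 2 ≤ N)
    (h : ∀ l : List σ, ∑ n ∈ Finset.range N, ∑ p ∈ Finset.HasAntidiagonal.antidiagonal n,
      c p.1 p.2 • F (x ^ p.1 * y ^ p.2 * (l.map MvPolynomial.X).prod) =
        F (z * (l.map MvPolynomial.X).prod)) :
    ∃ g, z - (x + y + x * y * g) ∈ annIdeal F := by
  obtain ⟨g, hg⟩ := exists_sum_antidiagonal_eq hr hl x y hN
  refine ⟨g, mem_annIdeal fun l => ?_⟩
  rw [sub_mul, map_sub, ← h, ← hg, Finset.sum_mul, map_sum, sub_eq_zero]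
  refine Finset.sum_congr rfl fun n _ => ?_
  rw [Finset.sum_mul, map_sum]
  refine Finset.sum_congr rfl fun p _ => ?_
  rw [smul_mul_assoc, map_smul]

end Polynomials

/-! ### Polynomials in first Chern classes acting on fundamental classes. -/

section ChernPolynomials

variable {k : Type u} [Field k] {X Y Z T V : QProj k}

theorem OB.chern_iterate (f : X ⟶ Y) (L : Pic X.sch) (n : ℕ) (x : OB f) :
    (OB.chern f L)^[n] x = OB.cherns f (List.replicate n L) x := by
  induction n with
  | zero => rfl
  | succ n ih => rw [Function.iterate_succ_apply', ih, List.replicate_succ, OB.cherns_cons]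

/-- The class `[id : T ⟶ T; L₁, …, L_r]`. -/
def cls (hT : Smooth T.str) (M : Multiset (Pic T.sch)) : OB1Cov T :=
  OB1.mk _ (OB.ofCyc (Cycle.self T M) hT)

/-- The value of a polynomial in first Chern class operators on the fundamental class of `T`. -/
def chernPoly (hT : Smooth T.str) : MvPolynomial (Pic T.sch) Lazard →ₗ[Lazard] OB1Cov T :=
  (MvPolynomial.basisMonomials (Pic T.sch) Lazard).constr Lazard
    fun m => cls hT (Finsupp.toMultiset m)

theorem chernPoly_prod (hT : Smooth T.str) (Ls : List (Pic T.sch)) :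
    chernPoly hT (Ls.map MvPolynomial.X).prod = cls hT Ls := by
  classical
  rw [MvPolynomial.prod_X_eq_basisMonomials, chernPoly, Module.Basis.constr_basis,
    Multiset.toFinsupp_toMultiset]

/-- The ideal of polynomials in first Chern class operators that vanish on all classes
`[id : T ⟶ T; L₁, …, L_r]`. -/
def relIdeal (hT : Smooth T.str) : Ideal (MvPolynomial (Pic T.sch) Lazard) :=
  MvPolynomial.annIdeal (chernPoly hT)

theorem chernPoly_eq_zero {hT : Smooth T.str} {p : MvPolynomial (Pic T.sch) Lazard}
    (hp : p ∈ relIdeal hT) : chernPoly hT p = 0 :=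
  MvPolynomial.map_eq_zero_of_mem_annIdeal hp

theorem relDim_mem_preRel (hT : Smooth T.str) (Ls : List (Pic T.sch))
    (h : topologicalKrullDim T.sch < (Ls.length : WithBot ℕ∞)) :
    OB.ofCyc (Cycle.self T Ls) hT ∈ OB.preRel (toPt T) := by
  have hf : Smooth (mor (toPt T)) := hT
  refine AddSubgroup.mem_sup_left ?_
  have h1 := OB.mem_imposed (R := OB.relDim) (f := toPt T)
    (ρ := OB.cherns _ Ls (OB.fund _ hf)) ⟨hT, hf, Ls, h, rfl⟩ []
  rwa [OB.cherns_nil, OB.cherns_fund hT] at h1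

/-- The empty scheme has dimension `⊥`, smaller than `0`, so even a product of no Chern classes is a
dimension relation. -/
theorem one_mem_relIdeal (hT : Smooth T.str) (h : IsEmpty T.sch) :
    (1 : MvPolynomial (Pic T.sch) Lazard) ∈ relIdeal hT := by
  refine MvPolynomial.mem_annIdeal fun Ls => ?_
  rw [one_mul, chernPoly_prod]
  refine OB1.mk_eq_zero (relDim_mem_preRel hT Ls ?_)
  have : IsEmpty (IrreducibleCloseds T.sch) := ⟨fun C => h.elim C.isIrreducible.nonempty.some⟩
  rw [topologicalKrullDim, Order.krullDim_eq_bot]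
  exact WithBot.bot_lt_coe _

/-- The section relation replaces `c₁(L) [T]` by `i_* [Z]`; the remaining Chern operators pass
through `i_*` by the projection formula, which restricts their bundles to `Z`. -/
theorem chernPoly_X_mul (hT : Smooth T.str) {L : LineBundle T.sch} {s : L.Sec} (hs : s.IsRegular)
    {i : Z ⟶ T} (hi : s.IsZeroScheme (mor i)) (hi' : IsProper (mor i)) (hZ : Smooth Z.str)
    {P : Pic T.sch} (hP : P = ⟦L⟧) (q : MvPolynomial (Pic T.sch) Lazard) :
    chernPoly hT (MvPolynomial.X P * q) = OB1Cov.push i hi'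
      (chernPoly hZ (MvPolynomial.rename (Pic.pull (mor i)) q)) := by
  refine MvPolynomial.map_mul_eq_of_prod (G := OB1Cov.push i hi' ∘ₗ chernPoly hZ) _ _ (fun Ls => ?_) q
  have hf : Smooth (mor (toPt T)) := hT
  have hf' : Smooth (mor (i ≫ toPt T)) := by
    rw [toPt_comp]
    exact hZ
  have h1 : OB1.mk (toPt T) (OB.cherns _ Ls (OB.chern (toPt T) P (OB.fund _ hf) -
      OB.push i hi' rfl (OB.fund _ hf'))) = 0 :=
    OB1.mk_eq_zero (AddSubgroup.mem_sup_right (OB.mem_imposed (R := OB.relSect) (f := toPt T)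
      ⟨hT, hf, L, s, Z, i, hs, hi, hZ, hi', hf', hP ▸ rfl⟩ Ls))
  rw [map_sub, map_sub, sub_eq_zero, ← OB.chern_cherns, ← OB.cherns_cons, OB.cherns_fund hT] at h1
  have h2 : chernPoly hT (MvPolynomial.X P * (Ls.map MvPolynomial.X).prod) =
      cls hT (P :: Ls : List (Pic T.sch)) := by
    rw [← chernPoly_prod, List.map_cons, List.prod_cons]
  have h4 : OB.cherns _ Ls (OB.push i hi' rfl (OB.fund _ hf')) =
      OB.push i hi' (toPt_comp i) (OB.ofCyc (Cycle.self Z (Ls.map (Pic.pull (mor i)))) hZ) := by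
    rw [OB.cherns_push]
    refine (congrArg (OB.push i hi' rfl) (OB.cherns_of _ _ _)).trans ?_
    refine OB.of_eq (Cycle.iso_of_eq (congrArg (Cycle.mk Z (𝟙 Z ≫ i) _) ?_))
    refine (add_zero _).trans ?_
    rw [← Multiset.map_coe]
    exact Cycle.pull_id_bundles Z _
  rw [h2, LinearMap.comp_apply, chernPoly_prod]
  refine h1.trans (Eq.trans (congrArg (OB1.mk (toPt T)) h4)
    (OB1.push_mk i hi' (toPt_comp i) _).symm)

theorem X_mul_mem_relIdeal (hT : Smooth T.str) {L : LineBundle T.sch} {s : L.Sec}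
    (hs : s.IsRegular) {i : Z ⟶ T} (hi : s.IsZeroScheme (mor i)) (hi' : IsProper (mor i))
    (hZ : Smooth Z.str) {P : Pic T.sch} (hP : P = ⟦L⟧) {p : MvPolynomial (Pic T.sch) Lazard}
    (hp : MvPolynomial.rename (Pic.pull (mor i)) p ∈ relIdeal hZ) :
    MvPolynomial.X P * p ∈ relIdeal hT :=
  MvPolynomial.mul_mem_annIdeal (chernPoly_X_mul hT hs hi hi' hZ hP) hp

theorem lazardCoeff_zero_right (i : ℕ) : lazardCoeff i 0 = if i = 1 then 1 else 0 := by
  unfold lazardCoeff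
  rw [MvPowerSeries.coeff_apply, genericSeries]
  by_cases h : i = 1
  · simp [h]
  · simp [h, Finsupp.ext_iff, Fin.forall_fin_two]

theorem lazardCoeff_zero_left (i : ℕ) : lazardCoeff 0 i = if i = 1 then 1 else 0 := by
  unfold lazardCoeff
  rw [MvPowerSeries.coeff_apply, genericSeries]
  by_cases h : i = 1
  · simp [h]
  · simp [h, Finsupp.ext_iff, Fin.forall_fin_two]

/-- The formal group law is applied to the fundamental class. With `dim T < N`, the dimension
relations kill all monomials of degree at least `N`; truncating at `N + 2` keeps the linear terms
even for `N` equal to `0` or `1`. -/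
theorem exists_X_tensor_sub_mem_relIdeal (hT : Smooth T.str) (L M : Pic T.sch) :
    ∃ h, MvPolynomial.X (L.tensor M) - (MvPolynomial.X L + MvPolynomial.X M +
      MvPolynomial.X L * MvPolynomial.X M * h) ∈ relIdeal hT := by
  obtain ⟨N, hN⟩ := T.exists_topologicalKrullDim_lt
  have hf : Smooth (mor (toPt T)) := hT
  refine MvPolynomial.exists_sub_mem_annIdeal lazardCoeff_zero_right lazardCoeff_zero_left _ _ _
    (N := N + 2) (by omega) fun Ls => ?_
  have h1 := OB1.fgl (f := toPt T) hT L M (OB.fund _ hf) (N + 2) (fun i j hij => by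
    rw [OB.chern_iterate, OB.chern_iterate, ← OB.cherns_append, OB.cherns_fund hT]
    refine relDim_mem_preRel hT _ (hN.trans_le ?_)
    rw [List.length_append, List.length_replicate, List.length_replicate]
    exact_mod_cast (by omega : N ≤ i + j)) Ls
  have h2 (i j : ℕ) : chernPoly hT (MvPolynomial.X L ^ i * MvPolynomial.X M ^ j *
      (Ls.map MvPolynomial.X).prod) = OB1.mk _ (OB.cherns _ Ls ((OB.chern _ L)^[i]
        ((OB.chern _ M)^[j] (OB.fund _ hf)))) := by
    rw [OB.chern_iterate, OB.chern_iterate, ← OB.cherns_append, ← OB.cherns_append,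
      OB.cherns_fund hT]
    refine Eq.trans ?_ (chernPoly_prod hT _)
    rw [List.map_append, List.map_append, List.map_replicate, List.map_replicate,
      List.prod_append, List.prod_append, List.prod_replicate, List.prod_replicate, mul_comm,
      mul_assoc]
  have h3 : chernPoly hT (MvPolynomial.X (L.tensor M) * (Ls.map MvPolynomial.X).prod) =
      OB1.mk _ (OB.cherns _ Ls (OB.chern _ (L.tensor M) (OB.fund _ hf))) := by
    rw [← OB.chern_cherns, ← OB.cherns_cons, OB.cherns_fund hT]
    refine Eq.trans ?_ (chernPoly_prod hT _)
    rw [List.map_cons, List.prod_cons]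
  rw [h3, ← h1]
  exact Finset.sum_congr rfl fun n _ => Finset.sum_congr rfl fun p _ =>
    congrArg (lazardCoeff p.1 p.2 • ·) (h2 p.1 p.2)

end ChernPolynomials
end Bordism

/-! ### Vanishing of long products of pulled back Chern classes. -/

namespace Bordism

open QProj

theorem LineBundle.pull_tensor {X Y : Scheme.{u}} (f : Y ⟶ X) (L M : LineBundle X) :
    (pull f (L.tensor M)).Iso ((pull f L).tensor (pull f M)) :=
  ⟨(pull f (L.tensor M)).nbhd, (pull f (L.tensor M)).mem_nbhd, fun _ => le_rfl, fun _ => le_rfl,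
    fun _ => 1, fun x y => by
      rw [Units.val_one, Units.val_one, map_one, map_one, one_mul, mul_one]
      refine congrArg _ (Eq.symm ?_)
      refine (map_mul (f.app ((L.tensor M).nbhd (f x) ⊓ (L.tensor M).nbhd (f y))).hom _ _).trans ?_
      exact congrArg₂ (· * ·) (app_res f _ _) (app_res f _ _)⟩

theorem Pic.pull_tensor {X Y : Scheme.{u}} (f : Y ⟶ X) (L M : Pic X) :
    pull f (L.tensor M) = (pull f L).tensor (pull f M) := by
  induction L using Quotient.inductionOn with
  | _ L =>
    induction M using Quotient.inductionOn with
    | _ M => exact Quotient.sound (LineBundle.pull_tensor f L M)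

section Nilpotence

variable {k : Type u} [Field k]

/-- Modulo `J` one has `x = z - y - x y h`, so `p` annihilates `x` once it annihilates `z` and `y`.
In the application `x`, `y`, `z` are the Chern classes of `L`, `B` and `L ⊗ B`. -/
theorem MvPolynomial.mul_mem_of_sub_mem {σ R : Type*} [CommRing R] {J : Ideal (MvPolynomial σ R)}
    {x y z h p : MvPolynomial σ R}
    (hxyz : z - (x + y + x * y * h) ∈ J) (hz : z * p ∈ J) (hy : y * p ∈ J) : x * p ∈ J := by
  have e : x * p = z * p - (z - (x + y + x * y * h)) * p - (1 + x * h) * (y * p) := by ring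
  rw [e]
  exact J.sub_mem (J.sub_mem hz (J.mul_mem_right _ hxyz)) (J.mul_mem_left _ hy)

/-- Monomials of length greater than the dimension of `V` in line bundles pulled back along a
smooth morphism to `V` vanish. -/
theorem prod_mem_relIdeal [CharZero k] {T V : QProj k} (hT : Smooth T.str) (hV : Smooth V.str)
    (p : T ⟶ V) (hp : Smooth (mor p)) (Ls : List (Pic V.sch))
    (h : topologicalKrullDim V.sch < (Ls.length : WithBot ℕ∞)) :
    ((Ls.map (Pic.pull (mor p))).map MvPolynomial.X).prod ∈ relIdeal hT := by
  generalize hn : Ls.length = n at h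
  -- The bound concerns the dimension of `V` and not that of `T`, so `V` shrinks along the induction
  -- while `T` follows by base change.
  induction n generalizing T V with
  | zero =>
    obtain rfl := List.length_eq_zero_iff.1 hn
    -- Here `dim V < 0`, so `V` is empty, and with it `T`.
    refine one_mem_relIdeal hT ⟨fun t => ?_⟩
    have : Nonempty (IrreducibleCloseds V.sch) :=
      ⟨⟨closure {mor p t}, isIrreducible_singleton.closure, isClosed_closure⟩⟩
    exact (Order.krullDim_nonneg (α := IrreducibleCloseds V.sch)).not_gt h
  | succ n ih =>
    obtain ⟨P, Ls, rfl⟩ := List.exists_cons_of_length_eq_add_one hn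
    rw [List.map_cons, List.map_cons, List.prod_cons]
    -- For a generated bundle, take a transverse section on `V` and pull it back to `T`. Its zero
    -- scheme `Z ×_V T` is smooth over `Z`, where `dim Z < dim V`, and one bundle fewer remains.
    have hgen {ι : Type u} (_ : Finite ι) {M : LineBundle V.sch} {s : ι → M.Sec}
        (hs : LineBundle.Generate s) : MvPolynomial.X (Pic.pull (mor p) ⟦M⟧) *
          ((Ls.map (Pic.pull (mor p))).map MvPolynomial.X).prod ∈ relIdeal hT := by
      have := Fintype.ofFinite ι
      obtain ⟨t, ht, htZ⟩ := hs.exists_transverse hV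
      obtain ⟨Z, i, hi⟩ := t.exists_isZeroScheme
      have hZ := htZ Z i hi
      have sq := fibreProd.isPullback i p
      have hq : Smooth (mor (fibreProd.fst i p)) :=
        MorphismProperty.of_isPullback (P := @Smooth) sq.flip hp
      have hi' : IsProper (mor i) := by
        have := hi.1
        infer_instance
      have hj : IsProper (mor (fibreProd.snd i p)) := isProper_of_isPullback sq hi'
      refine X_mul_mem_relIdeal hT (ht.pull (mor p)) (hi.pull (mor p) sq.flip) hj
        (smooth_str_of_smooth hq hZ) rfl ?_
      have h1 := ih (smooth_str_of_smooth hq hZ) hZ _ hq (Ls.map (Pic.pull (mor i)))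
        ((List.length_map _).trans (Nat.succ_injective hn)) (ht.topologicalKrullDim_lt hV hi h)
      have h2 : MvPolynomial.rename (R := Lazard) (Pic.pull (mor (fibreProd.snd i p)))
          ((Ls.map (Pic.pull (mor p))).map MvPolynomial.X).prod =
          (((Ls.map (Pic.pull (mor i))).map (Pic.pull (mor (fibreProd.fst i p)))).map
            MvPolynomial.X).prod := by
        rw [map_list_prod, List.map_map, List.map_map, List.map_map, List.map_map]
        refine congrArg List.prod (List.map_congr_left fun a _ => ?_)
        refine (MvPolynomial.rename_X _ _).trans (congrArg MvPolynomial.X ?_)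
        exact (Pic.pull_comp _ _ _).symm.trans ((congrArg (fun f => Pic.pull f a) sq.w.symm).trans
          (Pic.pull_comp _ _ _))
      rw [h2]
      exact h1
    have := V.noetherianSpace
    obtain ⟨A, hA⟩ := V.property.exists_ample
    induction P using Quotient.inductionOn with
    | _ L =>
      obtain ⟨ι, hι, M, B, s, t, hM, hs, ht⟩ := LineBundle.exists_generate L hA
      -- The general case: the formal group law expresses `c₁(L)` through the Chern classes of the
      -- two generated bundles `B` and `M`, both treated by `hgen`.
      obtain ⟨g, hg⟩ := exists_X_tensor_sub_mem_relIdeal hT (Pic.pull (mor p) ⟦L⟧)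
        (Pic.pull (mor p) ⟦B⟧)
      have e : (Pic.pull (mor p) ⟦L⟧).tensor (Pic.pull (mor p) ⟦B⟧) = Pic.pull (mor p) ⟦M⟧ :=
        (Pic.pull_tensor _ _ _).symm.trans (congrArg (Pic.pull (mor p)) (Quotient.sound hM))
      rw [e] at hg
      exact MvPolynomial.mul_mem_of_sub_mem hg (hgen hι hs) (hgen hι ht)

end Nilpotence
end Bordism

namespace Bordism

open QProj

/-! ### Cutting line bundles and sections along idempotents. -/

namespace LineBundle

variable {X Y Z : Scheme.{u}}

theorem Iso.of_trans {L M : LineBundle X} {N : X → X.Opens} (hN : ∀ x, x ∈ N x)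
    (hL : ∀ x, N x ≤ L.nbhd x) (hM : ∀ x, N x ≤ M.nbhd x)
    (h : ∀ x y, res (inf_le_inf (hM x) (hM y)) (M.trans x y) =
      res (inf_le_inf (hL x) (hL y)) (L.trans x y)) : L.Iso M :=
  ⟨N, hN, hL, hM, fun _ => 1, fun x y => by
    rw [Units.val_one, Units.val_one, map_one, map_one, one_mul, mul_one, h]⟩

/-- The function that is `a` where the idempotent `e` is `1` and `1` where `e` is `0`. -/
def idemFun (e : Γ(X, ⊤)) {U : X.Opens} (a : Γ(X, U)) : Γ(X, U) :=
  res le_top e * a + (1 - res le_top e)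

theorem res_idemFun (e : Γ(X, ⊤)) {U V : X.Opens} (h : V ≤ U) (a : Γ(X, U)) :
    res h (idemFun e a) = idemFun e (res h a) := by
  simp only [idemFun, map_mul, map_add, map_sub, map_one, res_res]

theorem idemFun_mul {e : Γ(X, ⊤)} (he : e * e = e) {U : X.Opens} (a b : Γ(X, U)) :
    idemFun e (a * b) = idemFun e a * idemFun e b := by
  have h := congrArg (res (le_top : U ≤ ⊤)) he
  rw [map_mul] at h
  simp only [idemFun]
  linear_combination (-a * b + a + b - 1) * h

theorem idemFun_add {e f : Γ(X, ⊤)} (h : e * f = 0) {U : X.Opens} (a : Γ(X, U)) :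
    idemFun (e + f) a = idemFun e a * idemFun f a := by
  have h := congrArg (res (le_top : U ≤ ⊤)) h
  rw [map_mul, map_zero] at h
  simp only [idemFun, map_add]
  linear_combination (-(a - 1) ^ 2) * h

theorem idemFun_apply_one (e : Γ(X, ⊤)) {U : X.Opens} : idemFun e (1 : Γ(X, U)) = 1 := by
  rw [idemFun, mul_one, add_sub_cancel]

theorem one_idemFun {U : X.Opens} (a : Γ(X, U)) : idemFun 1 a = a := by
  rw [idemFun, map_one, one_mul, sub_self, add_zero]

theorem zero_idemFun {U : X.Opens} (a : Γ(X, U)) : idemFun 0 a = 1 := by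
  rw [idemFun, map_zero, zero_mul, sub_zero, zero_add]

theorem app_idemFun (f : Y ⟶ X) (e : Γ(X, ⊤)) {U : X.Opens} (a : Γ(X, U)) :
    (f.app U).hom (idemFun e a) = idemFun ((f.app ⊤).hom e) ((f.app U).hom a) := by
  simp only [idemFun, map_mul, map_add, map_sub, map_one, app_res]
  rfl

/-- The line bundle that is `L` where the idempotent `e` is `1` and trivial where `e` is `0`. -/
def idem (L : LineBundle X) (e : Γ(X, ⊤)) (he : e * e = e) : LineBundle X where
  nbhd := L.nbhd
  mem_nbhd := L.mem_nbhd
  trans x y := idemFun e (L.trans x y)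
  trans_self x := by rw [L.trans_self, idemFun_apply_one]
  cocycle x y z V hxy hyz hxz := by
    rw [res_idemFun, res_idemFun, res_idemFun, ← idemFun_mul he, L.cocycle x y z V hxy hyz hxz]

/-- The section that is `s` where the idempotent `e` is `1` and `1` where `e` is `0`. -/
def Sec.idem {L : LineBundle X} (s : L.Sec) (e : Γ(X, ⊤)) (he : e * e = e) : (L.idem e he).Sec where
  val x := idemFun e (s.val x)
  compat x y := (res_idemFun e _ _).trans ((congrArg _ (s.compat x y)).trans
    ((idemFun_mul he _ _).trans (congrArg _ (res_idemFun e _ _).symm)))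

theorem mem_nonZeroDivisors_of_idem {R : Type*} [CommRing R] {e a : R} (he : e * e = e)
    (ha : a ∈ nonZeroDivisors R) : e * a + (1 - e) ∈ nonZeroDivisors R := by
  rw [mem_nonZeroDivisors_iff_right] at ha ⊢
  intro b hb
  have h1 : e * b = 0 := ha _ (by linear_combination e * hb + (b - a * b) * he)
  linear_combination hb + (1 - a) * h1

theorem Sec.IsRegular.idem {L : LineBundle X} {s : L.Sec} (hs : s.IsRegular) (e : Γ(X, ⊤))
    (he : e * e = e) : (s.idem e he).IsRegular := fun x V hV => by
  have h := congrArg (res (le_top : V.1 ≤ ⊤)) he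
  rw [map_mul] at h
  have h1 := mem_nonZeroDivisors_of_idem h (hs x V hV)
  exact (res_idemFun e hV (s.val x)).symm ▸ h1

theorem idem_one (L : LineBundle X) : (L.idem 1 (one_mul 1)).Iso L :=
  .of_trans (N := L.nbhd) L.mem_nbhd (fun _ => le_rfl) (fun _ => le_rfl) fun x y =>
    congrArg (res _) (one_idemFun (L.trans x y)).symm

theorem idem_tensor (L : LineBundle X) {e f : Γ(X, ⊤)} (he : e * e = e) (hf : f * f = f)
    (hef : e * f = 0) (h : (e + f) * (e + f) = e + f) :
    ((L.idem e he).tensor (L.idem f hf)).Iso (L.idem (e + f) h) :=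
  .of_trans (N := L.nbhd) L.mem_nbhd (fun _ => le_inf le_rfl le_rfl) (fun _ => le_rfl) fun x y => by
    rw [res_tensor]
    refine (res_self _ _).trans (Eq.trans ?_ (congrArg₂
      (fun a b : Γ(X, L.nbhd x ⊓ L.nbhd y) => a * b) (res_self le_rfl _)
      (res_self le_rfl _)).symm)
    exact idemFun_add hef (L.trans x y)

/-- The function `e s + (1 - e)` is `s` where `e = 1` and a unit where `e = 0`, so membership in its
ideal is a condition on the first part only. -/
theorem mem_span_idem_iff {R : Type*} [CommRing R] {e s : R} (he : e * e = e) (a : R) :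
    e * a ∈ Ideal.span {s} ↔ a ∈ Ideal.span {e * s + (1 - e)} := by
  rw [Ideal.mem_span_singleton', Ideal.mem_span_singleton']
  constructor
  · rintro ⟨b, hb⟩
    exact ⟨e * b + (1 - e) * a, by linear_combination e * hb + (b * s - b - a * s + 2 * a) * he⟩
  · rintro ⟨b, hb⟩
    exact ⟨e * b, by linear_combination e * hb + (b - b * s) * he⟩

/-- The zero scheme of `s` on the part of `X` where the idempotent `e` is `1`. -/
theorem Sec.IsZeroScheme.idem {L : LineBundle X} {s : L.Sec} {i : Z ⟶ X} (hi : s.IsZeroScheme i)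
    (e : Γ(X, ⊤)) (he : e * e = e) (j : Y ⟶ Z) [IsClosedImmersion j]
    (hj : ∀ (U : Z.Opens) (a : Γ(Z, U)), (j.app U).hom a = 0 ↔
      res le_top ((i.app ⊤).hom e) * a = 0) : (s.idem e he).IsZeroScheme (j ≫ i) := by
  have := hi.1
  refine ⟨inferInstance, fun x V hV => ?_⟩
  have h := congrArg (res (le_top : V.1 ≤ ⊤)) he
  rw [map_mul] at h
  have h0 := hi.2 x V hV
  have h1 (a : Γ(X, V.1)) : a ∈ (j ≫ i).ker.ideal V ↔ res le_top e * a ∈ i.ker.ideal V := by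
    rw [Scheme.Hom.ker_apply, Scheme.Hom.ker_apply, RingHom.mem_ker, RingHom.mem_ker, map_mul,
      app_res]
    exact hj _ _
  ext a
  rw [h1, h0, mem_span_idem_iff h]
  exact (congrArg (a ∈ Ideal.span {·}) (res_idemFun e hV (s.val x))).to_iff.symm

theorem Sec.isEmpty_of_isZeroScheme {L : LineBundle X} {s : L.Sec} {i : Z ⟶ X}
    (hi : s.IsZeroScheme i) (hs : ∀ x, IsUnit (s.val x)) : IsEmpty Z := by
  have := hi.1
  refine ⟨fun z => ?_⟩
  obtain ⟨V, hV, hx, hV'⟩ := exists_isAffineOpen_mem_and_subset (L.mem_nbhd (i z))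
  have h := hi.2 (i z) ⟨V, hV⟩ hV'
  rw [Ideal.span_singleton_eq_top.2 ((hs _).map _), Scheme.Hom.ker_apply, Ideal.eq_top_iff_one,
    RingHom.mem_ker, map_one] at h
  have h2 : Z.basicOpen (1 : Γ(Z, i ⁻¹ᵁ V)) = i ⁻¹ᵁ V := Z.basicOpen_of_isUnit isUnit_one
  have h3 : Z.basicOpen (0 : Γ(Z, i ⁻¹ᵁ V)) = ⊥ := Z.basicOpen_zero _
  rw [← h, h2] at h3
  exact (h3.le hx : z ∈ (⊥ : Z.Opens))

end LineBundle

end Bordism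

/-! ### Additivity of fundamental classes over connected components. -/

namespace Bordism

open QProj

theorem app_app_of_comp_eq_id {X Y : Scheme.{u}} {f : X ⟶ Y} {g : Y ⟶ X} (h : f ≫ g = 𝟙 X)
    (a : Γ(X, ⊤)) : (f.app ⊤).hom ((g.app ⊤).hom a) = a := by
  have h1 : (f ≫ g).appTop.hom a = a := by
    rw [h, Scheme.Hom.id_appTop]
    rfl
  rwa [Scheme.Hom.comp_appTop] at h1

theorem MvPolynomial.map_mul_eq_sum {σ R M ι : Type*} [CommRing R] [AddCommGroup M]
    [Module R M] {F : MvPolynomial σ R →ₗ[R] M} {s : Finset ι} {x : ι → MvPolynomial σ R}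
    {z : MvPolynomial σ R} (h : z - ∑ c ∈ s, x c ∈ annIdeal F) (q : MvPolynomial σ R) :
    F (z * q) = ∑ c ∈ s, F (x c * q) := by
  have h1 := h q
  rwa [mul_comm, sub_mul, Finset.sum_mul, map_sub, map_sum, sub_eq_zero] at h1

theorem MvPolynomial.sub_add_mem {σ R : Type*} [CommRing R] {J : Ideal (MvPolynomial σ R)}
    {x y z w h : MvPolynomial σ R} (hz : z - (x + y + x * y * h) ∈ J) (hxy : x * y ∈ J)
    (hy : y - w ∈ J) : z - (x + w) ∈ J := by
  have e : z - (x + w) = z - (x + y + x * y * h) + x * y * h + (y - w) := by ring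
  rw [e]
  exact J.add_mem (J.add_mem hz (J.mul_mem_right _ hxy)) hy

theorem MvPolynomial.sub_zero_mem {σ R : Type*} [CommRing R] {J : Ideal (MvPolynomial σ R)}
    {x : MvPolynomial σ R} (h : x ∈ J) : x - 0 ∈ J := by
  rwa [sub_zero]

theorem MvPolynomial.rename_X_mem {σ τ R : Type*} [CommRing R] {J : Ideal (MvPolynomial τ R)}
    {f : σ → τ} {a : σ} (h : MvPolynomial.X (f a) ∈ J) :
    MvPolynomial.rename f (MvPolynomial.X a) ∈ J := by
  rwa [MvPolynomial.rename_X]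

/-- The isomorphism class of a line bundle. -/
def Pic.of {X : Scheme.{u}} (L : LineBundle X) : Pic X := ⟦L⟧

theorem ι_app_eq_zero_iff {X : Scheme.{u}} (V U : X.Opens) (a : Γ(X, U)) :
    (V.ι.app U).hom a = 0 ↔ res (inf_le_left : U ⊓ V ≤ U) a = 0 := by
  have e : V.ι ''ᵁ V.ι ⁻¹ᵁ U = U ⊓ V := by
    rw [Scheme.Hom.image_preimage_eq_opensRange_inf, Scheme.Opens.opensRange_ι, inf_comm]
  have e' : V.ι ''ᵁ V.ι ⁻¹ᵁ U ≤ U := e.le.trans inf_le_left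
  change res e' a = 0 ↔ _
  constructor
  · intro h
    rw [← res_res e' e.ge, h, map_zero]
  · intro h
    rw [← res_res inf_le_left e.le, h, map_zero]

section Additivity

variable {k : Type u} [Field k] {X Y Z T W : QProj k}

theorem Comp.smooth (hW : Smooth W.str) (C : Comp W.sch) : Smooth (clopenSub W C.1 C.2.1).str :=
  inferInstanceAs (Smooth (C.1.ι ≫ W.str))

theorem Comp.le_iSup (hW : Smooth W.str) (U : W.sch.Opens) :
    U ≤ ⨆ C : Comp W.sch, U ⊓ C.1 := fun x hx => by
  obtain ⟨C, y, rfl⟩ := (IsDisjointCover.comp W hW).cover x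
  exact Opens.mem_iSup.2 ⟨C, hx, y.2⟩

theorem Comp.inf_eq_bot (hW : Smooth W.str) {C D : Comp W.sch} (h : C ≠ D) : C.1 ⊓ D.1 = ⊥ := by
  refine Opens.ext (Set.disjoint_iff_inter_eq_empty.1 ?_)
  have h1 : Disjoint (Set.range C.1.ι) (Set.range D.1.ι) :=
    (IsDisjointCover.comp W hW).disjoint C D h
  rwa [Scheme.Opens.range_ι, Scheme.Opens.range_ι] at h1

theorem Comp.ext_res (hW : Smooth W.str) {U : W.sch.Opens} {a b : Γ(W.sch, U)}
    (h : ∀ C : Comp W.sch, res (inf_le_left : U ⊓ C.1 ≤ U) a = res inf_le_left b) : a = b :=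
  W.sch.sheaf.eq_of_locally_eq' (fun C : Comp W.sch => U ⊓ C.1) U (fun _ => homOfLE inf_le_left)
    (Comp.le_iSup hW U) a b h

theorem subsingleton_of_eq_bot {X : Scheme.{u}} {U : X.Opens} (h : U = ⊥) :
    Subsingleton Γ(X, U) := by
  subst h
  infer_instance

open Classical in
theorem Comp.exists_idem (hW : Smooth W.str) (C : Comp W.sch) : ∃ e : Γ(W.sch, ⊤),
    ∀ D : Comp W.sch, res (le_top : D.1 ≤ ⊤) e = if C = D then 1 else 0 := by
  obtain ⟨e, he, -⟩ := W.sch.sheaf.existsUnique_gluing' (fun D : Comp W.sch => D.1) ⊤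
    (fun _ => homOfLE le_top) ((Comp.le_iSup hW ⊤).trans (iSup_mono fun _ => inf_le_right))
    (fun D => (if C = D then 1 else 0 : Γ(W.sch, D.1))) (fun D D' => by
      by_cases h : D = D'
      · subst h
        rfl
      · have := subsingleton_of_eq_bot (Comp.inf_eq_bot hW h)
        exact Subsingleton.elim (α := Γ(W.sch, D.1 ⊓ D'.1)) _ _)
  exact ⟨e, he⟩

/-- The function that is `1` on the component `C` and `0` on the others. -/
def Comp.idem (hW : Smooth W.str) (C : Comp W.sch) : Γ(W.sch, ⊤) := (Comp.exists_idem hW C).choose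

open Classical in
theorem Comp.res_idem (hW : Smooth W.str) (C D : Comp W.sch) {U : W.sch.Opens} (h : U ≤ D.1) :
    res (le_top : U ≤ ⊤) (C.idem hW) = if C = D then 1 else 0 := by
  have h1 := congrArg (res h) ((Comp.exists_idem hW C).choose_spec D)
  rw [res_res] at h1
  refine h1.trans ?_
  split_ifs
  · exact map_one _
  · exact map_zero _

theorem Comp.idem_mul_self (hW : Smooth W.str) (C : Comp W.sch) :
    C.idem hW * C.idem hW = C.idem hW := Comp.ext_res hW fun D => by
  rw [map_mul, Comp.res_idem hW C D inf_le_right]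
  split_ifs <;> simp

theorem Comp.idem_mul (hW : Smooth W.str) {C D : Comp W.sch} (h : C ≠ D) :
    C.idem hW * D.idem hW = 0 := Comp.ext_res hW fun E => by
  rw [map_mul, Comp.res_idem hW C E inf_le_right, Comp.res_idem hW D E inf_le_right, map_zero]
  split_ifs with h1 h2
  · exact absurd (h1.trans h2.symm) h
  all_goals simp

theorem Comp.sum_idem (hW : Smooth W.str) [Fintype (Comp W.sch)] :
    ∑ C : Comp W.sch, C.idem hW = 1 := Comp.ext_res hW fun E => by
  classical
  rw [map_sum, map_one]
  simp only [Comp.res_idem hW _ E inf_le_right]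
  rw [Finset.sum_ite_eq', if_pos (Finset.mem_univ _)]

theorem Comp.app_eq_zero_iff (hW : Smooth W.str) (C : Comp W.sch) (U : W.sch.Opens)
    (a : Γ(W.sch, U)) : ((mor (clopenSub.ι W C.1 C.2.1)).app U).hom a = 0 ↔
      res le_top (C.idem hW) * a = 0 := by
  classical
  have h : ((mor (clopenSub.ι W C.1 C.2.1)).app U).hom a = 0 ↔
      res (inf_le_left : U ⊓ C.1 ≤ U) a = 0 :=
    ι_app_eq_zero_iff C.1 U a
  rw [h]
  constructor
  · refine fun h => Comp.ext_res hW fun D => ?_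
    rw [map_mul, res_res, Comp.res_idem hW C D inf_le_right, map_zero]
    split_ifs with hCD
    · subst hCD
      rw [h, mul_zero]
    · rw [zero_mul]
  · intro h
    have h1 := congrArg (res (inf_le_left : U ⊓ C.1 ≤ U)) h
    rwa [map_mul, res_res, Comp.res_idem hW C C inf_le_right, if_pos rfl, one_mul, map_zero] at h1

theorem OB1Cov.push_id (h : IsProper (mor (𝟙 X))) (x : OB1Cov X) : OB1Cov.push (𝟙 X) h x = x :=
  LinearMap.congr_fun (g := LinearMap.id) (OB1.hom_ext fun x =>
    congrArg (OB1.mk _) (OB.push_id _ h _ x)) x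

theorem OB1Cov.push_comp (f : X ⟶ Y) (g : Y ⟶ Z) (hf : IsProper (mor f)) (hg : IsProper (mor g))
    (hfg : IsProper (mor (f ≫ g))) (x : OB1Cov X) :
    OB1Cov.push (f ≫ g) hfg x = OB1Cov.push g hg (OB1Cov.push f hf x) :=
  LinearMap.congr_fun (g := OB1Cov.push g hg ∘ₗ OB1Cov.push f hf) (OB1.hom_ext fun x =>
    congrArg (OB1.mk _) (OB.push_push f hf g hg hfg _ _ _ x).symm) x

/-- A nowhere vanishing section has empty zero scheme, and the section relation gives `c₁(L) = i_*
0`. So the Chern class of a trivial bundle is zero. -/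
theorem X_mem_relIdeal (hT : Smooth T.str) {L : LineBundle T.sch} {s : L.Sec}
    (hs : ∀ x, IsUnit (s.val x)) {P : Pic T.sch} (hP : P = ⟦L⟧) :
    MvPolynomial.X P ∈ relIdeal hT := by
  obtain ⟨Z, i, hi⟩ := s.exists_isZeroScheme
  have hZ := LineBundle.Sec.isEmpty_of_isZeroScheme hi hs
  have := hi.1
  have hi' : IsProper (mor i) := inferInstance
  have hZ' : Smooth Z.str := inferInstance
  have h := X_mul_mem_relIdeal hT (fun x V h => ((hs x).map (res h)).mem_nonZeroDivisors) hi hi' hZ'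
    hP (p := 1) (by
      rw [map_one]
      exact one_mem_relIdeal hZ' hZ)
  rwa [mul_one] at h

/-- Additivity of fundamental classes, given a section of `T ⟶ W` that is the zero scheme of a
section of a line bundle. -/
theorem chernPoly_eq_sum_of_isZeroScheme (hW : Smooth W.str) (hT : Smooth T.str) (p : T ⟶ W)
    (hp : IsProper (mor p)) (i : W ⟶ T) (hip : i ≫ p = 𝟙 W) {L : LineBundle T.sch} {s : L.Sec}
    (hs : s.IsRegular) (hi : s.IsZeroScheme (mor i)) [Fintype (Comp W.sch)]
    (q : MvPolynomial (Pic W.sch) Lazard) :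
    chernPoly hW q = ∑ C : Comp W.sch, OB1Cov.push (clopenSub.ι W C.1 C.2.1)
      (clopenSub.isProper_ι _ _ _) (chernPoly (C.smooth hW)
        (MvPolynomial.rename (Pic.pull (mor (clopenSub.ι W C.1 C.2.1))) q)) := by
  classical
  have hi' : IsProper (mor i) := by
    have := hi.1
    infer_instance
  have hip' : mor i ≫ mor p = 𝟙 W.sch := congrArg mor hip
  -- The idempotents of `W`, pulled back to `T` along `p`; since `p` has the section `i`,
  -- restricting them to `W` gives back the original ones.
  let e (C : Comp W.sch) : Γ(T.sch, ⊤) := ((mor p).app ⊤).hom (C.idem hW)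
  have he (C : Comp W.sch) : e C * e C = e C :=
    (map_mul _ _ _).symm.trans (congrArg _ (C.idem_mul_self hW))
  have hie (C : Comp W.sch) : ((mor i).app ⊤).hom (e C) = C.idem hW :=
    app_app_of_comp_eq_id hip' _
  let j (C : Comp W.sch) : clopenSub W C.1 C.2.1 ⟶ T := clopenSub.ι W C.1 C.2.1 ≫ i
  have hj (C : Comp W.sch) : IsProper (mor (j C)) :=
    isProper_comp (clopenSub.isProper_ι _ _ _) hi'
  have hjC (C : Comp W.sch) : (s.idem (e C) (he C)).IsZeroScheme (mor (j C)) := by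
    have := clopenSub.isClosedImmersion_ι W C.1 C.2.1
    refine hi.idem (e C) (he C) (mor (clopenSub.ι W C.1 C.2.1)) fun U a => ?_
    rw [hie]
    exact C.app_eq_zero_iff hW U a
  have hje (C : Comp W.sch) : ((mor (j C)).app ⊤).hom (e C) = 1 := by
    have h : ((mor (j C)).app ⊤).hom (e C - 1) = 0 := by
      refine (C.app_eq_zero_iff hW ⊤ (((mor i).app ⊤).hom (e C - 1))).2 ?_
      rw [map_sub, map_one, hie, res_self]
      exact (mul_sub _ _ _).trans (sub_eq_zero.2 ((C.idem_mul_self hW).trans (mul_one _).symm))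
    rwa [map_sub, map_one, sub_eq_zero] at h
  -- The section relation for the first factor restricts the second to `C`. There `f` is `0`, so the
  -- second bundle has a nowhere vanishing section.
  have hprod (C : Comp W.sch) (f : Γ(T.sch, ⊤)) (hf : f * f = f) (hef : e C * f = 0) :
      MvPolynomial.X (Pic.of (L.idem (e C) (he C))) *
        MvPolynomial.X (Pic.of (L.idem f hf)) ∈ relIdeal hT := by
    refine X_mul_mem_relIdeal hT (hs.idem _ _) (hjC C) (hj C) (C.smooth hW) rfl ?_
    refine MvPolynomial.rename_X_mem ?_
    have h0 : ((mor (j C)).app ⊤).hom f = 0 := by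
      have h := congrArg ((mor (j C)).app ⊤).hom hef
      rwa [map_mul, hje, one_mul, map_zero] at h
    refine X_mem_relIdeal (C.smooth hW) (s := (s.idem f hf).pull (mor (j C))) (fun x => ?_) rfl
    exact (congrArg IsUnit ((LineBundle.app_idemFun (mor (j C)) f _).trans
      ((congrArg (LineBundle.idemFun · _) h0).trans (LineBundle.zero_idemFun _)))).mpr isUnit_one
  -- By induction on `S`, the bundle cut out by the sum of orthogonal idempotents is the tensor
  -- product of the single ones. The mixed term of the formal group law vanishes by `hprod`, so the
  -- Chern classes add.
  have hsum (S : Finset (Comp W.sch)) : ∃ h : (∑ C ∈ S, e C) * (∑ C ∈ S, e C) = ∑ C ∈ S, e C,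
      MvPolynomial.X (Pic.of (L.idem _ h)) -
        ∑ C ∈ S, MvPolynomial.X (Pic.of (L.idem (e C) (he C))) ∈ relIdeal hT := by
    induction S using Finset.induction_on with
    | empty =>
      rw [Finset.sum_empty, Finset.sum_empty]
      refine ⟨mul_zero 0, ?_⟩
      exact MvPolynomial.sub_zero_mem (X_mem_relIdeal hT (s := s.idem _ _) (fun x => (congrArg IsUnit
        (LineBundle.zero_idemFun (s.val x))).mpr isUnit_one) rfl)
    | insert C S hC ih =>
      obtain ⟨h, hS⟩ := ih
      have hef : e C * ∑ C ∈ S, e C = 0 := by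
        rw [Finset.mul_sum]
        refine Finset.sum_eq_zero fun D hD => ?_
        refine (map_mul _ _ _).symm.trans ((congrArg _ (Comp.idem_mul hW ?_)).trans (map_zero _))
        rintro rfl
        exact hC hD
      have h' : (e C + ∑ C ∈ S, e C) * (e C + ∑ C ∈ S, e C) = e C + ∑ C ∈ S, e C := by
        linear_combination he C + h + 2 * hef
      rw [Finset.sum_insert hC, Finset.sum_insert hC]
      refine ⟨h', ?_⟩
      obtain ⟨g, hg⟩ := exists_X_tensor_sub_mem_relIdeal hT (Pic.of (L.idem (e C) (he C)))
        (Pic.of (L.idem _ h))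
      have h1 : (Pic.of (L.idem (e C) (he C))).tensor (Pic.of (L.idem _ h)) =
          Pic.of (L.idem _ h') := Quotient.sound (L.idem_tensor (he C) h hef h')
      rw [h1] at hg
      exact MvPolynomial.sub_add_mem hg (hprod C _ h hef) hS
  have hone : ∑ C, e C = 1 := (map_sum _ _ _).symm.trans
    ((congrArg _ (Comp.sum_idem hW)).trans (map_one _))
  obtain ⟨h1, h2⟩ := hsum Finset.univ
  -- All idempotents together sum to `1`, which gives back `L` itself.
  have h3 : Pic.of (L.idem _ h1) = Pic.of L := by
    have h3 (f : Γ(T.sch, ⊤)) (hf : f * f = f) (hf' : f = 1) : Pic.of (L.idem f hf) = Pic.of L := by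
      subst hf'
      exact Quotient.sound L.idem_one
    exact h3 _ h1 hone
  rw [h3] at h2
  have h4 := congrArg (OB1Cov.push p hp)
    (MvPolynomial.map_mul_eq_sum h2 (MvPolynomial.rename (Pic.pull (mor p)) q))
  rw [map_sum] at h4
  have h5 {V : QProj k} (l : V ⟶ T) (l' : V ⟶ W) (hl : l ≫ p = l') :
      MvPolynomial.rename (R := Lazard) (Pic.pull (mor l))
        (MvPolynomial.rename (Pic.pull (mor p)) q) =
      MvPolynomial.rename (Pic.pull (mor l')) q := by
    subst hl
    rw [MvPolynomial.rename_rename]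
    exact congrArg (fun f => MvPolynomial.rename f q) (funext fun P => (Pic.pull_comp _ _ P).symm)
  have h6 : MvPolynomial.rename (R := Lazard) (Pic.pull (mor (𝟙 W))) q = q := by
    have e : Pic.pull (mor (𝟙 W)) = id := funext Pic.pull_id
    rw [e, MvPolynomial.rename_id]
    rfl
  have h7 {V : QProj k} (l : V ⟶ T) (l' : V ⟶ W) (hl : l ≫ p = l') (hl₁ : IsProper (mor l))
      (hl₂ : IsProper (mor l')) (x : OB1Cov V) :
      OB1Cov.push p hp (OB1Cov.push l hl₁ x) = OB1Cov.push l' hl₂ x := by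
    subst hl
    exact (OB1Cov.push_comp _ _ _ _ _ x).symm
  -- As `i` is a section of `p`, the polynomial `q` is the restriction of its own pullback to `T`,
  -- and `p_* i_*` is the identity; so the class on `W` is the pushforward of `c₁(L)` times that
  -- pullback.
  have hL : chernPoly hW q = OB1Cov.push p hp (chernPoly hT (MvPolynomial.X (Pic.of L) *
      MvPolynomial.rename (Pic.pull (mor p)) q)) := by
    rw [chernPoly_X_mul hT hs hi hi' hW (P := Pic.of L) rfl, h5 i (𝟙 W) hip, h6,
      h7 i (𝟙 W) hip hi' (isProper_id W), OB1Cov.push_id]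
  refine hL.trans (h4.trans (Finset.sum_congr rfl fun C _ => ?_))
  have hjp : j C ≫ p = clopenSub.ι W C.1 C.2.1 := by
    rw [Category.assoc, hip, Category.comp_id]
  rw [chernPoly_X_mul hT (hs.idem _ _) (hjC C) (hj C) (C.smooth hW)
    (P := Pic.of (L.idem (e C) (he C))) rfl, h5 (j C) _ hjp,
    h7 (j C) _ hjp (hj C) (clopenSub.isProper_ι _ _ _)]

/-- Additivity of fundamental classes. -/
theorem chernPoly_eq_sum (hW : Smooth W.str) [Fintype (Comp W.sch)]
    (q : MvPolynomial (Pic W.sch) Lazard) :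
    chernPoly hW q = ∑ C : Comp W.sch, OB1Cov.push (clopenSub.ι W C.1 C.2.1)
      (clopenSub.isProper_ι _ _ _) (chernPoly (C.smooth hW)
        (MvPolynomial.rename (Pic.pull (mor (clopenSub.ι W C.1 C.2.1))) q)) := by
  -- The auxiliary scheme is `T = W × ℙ¹`: proper over `W`, smooth over `ℙ¹`, with the section `i =
  -- (id, 0)`.
  have sq := fibreProd.isPullback (toPt W) (toPt (projLine k))
  have hW' : Smooth (mor (toPt W)) := hW
  have hsnd : Smooth (mor (fibreProd.snd (toPt W) (toPt (projLine k)))) :=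
    MorphismProperty.of_isPullback (P := @Smooth) sq hW'
  have hfst := isProper_of_isPullback sq.flip (isProper_projLine k)
  have ho : projLine.origin k ≫ toPt (projLine k) = 𝟙 (pt k) := by
    rw [toPt_comp]
    rfl
  have w : 𝟙 W.sch ≫ mor (toPt W) = mor (toPt W ≫ projLine.origin k) ≫ mor (toPt (projLine k)) := by
    have h : mor (projLine.origin k) ≫ mor (toPt (projLine k)) = 𝟙 _ := congrArg mor ho
    change _ = (mor (toPt W) ≫ mor (projLine.origin k)) ≫ mor (toPt (projLine k))
    rw [Category.assoc, h, Category.id_comp, Category.comp_id]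
  let i : W ⟶ fibreProd (toPt W) (toPt (projLine k)) := homMk (sq.lift _ _ w)
    ((Category.assoc _ _ _).symm.trans ((congrArg (· ≫ W.str) (sq.lift_fst _ _ w)).trans
      (Category.id_comp _)))
  have h1 : i ≫ fibreProd.fst _ _ = 𝟙 W := QProj.hom_ext (sq.lift_fst _ _ w)
  have h2 : mor i ≫ mor (fibreProd.snd (toPt W) (toPt (projLine k))) =
    mor (toPt W) ≫ mor (projLine.origin k) := sq.lift_snd _ _ w
  -- The section `i` is the base change of the origin: pasting with the square of `W × ℙ¹` gives a
  -- square with identities on two sides. So it is the zero scheme of the pullback of `X₁`.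
  have sq' : IsPullback (mor i) (mor (toPt W))
      (mor (fibreProd.snd (toPt W) (toPt (projLine k)))) (mor (projLine.origin k)) := by
    refine IsPullback.of_right ?_ h2 sq
    have e1 : mor i ≫ mor (fibreProd.fst (toPt W) (toPt (projLine k))) = 𝟙 _ := congrArg mor h1
    have e2 : mor (projLine.origin k) ≫ mor (toPt (projLine k)) = 𝟙 _ := congrArg mor ho
    rw [e1, e2]
    exact IsPullback.id_horiz _
  let L : LineBundle (projLine k).sch := ProjLine.twist k
  let s : L.Sec := ProjLine.sec 1
  have hs : s.IsRegular := ProjLine.isRegular_sec 1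
  have hz : s.IsZeroScheme (mor (projLine.origin k)) := ProjLine.isZeroScheme_zero
  exact chernPoly_eq_sum_of_isZeroScheme hW (smooth_str_of_smooth hsnd (smooth_projLine k)) _ hfst i
    h1 (hs.pull (mor (fibreProd.snd (toPt W) (toPt (projLine k))))) (hz.pull _ sq') q

end Additivity
end Bordism

namespace Bordism

open QProj

theorem MvPolynomial.rename_prod_X {σ τ R : Type*} [CommSemiring R] (f : σ → τ) (l : List σ) :
    MvPolynomial.rename f (l.map (MvPolynomial.X (R := R))).prod =
      ((l.map f).map MvPolynomial.X).prod := by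
  rw [map_list_prod, List.map_map, List.map_map]
  exact congrArg List.prod (List.map_congr_left fun a _ => MvPolynomial.rename_X f a)

/-! ### The two comparison maps on cycles, and how operations transfer along them. -/

section Comparison

variable {k : Type u} [Field k] {X Y Z : QProj k}

theorem OB1.mk_ofCyc (c : Cycle X) (hc : Smooth c.src.str) (l : List (Pic c.src.sch))
    (hl : (l : Multiset (Pic c.src.sch)) = c.bundles) : OB1.mk _ (OB.ofCyc c hc) =
      OB1Cov.push c.map c.isProper (chernPoly hc (l.map MvPolynomial.X).prod) := by
  rw [chernPoly_prod, hl]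
  exact congrArg (OB1.mk (toPt X)) (OB.push_ofCyc_self c hc).symm

theorem ZCyc.hom_ext {A : Type*} [AddCommGroup A] {φ ψ : ZCyc X →+ A}
    (h : ∀ c, φ (of c) = ψ (of c)) : φ = ψ :=
  FreeAbelianGroup.lift_ext _ _ fun q => by
    induction q using Quotient.inductionOn with
    | _ c => exact h c

/-- The map sending a cycle with smooth source to the sum of its restrictions to the components. -/
def OB.toZ (X : QProj k) : OB (toPt X) →+ ZCyc X :=
  OB.lift (fun c => ZCyc.ofSmooth c.1 ((smooth_toPt_iff c.1).1 c.2))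
    fun _ _ h => ZCyc.ofSmooth_congr h _ _

theorem OB.toZ_ofCyc (c : Cycle X) (hc : Smooth c.src.str) :
    OB.toZ X (OB.ofCyc c hc) = ZCyc.ofSmooth c hc := OB.lift_of _ _ _

/-- The inclusion of the cycles with integral source. -/
def ZCyc.toOB (X : QProj k) : ZCyc X →+ OB (toPt X) :=
  FreeAbelianGroup.lift (Quotient.lift (fun c : CobCycle X => OB.ofCyc c.1 c.2.1)
    fun _ _ h => OB.ofCyc_congr h _ _)

theorem ZCyc.toOB_of (c : CobCycle X) : ZCyc.toOB X (ZCyc.of c) = OB.ofCyc c.1 c.2.1 :=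
  FreeAbelianGroup.lift_apply_of _ _

/-- An integral source is connected, so it is its own only component. -/
theorem ZCyc.ofSmooth_eq_of (c : CobCycle X) : ZCyc.ofSmooth c.1 c.2.1 = ZCyc.of c := by
  have := c.2.2
  have hne : Nonempty (⊤ : c.1.src.sch.Opens).toScheme :=
    (inferInstance : Nonempty c.1.src.sch).map fun x => ⟨x, trivial⟩
  have hI : IsIntegral (⊤ : c.1.src.sch.Opens).toScheme :=
    isIntegral_of_isOpenImmersion (⊤ : c.1.src.sch.Opens).ι
  let C : Comp c.1.src.sch := ⟨⊤, isClosed_univ, hI⟩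
  have hC (D : Comp c.1.src.sch) : D = C := by
    have hcl : IsClopen (D.1 : Set c.1.src.sch) := ⟨D.2.1, D.1.isOpen⟩
    exact Subtype.ext (Opens.ext (hcl.eq_univ D.nonempty))
  let _ : Unique (Comp c.1.src.sch) := ⟨⟨C⟩, hC⟩
  rw [ofSmooth, finsum_unique]
  let e : clopenSub c.1.src C.1 C.2.1 ≅ c.1.src := QProj.isoMk c.1.src.sch.topIso rfl
  have he : e.hom = clopenSub.ι c.1.src C.1 C.2.1 := QProj.hom_ext rfl
  exact ZCyc.of_congr (c := ⟨c.1.comp C, C.smooth c.2.1, C.2.2⟩)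
    ⟨e, congrArg (· ≫ c.1.map) he, congrArg (fun f => c.1.bundles.map (Pic.pull (mor f))) he⟩

theorem OB.toZ_toOB (x : ZCyc X) : OB.toZ X (ZCyc.toOB X x) = x :=
  DFunLike.congr_fun (f := (OB.toZ X).comp (ZCyc.toOB X)) (g := AddMonoidHom.id _)
    (ZCyc.hom_ext fun c => by
      change OB.toZ X (ZCyc.toOB X (ZCyc.of c)) = ZCyc.of c
      rw [ZCyc.toOB_of, OB.toZ_ofCyc, ZCyc.ofSmooth_eq_of]) x

/-- Cutting a source into components loses information in `OB` but none in `OB1`: this is additivity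
on the source, pushed forward to `X`. It makes the two comparison maps inverse to each other. -/
theorem OB1.mk_toOB_toZ (x : OB (toPt X)) :
    OB1.mk (toPt X) (ZCyc.toOB X (OB.toZ X x)) = OB1.mk (toPt X) x :=
  DFunLike.congr_fun (f := ((OB1.mk (toPt X)).comp ((ZCyc.toOB X).comp (OB.toZ X))))
    (g := OB1.mk (toPt X)) (OB.hom_ext_toPt fun c hc => by
      have hfin : Fintype (Comp c.src.sch) := @Fintype.ofFinite _ (Comp.finite c.src)
      obtain ⟨l, hl⟩ := Quotient.exists_rep c.bundles
      change OB1.mk (toPt X) (ZCyc.toOB X (OB.toZ X (OB.ofCyc c hc))) = _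
      rw [OB.toZ_ofCyc, ZCyc.ofSmooth_def, map_sum, map_sum, OB1.mk_ofCyc c hc l hl,
        chernPoly_eq_sum, map_sum]
      refine Finset.sum_congr rfl fun C _ => ?_
      rw [ZCyc.toOB_of, MvPolynomial.rename_prod_X, ← OB1Cov.push_comp]
      exact OB1.mk_ofCyc (c.comp C) _ (l.map (Pic.pull (mor (clopenSub.ι c.src C.1 C.2.1))))
        ((Multiset.map_coe _ _).symm.trans (congrArg (Multiset.map _) hl))) x

theorem ZCyc.toOB_push (f : X ⟶ Y) (hf : IsProper (mor f)) (x : ZCyc X) :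
    ZCyc.toOB Y (ZCyc.push f hf x) = OB.push f hf (toPt_comp f) (ZCyc.toOB X x) :=
  DFunLike.congr_fun (f := (ZCyc.toOB Y).comp (ZCyc.push f hf))
    (g := (OB.push f hf (toPt_comp f)).comp (ZCyc.toOB X)) (ZCyc.hom_ext fun c => by
      exact (ZCyc.toOB_of ⟨c.1.push f hf, c.2⟩).trans
        (congrArg (OB.push f hf (toPt_comp f)) (ZCyc.toOB_of c)).symm) x

theorem ZCyc.toOB_chern (L : Pic X.sch) (x : ZCyc X) :
    ZCyc.toOB X (ZCyc.chern L x) = OB.chern (toPt X) L (ZCyc.toOB X x) :=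
  DFunLike.congr_fun (f := (ZCyc.toOB X).comp (ZCyc.chern L))
    (g := (OB.chern (toPt X) L).comp (ZCyc.toOB X)) (ZCyc.hom_ext fun c => by
      exact (ZCyc.toOB_of ⟨c.1.chern L, c.2⟩).trans
        (congrArg (OB.chern (toPt X) L) (ZCyc.toOB_of c)).symm) x

theorem ZCyc.push_ofSmooth (f : X ⟶ Y) (hf : IsProper (mor f)) (c : Cycle X)
    (hc : Smooth c.src.str) :
    ZCyc.push f hf (ofSmooth c hc) = ofSmooth (c.push f hf) hc := by
  have hfin : Fintype (Comp c.src.sch) := @Fintype.ofFinite _ (Comp.finite c.src)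
  rw [ofSmooth_def c hc, map_sum]
  refine Eq.trans (Finset.sum_congr rfl fun C _ => ?_) (@ofSmooth_def _ _ _ (c.push f hf) hc hfin).symm
  exact of_congr (c := ⟨(c.comp C).push f hf, (c.cobComp hc C).2⟩)
    (d := (c.push f hf).cobComp hc C) ⟨CategoryTheory.Iso.refl _,
      (Category.id_comp _).trans (Category.assoc _ _ _).symm, Cycle.pull_id_bundles _ _⟩

theorem ZCyc.chern_ofSmooth (L : Pic X.sch) (c : Cycle X) (hc : Smooth c.src.str) :
    ZCyc.chern L (ofSmooth c hc) = ofSmooth (c.chern L) hc := by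
  have hfin : Fintype (Comp c.src.sch) := @Fintype.ofFinite _ (Comp.finite c.src)
  rw [ofSmooth_def c hc, map_sum]
  refine Eq.trans (Finset.sum_congr rfl fun C _ => ?_) (@ofSmooth_def _ _ _ (c.chern L) hc hfin).symm
  refine of_congr (c := ⟨(c.comp C).chern L, (c.cobComp hc C).2⟩)
    (d := (c.chern L).cobComp hc C) (Cycle.iso_of_eq (congrArg (Cycle.mk _ _ _) ?_))
  refine Eq.trans ?_ (Multiset.map_cons (Pic.pull (mor (clopenSub.ι c.src C.1 C.2.1))) _ _).symm
  exact congrArg (· ::ₘ (c.comp C).bundles) (Pic.pull_comp _ _ L)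

theorem OB.toZ_push (f : X ⟶ Y) (hf : IsProper (mor f)) (x : OB (toPt X)) :
    OB.toZ Y (OB.push f hf (toPt_comp f) x) = ZCyc.push f hf (OB.toZ X x) :=
  DFunLike.congr_fun (f := (OB.toZ Y).comp (OB.push f hf (toPt_comp f)))
    (g := (ZCyc.push f hf).comp (OB.toZ X)) (OB.hom_ext_toPt fun c hc =>
      (OB.toZ_ofCyc (c.push f hf) hc).trans ((ZCyc.push_ofSmooth f hf c hc).symm.trans
        (congrArg (ZCyc.push f hf) (OB.toZ_ofCyc c hc)).symm)) x

theorem OB.toZ_chern (L : Pic X.sch) (x : OB (toPt X)) :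
    OB.toZ X (OB.chern (toPt X) L x) = ZCyc.chern L (OB.toZ X x) :=
  DFunLike.congr_fun (f := (OB.toZ X).comp (OB.chern (toPt X) L))
    (g := (ZCyc.chern L).comp (OB.toZ X)) (OB.hom_ext_toPt fun c hc =>
      (OB.toZ_ofCyc (c.chern L) hc).trans ((ZCyc.chern_ofSmooth L c hc).symm.trans
        (congrArg (ZCyc.chern L) (OB.toZ_ofCyc c hc)).symm)) x

theorem ZCyc.cherns_cons (L : Pic X.sch) (Ls : List (Pic X.sch)) (x : ZCyc X) :
    ZCyc.cherns (L :: Ls) x = ZCyc.chern L (ZCyc.cherns Ls x) := rfl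

theorem OB.toZ_cherns (Ls : List (Pic X.sch)) (x : OB (toPt X)) :
    OB.toZ X (OB.cherns (toPt X) Ls x) = ZCyc.cherns Ls (OB.toZ X x) := by
  induction Ls with
  | nil => rfl
  | cons L Ls ih => rw [OB.cherns_cons, ZCyc.cherns_cons, OB.toZ_chern, ih]

theorem ZCyc.toOB_cherns (Ls : List (Pic X.sch)) (x : ZCyc X) :
    ZCyc.toOB X (ZCyc.cherns Ls x) = OB.cherns (toPt X) Ls (ZCyc.toOB X x) := by
  induction Ls with
  | nil => rfl
  | cons L Ls ih => rw [OB.cherns_cons, ZCyc.cherns_cons, ZCyc.toOB_chern, ih]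

theorem ZCyc.chern_iterate (L : Pic X.sch) (n : ℕ) (x : ZCyc X) :
    (ZCyc.chern L)^[n] x = ZCyc.cherns (List.replicate n L) x := by
  induction n with
  | zero => rfl
  | succ n ih => rw [Function.iterate_succ_apply', ih, List.replicate_succ, ZCyc.cherns_cons]

theorem ZCyc.pull_toZ (g : Y ⟶ X) (hg : IsSmoothEquidim g) (x : OB (toPt X)) :
    ZCyc.pull g hg (OB.toZ X x) = OB.toZ Y (OB.spull g hg.smooth x) :=
  DFunLike.congr_fun (f := (ZCyc.pull g hg).comp (OB.toZ X))
    (g := (OB.toZ Y).comp (OB.spull g hg.smooth)) (OB.hom_ext_toPt fun c hc => by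
      change ZCyc.pull g hg (OB.toZ X (OB.ofCyc c hc)) =
        OB.toZ Y (OB.spull g hg.smooth (OB.ofCyc c hc))
      rw [OB.toZ_ofCyc, OB.spull_of, OB.toZ_ofCyc]
      exact ZCyc.pull_ofSmooth g hg c hc) x

/-- Pullback on `ZCyc` is uncut base change followed by cutting. The base change formula and
functoriality thus need no bookkeeping of components. -/
theorem ZCyc.pull_eq (g : Y ⟶ X) (hg : IsSmoothEquidim g) (x : ZCyc X) :
    ZCyc.pull g hg x = OB.toZ Y (OB.spull g hg.smooth (ZCyc.toOB X x)) := by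
  rw [← ZCyc.pull_toZ, OB.toZ_toOB]

theorem ZCyc.pull_id (x : ZCyc X) : ZCyc.pull (𝟙 X) (IsSmoothEquidim.id X) x = x := by
  rw [ZCyc.pull_eq, OB.spull_id, OB.toZ_toOB]

theorem ZCyc.pull_cherns (g : Y ⟶ X) (hg : IsSmoothEquidim g) (Ls : List (Pic X.sch))
    (x : ZCyc X) : ZCyc.pull g hg (ZCyc.cherns Ls x) =
      ZCyc.cherns (Ls.map (Pic.pull (mor g))) (ZCyc.pull g hg x) := by
  rw [ZCyc.pull_eq, ZCyc.pull_eq, ZCyc.toOB_cherns, OB.spull_cherns, OB.toZ_cherns]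

theorem ZCyc.cherns_push (f : X ⟶ Y) (hf : IsProper (mor f)) (Ls : List (Pic Y.sch))
    (x : ZCyc X) : ZCyc.cherns Ls (ZCyc.push f hf x) =
      ZCyc.push f hf (ZCyc.cherns (Ls.map (Pic.pull (mor f))) x) := by
  obtain ⟨x, rfl⟩ : ∃ y, OB.toZ X y = x := ⟨_, OB.toZ_toOB x⟩
  rw [← OB.toZ_push, ← OB.toZ_cherns, OB.cherns_push, OB.toZ_push, OB.toZ_cherns]

theorem ZCyc.pull_push {P : QProj k} {p : P ⟶ X} {q : P ⟶ Z} {f : X ⟶ Y} {t : Z ⟶ Y}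
    (sq : IsPullback (mor p) (mor q) (mor f) (mor t)) (hf : IsProper (mor f))
    (hq : IsProper (mor q)) (hp : IsSmoothEquidim p) (ht : IsSmoothEquidim t) (x : ZCyc X) :
    ZCyc.pull t ht (ZCyc.push f hf x) = ZCyc.push q hq (ZCyc.pull p hp x) := by
  rw [ZCyc.pull_eq, ZCyc.pull_eq, ZCyc.toOB_push, OB.spull_push sq hf hq hp.smooth ht.smooth,
    OB.toZ_push]

theorem ZCyc.pull_pull (g : Y ⟶ X) (hg : IsSmoothEquidim g) (h : Z ⟶ Y) (hh : IsSmoothEquidim h)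
    (x : ZCyc X) : ZCyc.pull h hh (ZCyc.pull g hg x) = ZCyc.pull (h ≫ g) (hh.comp hg) x := by
  obtain ⟨x, rfl⟩ : ∃ y, OB.toZ X y = x := ⟨_, OB.toZ_toOB x⟩
  rw [ZCyc.pull_toZ, ZCyc.pull_toZ, ZCyc.pull_toZ, OB.spull_spull _ _ _ _ (hh.comp hg).smooth]

theorem ZCyc.cherns_append (Ls Ms : List (Pic X.sch)) (x : ZCyc X) :
    ZCyc.cherns (Ls ++ Ms) x = ZCyc.cherns Ls (ZCyc.cherns Ms x) := by
  induction Ls with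
  | nil => rfl
  | cons L Ls ih => rw [List.cons_append, ZCyc.cherns_cons, ZCyc.cherns_cons, ih]

theorem ZCyc.cherns_mem_imposed {R : Rel k} {x : ZCyc X} (hx : x ∈ imposed R X)
    (Ls : List (Pic X.sch)) : cherns Ls x ∈ imposed R X := by
  refine (show imposed R X ≤ (imposed R X).comap (cherns Ls) from
    (AddSubgroup.closure_le _).2 ?_) hx
  rintro _ ⟨U, W, f, hf, Ms, g, hg, ρ, hρ, rfl⟩
  refine AddSubgroup.subset_closure ⟨U, W, f, hf, Ls.map (Pic.pull (mor f)) ++ Ms, g, hg, ρ, hρ, ?_⟩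
  rw [ZCyc.cherns_push, ZCyc.cherns_append]

/-- By base change along `f`, the pullback of an imposed element is imposed on the fibre product,
with the composite smooth morphism in place of `g`. -/
theorem ZCyc.pull_mem_imposed {R : Rel k} {x : ZCyc X} (hx : x ∈ imposed R X) (t : Y ⟶ X)
    (ht : IsSmoothEquidim t) : pull t ht x ∈ imposed R Y := by
  refine (show imposed R X ≤ (imposed R Y).comap (pull t ht) from
    (AddSubgroup.closure_le _).2 ?_) hx
  rintro _ ⟨U, W, f, hf, Ms, g, hg, ρ, hρ, rfl⟩
  have sq := fibreProd.isPullback f t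
  have hp : IsSmoothEquidim (fibreProd.fst f t) := ht.of_isPullback sq
  refine AddSubgroup.subset_closure ⟨fibreProd f t, W, fibreProd.snd f t,
    isProper_of_isPullback sq hf, Ms.map (Pic.pull (mor (fibreProd.fst f t))),
    fibreProd.fst f t ≫ g, hp.comp hg, ρ, hρ, ?_⟩
  rw [ZCyc.pull_push sq hf (isProper_of_isPullback sq hf) hp ht, ZCyc.pull_cherns,
    ZCyc.pull_pull g hg _ hp]

theorem ZCyc.push_mem_imposed {R : Rel k} {x : ZCyc X} (hx : x ∈ imposed R X) (f : X ⟶ Y)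
    (hf : IsProper (mor f)) : push f hf x ∈ imposed R Y := ZCyc.imposed_le R f hf hx

theorem ZCyc.map_mem_preRel {x : ZCyc X} {φ : ZCyc X →+ ZCyc Y}
    (h : ∀ (R : Rel k) (x : ZCyc X), x ∈ imposed R X → φ x ∈ imposed R Y) (hx : x ∈ preRel X) :
    φ x ∈ preRel Y :=
  (sup_le (fun y hy => AddSubgroup.mem_sup_left (h _ y hy))
    (fun y hy => AddSubgroup.mem_sup_right (h _ y hy)) :
      preRel X ≤ (preRel Y).comap φ) hx

end Comparison
end Bordism

namespace Bordism

open QProj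

/-! ### Extending maps to the quotients, and transporting dimension and section relations. -/

section Lift

variable {A A' B : Type*} [AddCommGroup A] [AddCommGroup A'] [AddCommGroup B] [Module Lazard B]
  (N : AddSubgroup A) (φ : A →+ B) (hφ : ∀ x ∈ N, φ x = 0)

/-- The `𝕃`-linear extension of an additive map that vanishes on a subgroup. -/
def tensorLift : Lazard ⊗[ℤ] (A ⧸ N) →ₗ[Lazard] B :=
  LinearMap.liftBaseChange Lazard (QuotientAddGroup.lift N φ hφ).toIntLinearMap

theorem tensorLift_one_tmul (x : A) :
    tensorLift N φ hφ (1 ⊗ₜ[ℤ] (QuotientAddGroup.mk' N x)) = φ x :=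
  (LinearMap.liftBaseChange_tmul _ _ _ _).trans (one_smul _ _)

theorem tensorLift_fglDefect (χ : A' →+ A) (c₁ c₂ c₁₂ : A' →+ A') (n : ℕ) (α : A') :
    tensorLift N φ hφ (LinearMap.baseChange Lazard
      ((QuotientAddGroup.mk' N).comp χ).toIntLinearMap (fglDefect c₁ c₂ c₁₂ n α)) =
      (∑ m ∈ Finset.range n, ∑ p ∈ Finset.HasAntidiagonal.antidiagonal m,
        lazardCoeff p.1 p.2 • φ (χ (c₁^[p.1] (c₂^[p.2] α)))) - φ (χ (c₁₂ α)) := by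
  have h (x : A') : (tensorLift N φ hφ ∘ₗ LinearMap.baseChange Lazard
      ((QuotientAddGroup.mk' N).comp χ).toIntLinearMap) (1 ⊗ₜ x) = φ (χ x) :=
    tensorLift_one_tmul N φ hφ (χ x)
  rw [← LinearMap.comp_apply, map_fglDefect]
  simp only [h]

end Lift

section Comparison

variable {k : Type u} [Field k] {X Y Z : QProj k}

/-- The projection to algebraic bordism. -/
def Omega.mk (X : QProj k) : ZCyc X →+ Omega X where
  toFun x := (ZCyc.imposedFGL X).mkQ (1 ⊗ₜ[ℤ] (QuotientAddGroup.mk' (ZCyc.preRel X) x))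
  map_zero' := by rw [map_zero, TensorProduct.tmul_zero, map_zero]
  map_add' x y := by rw [map_add, TensorProduct.tmul_add, map_add]

theorem Omega.mk_eq_zero {x : ZCyc X} (hx : x ∈ ZCyc.preRel X) : Omega.mk X x = 0 := by
  have h : QuotientAddGroup.mk' (ZCyc.preRel X) x = 0 := (QuotientAddGroup.eq_zero_iff x).2 hx
  change (ZCyc.imposedFGL X).mkQ (1 ⊗ₜ[ℤ] (QuotientAddGroup.mk' (ZCyc.preRel X) x)) = 0
  rw [h, TensorProduct.tmul_zero, map_zero]

theorem Omega.push_mk (f : X ⟶ Y) (hf : IsProper (mor f)) (x : ZCyc X) :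
    Omega.push f hf (Omega.mk X x) = Omega.mk Y (ZCyc.push f hf x) := rfl

theorem Omega.hom_ext {B : Type*} [AddCommGroup B] [Module Lazard B]
    {F G : Omega X →ₗ[Lazard] B} (h : ∀ x, F (Omega.mk X x) = G (Omega.mk X x)) : F = G := by
  refine Submodule.linearMap_qext _ (TensorProduct.AlgebraTensorModule.curry_injective
    (LinearMap.ext_ring (LinearMap.ext fun x => ?_)))
  induction x using QuotientAddGroup.induction_on with
  | H x => exact h x

/-- The formal group law relations in algebraic bordism. -/
theorem Omega.fgl (hY : Smooth Y.str) (f : Y ⟶ X) (hf : IsProper (mor f)) (L₁ L₂ : Pic Y.sch)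
    (α : ZCyc Y) (N : ℕ) (hN : ∀ i j, N ≤ i + j →
      (ZCyc.chern L₁)^[i] ((ZCyc.chern L₂)^[j] α) ∈ ZCyc.preRel Y) (Ls : List (Pic Y.sch)) :
    ∑ n ∈ Finset.range N, ∑ p ∈ Finset.HasAntidiagonal.antidiagonal n, lazardCoeff p.1 p.2 •
      Omega.mk X (ZCyc.push f hf (ZCyc.cherns Ls
        ((ZCyc.chern L₁)^[p.1] ((ZCyc.chern L₂)^[p.2] α)))) =
      Omega.mk X (ZCyc.push f hf (ZCyc.cherns Ls (ZCyc.chern (L₁.tensor L₂) α))) := by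
  have h : LinearMap.baseChange Lazard
        (((QuotientAddGroup.mk' (ZCyc.preRel X)).comp ((ZCyc.push f hf).comp
        ((ZCyc.cherns Ls).comp (ZCyc.pull (𝟙 Y) (IsSmoothEquidim.id Y))))).toIntLinearMap)
      (fglDefect (ZCyc.chern L₁) (ZCyc.chern L₂) (ZCyc.chern (L₁.tensor L₂)) N α) ∈
        ZCyc.imposedFGL X :=
    Submodule.subset_span ⟨Y, Y, f, hf, Ls, 𝟙 Y, IsSmoothEquidim.id Y, _, ⟨hY, L₁, L₂, α, N, hN, rfl⟩,
      rfl⟩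
  have h1 := (Submodule.Quotient.mk_eq_zero (ZCyc.imposedFGL X)).2 h
  rw [← Submodule.mkQ_apply, ← LinearMap.comp_apply, map_fglDefect, sub_eq_zero] at h1
  have h3 (x : ZCyc Y) : Omega.mk X (ZCyc.push f hf (ZCyc.cherns Ls x)) =
      ((ZCyc.imposedFGL X).mkQ ∘ₗ LinearMap.baseChange Lazard
        (((QuotientAddGroup.mk' (ZCyc.preRel X)).comp ((ZCyc.push f hf).comp
        ((ZCyc.cherns Ls).comp (ZCyc.pull (𝟙 Y) (IsSmoothEquidim.id Y))))).toIntLinearMap))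
          (1 ⊗ₜ x) :=
    congrArg (fun y => Omega.mk X (ZCyc.push f hf (ZCyc.cherns Ls y))) (ZCyc.pull_id x).symm
  simp only [h3]
  exact h1

/-! ### From bivariant cycles to algebraic bordism -/

theorem OB.pull_mem_imposed {R : BivRel k} {X' Y' : QProj k} {f : X ⟶ Y} {f' : X' ⟶ Y'}
    {t : X' ⟶ X} {g : Y' ⟶ Y} (sq : IsPullback (mor t) (mor f') (mor f) (mor g))
    (hg : IsSmoothEquidim g) {x : OB f} (hx : x ∈ imposed R f) : pull sq x ∈ imposed R f' := by
  refine (show imposed R f ≤ (imposed R f').comap (pull sq) from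
    (AddSubgroup.closure_le _).2 ?_) hx
  rintro _ ⟨U, A', A, f₁, hf₁, q, w, t₁, z₁, g₁, sq₁, hg₁, Ls, ρ, hρ, rfl⟩
  have sq₂ := fibreProd.isPullback f₁ t
  have w' : mor f₁ ≫ mor f = mor q := congrArg mor w
  have sq₃ : IsPullback (mor (fibreProd.fst f₁ t)) (mor (fibreProd.snd f₁ t ≫ f')) (mor q)
      (mor g) := w' ▸ sq₂.paste_vert sq
  have sq₄ : IsPullback (mor (fibreProd.fst f₁ t ≫ t₁)) (mor (fibreProd.snd f₁ t ≫ f')) (mor z₁)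
      (mor (g ≫ g₁)) := sq₃.paste_horiz sq₁
  refine AddSubgroup.subset_closure ⟨fibreProd f₁ t, A', A, fibreProd.snd f₁ t,
    isProper_of_isPullback sq₂ hf₁, _, rfl, fibreProd.fst f₁ t ≫ t₁, z₁, g ≫ g₁, sq₄,
    hg.comp hg₁, Ls.map (Pic.pull (mor (fibreProd.fst f₁ t))), ρ, hρ, ?_⟩
  rw [pull_push sq sq₂ hf₁ (isProper_of_isPullback sq₂ hf₁) w rfl sq₃, pull_cherns,
    pull_pull sq₁ sq₃ sq₄]

theorem OB.pull_mem_preRel {X' Y' : QProj k} {f : X ⟶ Y} {f' : X' ⟶ Y'}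
    {t : X' ⟶ X} {g : Y' ⟶ Y} (sq : IsPullback (mor t) (mor f') (mor f) (mor g))
    (hg : IsSmoothEquidim g) {x : OB f} (hx : x ∈ preRel f) : pull sq x ∈ preRel f' :=
  (sup_le (fun _ hy => AddSubgroup.mem_sup_left (pull_mem_imposed sq hg hy))
    (fun _ hy => AddSubgroup.mem_sup_right (pull_mem_imposed sq hg hy)) :
      preRel f ≤ (preRel f').comap (pull sq)) hx

/-- A bivariant pullback along `g` base changes the cycle along `t`, which is what the pullback of
bordism along `t` does. -/
theorem OB.toZ_pull_of {X' : QProj k} {f : X ⟶ Y} {t : X' ⟶ X} {g : pt k ⟶ Y}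
    (sq : IsPullback (mor t) (mor (toPt X')) (mor f) (mor g)) (ht : IsSmoothEquidim t)
    (c : Cycle X) (hc : Smooth c.src.str) (hc' : Smooth (mor (c.map ≫ f))) :
    toZ X' (pull sq (of ⟨c, hc'⟩)) = ZCyc.pull t ht (ZCyc.ofSmooth c hc) :=
  (lift_of _ _ _).trans (ZCyc.pull_ofSmooth t ht c hc).symm

theorem Comp.topologicalKrullDim_le (C : Comp X.sch) :
    topologicalKrullDim (clopenSub X C.1 C.2.1).sch ≤ topologicalKrullDim X.sch := by
  have := clopenSub.isClosedImmersion_ι X C.1 C.2.1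
  exact (mor (clopenSub.ι X C.1 C.2.1)).isClosedEmbedding.isInducing.topologicalKrullDim_le

theorem ZCyc.ofSmooth_mem_relDim (hX : Smooth X.str) (c : Cycle X) (hc : Smooth c.src.str)
    (h : topologicalKrullDim c.src.sch < (Multiset.card c.bundles : WithBot ℕ∞)) :
    ofSmooth c hc ∈ AddSubgroup.closure (relDim X) := by
  have hfin : Fintype (Comp c.src.sch) := @Fintype.ofFinite _ (Comp.finite c.src)
  rw [ofSmooth_def]
  refine AddSubgroup.sum_mem _ fun C _ => AddSubgroup.subset_closure ⟨hX, c.cobComp hc C, ?_, rfl⟩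
  refine (C.topologicalKrullDim_le.trans_lt h).trans_eq ?_
  exact congrArg _ (Multiset.card_map _ _).symm

theorem sub_mem_of_eq_sum {ι A : Type*} [Fintype ι] [AddCommGroup A] {S : AddSubgroup A} {x y : A}
    {a b : ι → A} (hx : x = ∑ i, a i) (hy : y = ∑ i, b i) (h : ∀ i, a i - b i ∈ S) :
    x - y ∈ S := by
  rw [hx, hy, ← Finset.sum_sub_distrib]
  exact S.sum_mem fun i _ => h i

/-- A section relation on a disconnected source is the sum of those on its components. The part of
`Z` in a component need not be connected, but the relation allows for that. -/
theorem ZCyc.ofSmooth_sub_mem_relSect (c : Cycle X) (hc : Smooth c.src.str)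
    {L : LineBundle c.src.sch} {s : L.Sec} (hs : s.IsRegular) {i : Z ⟶ c.src}
    (hi : s.IsZeroScheme (mor i)) (hi' : IsProper (mor i)) (hZ : Smooth Z.str) :
    ofSmooth (c.addBundle (Pic.of L)) hc - ofSmooth (c.restrict i hi') hZ ∈
      AddSubgroup.closure (relSect X) := by
  have hfin : Fintype (Comp c.src.sch) := @Fintype.ofFinite _ (Comp.finite c.src)
  let j (C : Comp c.src.sch) := clopenSub.ι c.src C.1 C.2.1
  have sq (C : Comp c.src.sch) := fibreProd.isPullback (j C) i
  have hd : IsDisjointCover (W := (c.restrict i hi').src) fun C => fibreProd.snd (j C) i :=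
    (IsDisjointCover.comp c.src hc).of_isPullback sq
  have e1 := @ofSmooth_def _ _ _ (c.addBundle (Pic.of L)) hc hfin
  have e2 := ofSmooth_eq_sum (c.restrict i hi') hZ hd
  refine sub_mem_of_eq_sum (ι := Comp c.src.sch) e1 e2 fun C => AddSubgroup.subset_closure ?_
  have hj : IsProper (mor (fibreProd.fst (j C) i)) := isProper_of_isPullback (sq C).flip hi'
  have : IsOpenImmersion (mor (j C)) := (IsDisjointCover.comp c.src hc).isOpenImmersion C
  have : Smooth (mor (j C)) := SmoothOfRelativeDimension.smooth (f := mor (j C)) 0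
  have hs' : Smooth (fibreProd (j C) i).str :=
    Cycle.smooth_restrict (c.restrict i hi') hZ _ (hd.isProper C) (hd.isOpenImmersion C)
  refine ⟨c.cobComp hc C, LineBundle.pull (mor (j C)) L, s.pull (mor (j C)), fibreProd (j C) i,
    fibreProd.fst (j C) i, hs.pull (mor (j C)), hi.pull _ (sq C), hs', hj, ?_⟩
  refine congrArg₂ (· - ·) ?_ ?_
  · refine of_congr (Cycle.iso_of_eq (congrArg (Cycle.mk _ _ _) ?_))
    exact Multiset.map_cons _ _ _
  · refine ofSmooth_congr ?_ _ _
    have w : fibreProd.snd (j C) i ≫ i = fibreProd.fst (j C) i ≫ j C := QProj.hom_ext (sq C).w.symm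
    have h1 : IsProper (mor (fibreProd.snd (j C) i ≫ i)) := isProper_comp (hd.isProper C) hi'
    have h2 : IsProper (mor (fibreProd.fst (j C) i ≫ j C)) := w ▸ h1
    exact (Cycle.restrict_restrict c i hi' _ (hd.isProper C) h1).trans
      ((Cycle.restrict_congr c _ h1 _ h2 (CategoryTheory.Iso.refl _)
        ((Category.id_comp _).trans w.symm)).trans
        (Cycle.restrict_restrict c (j C) (clopenSub.isProper_ι _ _ _) _ hj h2).symm)

/-- The subgroup generated by the relations on `Z`, pulled back and pushed forward, is imposed. -/
theorem ZCyc.mem_imposed {R : Rel k} {Y : QProj k} {x : ZCyc Z} (hx : x ∈ AddSubgroup.closure (R Z))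
    (f : Y ⟶ X) (hf : IsProper (mor f)) (Ls : List (Pic Y.sch)) (g : Y ⟶ Z)
    (hg : IsSmoothEquidim g) : push f hf (cherns Ls (pull g hg x)) ∈ imposed R X :=
  (show AddSubgroup.closure (R Z) ≤
      (imposed R X).comap ((push f hf).comp ((cherns Ls).comp (pull g hg))) from
    (AddSubgroup.closure_le _).2 fun ρ hρ =>
      AddSubgroup.subset_closure ⟨Y, Z, f, hf, Ls, g, hg, ρ, hρ, rfl⟩) hx

/-- Over the point the smooth morphism of an imposed bivariant relation is `g : pt ⟶ Z`, and its
base change `t : X' ⟶ Z'` takes over the role of the smooth morphism in the relations imposed on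
bordism. -/
theorem OB.toZ_mem_imposed {R : BivRel k} {S : ZCyc.Rel k}
    (h : ∀ {X' Z' Z : QProj k} {t : X' ⟶ Z'} {z : Z' ⟶ Z} {g : pt k ⟶ Z}
      (sq : IsPullback (mor t) (mor (toPt X')) (mor z) (mor g)) (ht : IsSmoothEquidim t) (ρ : OB z),
      ρ ∈ R z → ∃ x ∈ AddSubgroup.closure (S Z'), toZ X' (pull sq ρ) = ZCyc.pull t ht x)
    {x : OB (toPt X)} (hx : x ∈ imposed R (toPt X)) : toZ X x ∈ ZCyc.imposed S X := by
  refine (show imposed R (toPt X) ≤ (ZCyc.imposed S X).comap (toZ X) from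
    (AddSubgroup.closure_le _).2 ?_) hx
  rintro _ ⟨X', Z', Z, f, hf, q, w, t, z, g, sq, hg, Ls, ρ, hρ, rfl⟩
  obtain rfl : toPt X' = q := (toPt_comp f).symm.trans w
  have ht : IsSmoothEquidim t := IsSmoothEquidim.of_isPullback hg sq
  obtain ⟨x, hx, e⟩ := h sq ht ρ hρ
  have e1 : toZ X (push f hf w (cherns (toPt X') Ls (pull sq ρ))) =
      ZCyc.push f hf (ZCyc.cherns Ls (ZCyc.pull t ht x)) := by
    rw [← e, ← toZ_cherns]
    exact toZ_push f hf _
  exact (congrArg (· ∈ ZCyc.imposed S X) e1).mpr (ZCyc.mem_imposed hx f hf Ls t ht)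

theorem OB.toZ_mem_preRel {x : OB (toPt X)} (hx : x ∈ preRel (toPt X)) :
    toZ X x ∈ ZCyc.preRel X := by
  refine (sup_le (fun _ hy => AddSubgroup.mem_sup_left (toZ_mem_imposed ?_ hy))
    (fun _ hy => AddSubgroup.mem_sup_right (toZ_mem_imposed ?_ hy)) :
      preRel (toPt X) ≤ (ZCyc.preRel X).comap (toZ X)) hx
  · rintro X' Z' Z t z g sq ht _ ⟨hZ, hz, Ls, hd, rfl⟩
    -- The pullbacks along the identity and the summand `0` match the form in which `cherns_of`
    -- produces the cycle.
    let c : Cycle Z' := ⟨Z', 𝟙 Z', isProper_id Z', (Ls.map (Pic.pull (mor (𝟙 Z'))) : Multiset _) + 0⟩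
    have hc : Multiset.card c.bundles = Ls.length :=
      (congrArg Multiset.card (add_zero _)).trans (List.length_map _)
    refine ⟨ZCyc.ofSmooth c hZ, ZCyc.ofSmooth_mem_relDim hZ c hZ (by rw [hc]; exact hd), ?_⟩
    refine Eq.trans (congrArg (fun y => toZ X' (pull sq y)) (cherns_of z Ls _)) ?_
    exact toZ_pull_of sq ht c hZ _
  · rintro X' Z' Z t z g sq ht _ ⟨hZ, hz, L, s, V, i, hs, hi, hV, hi', hiz, rfl⟩
    have h1 := ZCyc.ofSmooth_sub_mem_relSect (Cycle.self Z' 0) hZ hs hi hi' hV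
    refine ⟨_, h1, ?_⟩
    rw [map_sub, map_sub, map_sub]
    refine congrArg₂ (· - ·) ?_ ?_
    · refine Eq.trans ?_ (congrArg _ (ZCyc.ofSmooth_congr (c := (Cycle.self Z' 0).chern (Pic.of L))
        (Cycle.iso_of_eq (congrArg (Cycle.mk _ _ _) ?_)) hZ hZ))
      · exact toZ_pull_of sq ht ((Cycle.self Z' 0).chern (Pic.of L)) hZ _
      · exact congrArg (· ::ₘ 0) (Pic.pull_id (Pic.of L))
    · refine Eq.trans (toZ_pull_of sq ht ((Cycle.self V 0).push i hi') hV _)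
        (congrArg _ (ZCyc.ofSmooth_congr ⟨CategoryTheory.Iso.refl _, ?_, rfl⟩ hV hV))
      exact (Category.id_comp (i ≫ 𝟙 Z')).trans ((Category.comp_id i).trans (Category.id_comp i).symm)

end Comparison
end Bordism

namespace Bordism

open QProj

/-! ### The formal group law relations and the comparison isomorphism. -/

section Comparison

variable {k : Type u} [Field k] {X Y Z : QProj k}

theorem OB.toZ_pull_chern {X' : QProj k} {f : X ⟶ Y} {t : X' ⟶ X} {g : pt k ⟶ Y}
    (sq : IsPullback (mor t) (mor (toPt X')) (mor f) (mor g)) (L : Pic X.sch) (x : OB f) :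
    toZ X' (pull sq (chern f L x)) = ZCyc.chern (Pic.pull (mor t) L) (toZ X' (pull sq x)) := by
  rw [pull_chern, toZ_chern]

theorem OB.toZ_pull_chern_iterate {X' : QProj k} {f : X ⟶ Y} {t : X' ⟶ X} {g : pt k ⟶ Y}
    (sq : IsPullback (mor t) (mor (toPt X')) (mor f) (mor g)) (L : Pic X.sch) (n : ℕ) (x : OB f) :
    toZ X' (pull sq ((chern f L)^[n] x)) =
      (ZCyc.chern (Pic.pull (mor t) L))^[n] (toZ X' (pull sq x)) := by
  induction n with
  | zero => rfl
  | succ n ih => rw [Function.iterate_succ_apply', Function.iterate_succ_apply', toZ_pull_chern, ih]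

/-- The relation for `α` becomes the one for the pullback of `α` to `X'`: `X'` is smooth because `t`
is smooth over the smooth `Z'`, and the vanishing bound `N` survives since pullback and `toZ`
respect the earlier relations. -/
theorem OB.imposedFGL_le_ker (X : QProj k) : imposedFGL (toPt X) ≤
    LinearMap.ker (tensorLift (preRel (toPt X)) ((Omega.mk X).comp (toZ X))
      fun _ hx => Omega.mk_eq_zero (toZ_mem_preRel hx)) := by
  refine Submodule.span_le.2 ?_
  rintro _ ⟨X', Z', Z, f, hf, q, w, t, z, g, sq, hg, Ls, _, ⟨hZ, L₁, L₂, α, N, hN, rfl⟩, rfl⟩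
  obtain rfl : toPt X' = q := (toPt_comp f).symm.trans w
  have ht : IsSmoothEquidim t := IsSmoothEquidim.of_isPullback hg sq
  refine (tensorLift_fglDefect _ _ _ _ _ _ _ _ _).trans (sub_eq_zero.2 ?_)
  have e (y : OB z) : toZ X (push f hf w (cherns (toPt X') Ls (pull sq y))) =
      ZCyc.push f hf (ZCyc.cherns Ls (toZ X' (pull sq y))) := by
    rw [← toZ_cherns]
    exact toZ_push f hf _
  have e₁ (i j : ℕ) : toZ X' (pull sq ((chern z L₁)^[i] ((chern z L₂)^[j] α))) =
      (ZCyc.chern (Pic.pull (mor t) L₁))^[i] ((ZCyc.chern (Pic.pull (mor t) L₂))^[j]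
        (toZ X' (pull sq α))) := by
    rw [toZ_pull_chern_iterate, toZ_pull_chern_iterate]
  have h := Omega.fgl (smooth_str_of_smooth ht.smooth hZ) f hf (Pic.pull (mor t) L₁)
    (Pic.pull (mor t) L₂) (toZ X' (pull sq α)) N (fun i j hij => by
      rw [← e₁]
      exact toZ_mem_preRel (pull_mem_preRel sq hg (hN i j hij))) Ls
  refine Eq.trans (Finset.sum_congr rfl fun n _ => Finset.sum_congr rfl fun p _ => ?_)
    (h.trans ?_)
  · exact congrArg (fun y => lazardCoeff p.1 p.2 • Omega.mk X y) ((e _).trans (by rw [e₁]))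
  · rw [← Pic.pull_tensor, ← toZ_pull_chern]
    exact congrArg (Omega.mk X) (e _).symm

/-- The comparison map from `OB1` to algebraic bordism. -/
def OB1Cov.toOmega (X : QProj k) : OB1Cov X →ₗ[Lazard] Omega X :=
  (OB.imposedFGL (toPt X)).liftQ _ (OB.imposedFGL_le_ker X)

theorem OB1Cov.toOmega_mk (x : OB (toPt X)) :
    toOmega X (OB1.mk _ x) = Omega.mk X (OB.toZ X x) :=
  tensorLift_one_tmul (OB.preRel (toPt X)) ((Omega.mk X).comp (OB.toZ X))
    (fun _ hx => Omega.mk_eq_zero (OB.toZ_mem_preRel hx)) x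

/-! ### From algebraic bordism to bivariant cycles -/

theorem MvPolynomial.prod_X_append {σ R : Type*} [CommSemiring R] (l l' : List σ) :
    ((l ++ l').map (MvPolynomial.X (R := R))).prod =
      (l.map MvPolynomial.X).prod * (l'.map MvPolynomial.X).prod := by
  rw [List.map_append, List.prod_append]

theorem OB1.mk_push_cherns_ofCyc (f : Y ⟶ X) (hf : IsProper (mor f)) (Ls : List (Pic Y.sch))
    (c : Cycle Y) (hc : Smooth c.src.str) (l : List (Pic c.src.sch))
    (hl : (l : Multiset (Pic c.src.sch)) = c.bundles) :
    OB1.mk _ (OB.push f hf (toPt_comp f) (OB.cherns _ Ls (OB.ofCyc c hc))) =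
      OB1Cov.push f hf (OB1Cov.push c.map c.isProper (chernPoly hc
        (((Ls.map (Pic.pull (mor c.map))).map MvPolynomial.X).prod *
          (l.map MvPolynomial.X).prod))) := by
  let d : Cycle Y := ⟨c.src, c.map, c.isProper,
    (Ls.map (Pic.pull (mor c.map)) : Multiset _) + c.bundles⟩
  have h1 : OB.cherns _ Ls (OB.ofCyc c hc) = OB.ofCyc d hc := OB.cherns_of _ Ls _
  have h2 : OB1.mk _ (OB.ofCyc d hc) = OB1Cov.push c.map c.isProper (chernPoly hc
      ((Ls.map (Pic.pull (mor c.map)) ++ l).map MvPolynomial.X).prod) :=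
    OB1.mk_ofCyc d hc (Ls.map (Pic.pull (mor c.map)) ++ l) ((Multiset.coe_add _ _).symm.trans
      (congrArg ((Ls.map (Pic.pull (mor c.map)) : Multiset (Pic c.src.sch)) + ·) hl))
  rw [h1, ← OB1.push_mk f hf (toPt_comp f), h2, MvPolynomial.prod_X_append]
  rfl

theorem MvPolynomial.rename_prod_X_mul {σ τ R : Type*} [CommSemiring R] (f : σ → τ)
    (l l' : List σ) : MvPolynomial.rename f ((l.map (MvPolynomial.X (R := R))).prod *
        (l'.map MvPolynomial.X).prod) =
      ((l.map f).map MvPolynomial.X).prod * ((l'.map f).map MvPolynomial.X).prod := by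
  rw [map_mul, rename_prod_X, rename_prod_X]

theorem MvPolynomial.prod_X_mul_cons {σ R : Type*} [CommSemiring R] (a : σ) (l l' : List σ) :
    (l.map (MvPolynomial.X (R := R))).prod * ((a :: l').map MvPolynomial.X).prod =
      MvPolynomial.X a * ((l.map MvPolynomial.X).prod * (l'.map MvPolynomial.X).prod) := by
  rw [List.map_cons, List.prod_cons, mul_left_comm]

/-- The relations of `OB` concern fundamental classes only. Writing a cycle as the pushforward of a
monomial in Chern classes extends the section relation to arbitrary cycles. -/
theorem OB1.mk_push_cherns_addBundle (f : Y ⟶ X) (hf : IsProper (mor f)) (Ls : List (Pic Y.sch))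
    (c : Cycle Y) (hc : Smooth c.src.str) {L : LineBundle c.src.sch} {s : L.Sec} (hs : s.IsRegular)
    {i : Z ⟶ c.src} (hi : s.IsZeroScheme (mor i)) (hi' : IsProper (mor i)) (hZ : Smooth Z.str) :
    OB1.mk _ (OB.push f hf (toPt_comp f) (OB.cherns _ Ls (OB.ofCyc (c.addBundle (Pic.of L)) hc))) =
      OB1.mk _ (OB.push f hf (toPt_comp f) (OB.cherns _ Ls (OB.ofCyc (c.restrict i hi') hZ))) := by
  obtain ⟨l, hl⟩ := Quotient.exists_rep c.bundles
  have h1 := OB1.mk_push_cherns_ofCyc f hf Ls (c.addBundle (Pic.of L)) hc (Pic.of L :: l)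
    (congrArg (Pic.of L ::ₘ ·) hl)
  have h2 := OB1.mk_push_cherns_ofCyc f hf Ls (c.restrict i hi') hZ (l.map (Pic.pull (mor i)))
    ((Multiset.map_coe _ _).symm.trans (congrArg (Multiset.map _) hl))
  have h3 := OB1Cov.push_comp i c.map hi' c.isProper (c.restrict i hi').isProper (chernPoly hZ
    (((Ls.map (Pic.pull (mor (i ≫ c.map)))).map MvPolynomial.X).prod *
      ((l.map (Pic.pull (mor i))).map MvPolynomial.X).prod))
  refine h1.trans (Eq.trans (congrArg (OB1Cov.push f hf) ?_) h2.symm)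
  refine Eq.trans (congrArg (OB1Cov.push c.map c.isProper) ?_) h3.symm
  refine (congrArg (chernPoly hc) (MvPolynomial.prod_X_mul_cons (R := Lazard) (Pic.of L) _ l)).trans
    ((chernPoly_X_mul hc hs hi hi' hZ rfl _).trans (congrArg (OB1Cov.push i hi') (congrArg
      (chernPoly hZ) ((MvPolynomial.rename_prod_X_mul _ _ _).trans ?_))))
  have h4 : (Ls.map (Pic.pull (mor c.map))).map (Pic.pull (mor i)) =
      Ls.map (Pic.pull (mor (i ≫ c.map))) :=
    (List.map_map).trans (List.map_congr_left fun a _ => (Pic.pull_comp _ _ a).symm)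
  rw [← h4]
  rfl

/-- The pullback in `ZCyc` cuts sources into components; by additivity the class in `OB1` does not
notice, so one may compute with the uncut base change. -/
theorem OB1.mk_toOB (f : Y ⟶ X) (hf : IsProper (mor f)) (Ls : List (Pic Y.sch)) (g : Y ⟶ Z)
    (hg : IsSmoothEquidim g) (x : OB (toPt Z)) :
    OB1.mk _ (ZCyc.toOB X (ZCyc.push f hf (ZCyc.cherns Ls (ZCyc.pull g hg (OB.toZ Z x))))) =
      OB1.mk _ (OB.push f hf (toPt_comp f) (OB.cherns _ Ls (OB.spull g hg.smooth x))) := by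
  rw [ZCyc.pull_toZ, ← OB.toZ_cherns, ← OB.toZ_push, OB1.mk_toOB_toZ]

theorem ZCyc.imposed_le_of_mk {R : Rel k} (h : ∀ {Y Z : QProj k} (f : Y ⟶ X) (hf : IsProper (mor f))
    (Ls : List (Pic Y.sch)) (g : Y ⟶ Z) (hg : IsSmoothEquidim g), ∀ ρ ∈ R Z,
      ∃ x, ρ = OB.toZ Z x ∧
        OB1.mk _ (OB.push f hf (toPt_comp f) (OB.cherns _ Ls (OB.spull g hg.smooth x))) = 0)
    {x : ZCyc X} (hx : x ∈ imposed R X) : OB1.mk _ (ZCyc.toOB X x) = 0 := by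
  refine (show imposed R X ≤ ((OB1.mk (toPt X)).comp (ZCyc.toOB X)).ker from
    (AddSubgroup.closure_le _).2 ?_) hx
  rintro _ ⟨Y, Z, f, hf, Ls, g, hg, ρ, hρ, rfl⟩
  obtain ⟨x, rfl, hx⟩ := h f hf Ls g hg ρ hρ
  exact (OB1.mk_toOB f hf Ls g hg x).trans hx

/-- The pullback of a dimension relation may have a source too large for the dimension relation of
`OB`; but its bundles come from the source of the original cycle along a smooth morphism, so
`prod_mem_relIdeal` applies. A transverse section stays transverse under smooth base change, so
section relations go to section relations. -/
theorem OB1.mk_toOB_eq_zero [CharZero k] {x : ZCyc X} (hx : x ∈ ZCyc.preRel X) :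
    OB1.mk _ (ZCyc.toOB X x) = 0 := by
  refine (sup_le (fun _ => ZCyc.imposed_le_of_mk ?_) (fun _ => ZCyc.imposed_le_of_mk ?_) :
    ZCyc.preRel X ≤ ((OB1.mk (toPt X)).comp (ZCyc.toOB X)).ker) hx
  · rintro Y Z f hf Ls g hg _ ⟨hZ, c, hd, rfl⟩
    refine ⟨OB.ofCyc c.1 c.2.1, ((OB.toZ_ofCyc _ _).trans (ZCyc.ofSmooth_eq_of c)).symm, ?_⟩
    obtain ⟨l, hl⟩ := Quotient.exists_rep c.1.bundles
    have hV := Cycle.smooth_baseChange g hg.smooth c.1 c.2.1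
    have hp : Smooth (mor (fibreProd.fst c.1.map g)) :=
      MorphismProperty.of_isPullback (P := @Smooth) (fibreProd.isPullback c.1.map g).flip hg.smooth
    have hl' : l.length = Multiset.card c.1.bundles := congrArg Multiset.card hl
    have h := prod_mem_relIdeal hV c.2.1 (fibreProd.fst c.1.map g) hp l (by rw [hl']; exact hd)
    refine (congrArg (fun y => OB1.mk _ (OB.push f hf (toPt_comp f) (OB.cherns _ Ls y)))
      (OB.spull_of g hg.smooth c.1 c.2.1)).trans ((OB1.mk_push_cherns_ofCyc f hf Ls _ hV
        (l.map (Pic.pull (mor (fibreProd.fst c.1.map g))))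
        ((Multiset.map_coe _ _).symm.trans (congrArg (Multiset.map _) hl))).trans ?_)
    refine (congrArg (fun y => OB1Cov.push f hf (OB1Cov.push _ _ y))
      (chernPoly_eq_zero ((relIdeal hV).mul_mem_left _ h))).trans ?_
    rw [map_zero, map_zero]
  · rintro Y Z f hf Ls g hg _ ⟨c, L, s, V, i, hs, hi, hV, hi', rfl⟩
    refine ⟨OB.ofCyc (c.1.addBundle (Pic.of L)) c.2.1 - OB.ofCyc (c.1.restrict i hi') hV, ?_, ?_⟩
    · refine Eq.trans ?_ (map_sub (OB.toZ Z) _ _).symm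
      exact congrArg₂ (· - ·) ((OB.toZ_ofCyc (c.1.addBundle (Pic.of L)) c.2.1).trans
        (ZCyc.ofSmooth_eq_of ⟨c.1.addBundle (Pic.of L), c.2⟩)).symm (OB.toZ_ofCyc _ hV).symm
    · rw [map_sub, map_sub, map_sub, map_sub, sub_eq_zero]
      have sq := fibreProd.isPullback i (fibreProd.fst c.1.map g)
      have hp : Smooth (mor (fibreProd.fst c.1.map g)) :=
        MorphismProperty.of_isPullback (P := @Smooth) (fibreProd.isPullback c.1.map g).flip hg.smooth
      have hq : Smooth (mor (fibreProd.fst i (fibreProd.fst c.1.map g))) :=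
        MorphismProperty.of_isPullback (P := @Smooth) sq.flip hp
      have hj := isProper_of_isPullback sq hi'
      have h := OB1.mk_push_cherns_addBundle f hf Ls (c.1.baseChange g)
        (Cycle.smooth_baseChange g hg.smooth c.1 c.2.1) (hs.pull (mor (fibreProd.fst c.1.map g)))
        (hi.pull (mor (fibreProd.fst c.1.map g)) sq.flip) hj (smooth_str_of_smooth hq hV)
      refine Eq.trans (congrArg (fun y => OB1.mk _ (OB.push f hf (toPt_comp f) (OB.cherns _ Ls y)))
        ?_) (h.trans (congrArg (fun y => OB1.mk _ (OB.push f hf (toPt_comp f) (OB.cherns _ Ls y)))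
        ?_))
      · refine (OB.spull_of g hg.smooth (c.1.addBundle (Pic.of L)) c.2.1).trans
          (OB.ofCyc_congr (Cycle.iso_of_eq (congrArg (Cycle.mk _ _ _) ?_)) _ _)
        exact Multiset.map_cons _ _ _
      · refine Eq.trans ?_ (OB.spull_of g hg.smooth (c.1.restrict i hi') hV).symm
        exact OB.ofCyc_congr (Cycle.baseChange_restrict g c.1 i hi' sq hj) _ _

/-- Each of the finitely many cycles in `x` has a source of finite dimension, where long products of
Chern classes are dimension relations. So the nilpotence required by the formal group law holds for
every element. -/
theorem OB.exists_cherns_mem_preRel (x : OB (toPt X)) :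
    ∃ N, ∀ Ls : List (Pic X.sch), N ≤ Ls.length → cherns (toPt X) Ls x ∈ preRel (toPt X) := by
  refine OB.induction x ⟨0, fun Ls _ => ?_⟩ (fun c => ?_) (fun c hc => ?_) fun x y hx hy => ?_
  · rw [map_zero]
    exact AddSubgroup.zero_mem _
  · obtain ⟨N, hN⟩ := c.1.src.exists_topologicalKrullDim_lt
    obtain ⟨l, hl⟩ := Quotient.exists_rep c.1.bundles
    have hc := (smooth_toPt_iff c.1).1 c.2
    refine ⟨N, fun Ls hLs => ?_⟩
    have h1 := preRel_le c.1.map c.1.isProper (toPt_comp c.1.map)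
      (relDim_mem_preRel hc (Ls.map (Pic.pull (mor c.1.map)) ++ l) (hN.trans_le (by
        rw [List.length_append, List.length_map]
        exact_mod_cast hLs.trans (Nat.le_add_right _ _))))
    refine (congrArg (· ∈ preRel (toPt X)) ?_).mp h1
    refine Eq.trans ?_ (cherns_of _ Ls c).symm
    have e : ((Ls.map (Pic.pull (mor c.1.map)) ++ l : List (Pic c.1.src.sch)) :
        Multiset (Pic c.1.src.sch)) = (Ls.map (Pic.pull (mor c.1.map)) : Multiset _) + c.1.bundles :=
      (Multiset.coe_add _ _).symm.trans
        (congrArg ((Ls.map (Pic.pull (mor c.1.map)) : Multiset (Pic c.1.src.sch)) + ·) hl)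
    exact (push_ofCyc_self ⟨c.1.src, c.1.map, c.1.isProper,
      (Ls.map (Pic.pull (mor c.1.map)) ++ l : List (Pic c.1.src.sch))⟩ hc).trans
      (of_eq (Cycle.iso_of_eq (congrArg (Cycle.mk c.1.src c.1.map c.1.isProper) e)))
  · obtain ⟨N, hN⟩ := hc
    refine ⟨N, fun Ls hLs => ?_⟩
    rw [map_neg]
    exact AddSubgroup.neg_mem _ (hN Ls hLs)
  · obtain ⟨N, hN⟩ := hx
    obtain ⟨M, hM⟩ := hy
    refine ⟨max N M, fun Ls hLs => ?_⟩
    rw [map_add]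
    exact AddSubgroup.add_mem _ (hN Ls ((le_max_left _ _).trans hLs))
      (hM Ls ((le_max_right _ _).trans hLs))

theorem ZCyc.push_cherns_pull_mem_preRel (f : Y ⟶ X) (hf : IsProper (mor f)) (Ls : List (Pic Y.sch))
    (g : Y ⟶ Z) (hg : IsSmoothEquidim g) {x : ZCyc Z} (hx : x ∈ preRel Z) :
    push f hf (cherns Ls (pull g hg x)) ∈ preRel X :=
  map_mem_preRel (φ := (push f hf).comp ((cherns Ls).comp (pull g hg)))
    (fun _ _ h => push_mem_imposed (cherns_mem_imposed (pull_mem_imposed h g hg) Ls) f hf) hx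

theorem OB.spull_chern_iterate (g : Y ⟶ X) (hg : Smooth (mor g)) (L : Pic X.sch) (n : ℕ)
    (x : OB (toPt X)) : spull g hg ((chern (toPt X) L)^[n] x) =
      (chern (toPt Y) (Pic.pull (mor g) L))^[n] (spull g hg x) := by
  rw [chern_iterate, chern_iterate, spull_cherns, List.map_replicate]

theorem ZCyc.toOB_chern_iterate (L : Pic X.sch) (n : ℕ) (x : ZCyc X) :
    toOB X ((chern L)^[n] x) = (OB.chern (toPt X) L)^[n] (toOB X x) := by
  rw [ZCyc.chern_iterate, OB.chern_iterate, toOB_cherns]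

/-- The bound `N` says that terms vanish in pre-cobordism, which yields their vanishing in `OB1` but
not in the quotient `PreOB` to which the formal group law of `OB1` refers. That law is therefore
used with a bound `N'` of its own, and the two truncations are compared at `max N N'`. -/
theorem ZCyc.imposedFGL_le_ker [CharZero k] (X : QProj k) : imposedFGL X ≤
    LinearMap.ker (tensorLift (preRel X) ((OB1.mk (toPt X)).comp (toOB X))
      fun _ hx => OB1.mk_toOB_eq_zero hx) := by
  refine Submodule.span_le.2 ?_
  rintro _ ⟨Y, W, f, hf, Ls, g, hg, _, ⟨hW, L₁, L₂, α, N, hN, rfl⟩, rfl⟩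
  refine (tensorLift_fglDefect _ _ _ _ _ _ _ _ _).trans (sub_eq_zero.2 ?_)
  have hg' : IsSmoothEquidim g := hg
  let β := OB.spull g hg'.smooth (toOB W α)
  have e (y : ZCyc W) : OB1.mk _ (toOB X (push f hf (cherns Ls (pull g hg y)))) =
      OB1.mk _ (OB.push f hf (toPt_comp f) (OB.cherns _ Ls (OB.spull g hg'.smooth (toOB W y)))) := by
    have h := OB1.mk_toOB f hf Ls g hg' (toOB W y)
    rwa [OB.toZ_toOB] at h
  let φ (i j : ℕ) : OB (toPt Y) := (OB.chern (toPt Y) (Pic.pull (mor g) L₁))^[i]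
    ((OB.chern (toPt Y) (Pic.pull (mor g) L₂))^[j] β)
  have e₁ (i j : ℕ) : OB.spull g hg'.smooth (toOB W ((chern L₁)^[i] ((chern L₂)^[j] α))) = φ i j := by
    rw [toOB_chern_iterate, toOB_chern_iterate, OB.spull_chern_iterate, OB.spull_chern_iterate]
  obtain ⟨N', hN'⟩ := OB.exists_cherns_mem_preRel β
  have h := congrArg (OB1Cov.push f hf) (OB1.fgl (smooth_str_of_smooth hg'.smooth hW)
    (Pic.pull (mor g) L₁) (Pic.pull (mor g) L₂) β (max N N') (fun i j hij => by
      rw [OB.chern_iterate, OB.chern_iterate, ← OB.cherns_append]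
      refine hN' _ ?_
      rw [List.length_append, List.length_replicate, List.length_replicate]
      exact (le_max_right _ _).trans hij) Ls)
  have h0 (i j : ℕ) (hij : N ≤ i + j) : OB1Cov.push f hf (OB1.mk _ (OB.cherns _ Ls (φ i j))) = 0 := by
    rw [← e₁]
    exact (e _).symm.trans (OB1.mk_toOB_eq_zero (push_cherns_pull_mem_preRel f hf Ls g hg (hN i j hij)))
  have e₂ : OB.spull g hg'.smooth (toOB W (chern (L₁.tensor L₂) α)) =
      OB.chern _ ((Pic.pull (mor g) L₁).tensor (Pic.pull (mor g) L₂)) β := by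
    rw [← Pic.pull_tensor, toOB_chern]
    exact OB.spull_cherns g hg'.smooth [L₁.tensor L₂] _
  refine Eq.trans ?_ (h.trans ?_)
  · rw [map_sum]
    simp only [map_sum, map_smul]
    refine Eq.trans (Finset.sum_congr rfl fun n _ => Finset.sum_congr rfl fun p _ =>
      congrArg (lazardCoeff p.1 p.2 • ·) ((e _).trans (congrArg (fun y => OB1.mk _
        (OB.push f hf (toPt_comp f) (OB.cherns _ Ls y))) (e₁ p.1 p.2)))) ?_
    -- The terms between `N` and `max N N'` are images of elements of `ZCyc.preRel`, hence zero in
    -- `OB1`.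
    refine Finset.sum_subset (Finset.range_mono (le_max_left _ _)) fun n _ hn => ?_
    refine Finset.sum_eq_zero fun p hp => ?_
    rw [Finset.mem_range, not_lt, ← Finset.HasAntidiagonal.mem_antidiagonal.1 hp] at hn
    exact (congrArg (lazardCoeff p.1 p.2 • ·) (h0 p.1 p.2 hn)).trans (smul_zero _)
  · exact ((e _).trans (congrArg (fun y => OB1.mk _
        (OB.push f hf (toPt_comp f) (OB.cherns _ Ls y))) e₂)).symm

/-- The comparison map from algebraic bordism to `OB1`. -/
def Omega.toOB1 [CharZero k] (X : QProj k) : Omega X →ₗ[Lazard] OB1Cov X :=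
  (ZCyc.imposedFGL X).liftQ _ (ZCyc.imposedFGL_le_ker X)

theorem Omega.toOB1_mk [CharZero k] (x : ZCyc X) :
    toOB1 X (mk X x) = OB1.mk _ (ZCyc.toOB X x) :=
  tensorLift_one_tmul (ZCyc.preRel X) ((OB1.mk (toPt X)).comp (ZCyc.toOB X))
    (fun _ hx => OB1.mk_toOB_eq_zero hx) x

/-- The comparison isomorphism. -/
def OB1Cov.equivOmega [CharZero k] (X : QProj k) : OB1Cov X ≃ₗ[Lazard] Omega X :=
  LinearEquiv.ofLinearMap (toOmega X) (Omega.toOB1 X)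
    (Omega.hom_ext fun x => by
      rw [LinearMap.comp_apply, Omega.toOB1_mk, toOmega_mk, OB.toZ_toOB, LinearMap.id_apply])
    (OB1.hom_ext fun x => by
      rw [LinearMap.comp_apply, toOmega_mk, Omega.toOB1_mk, OB1.mk_toOB_toZ, LinearMap.id_apply])

theorem OB1Cov.equivOmega_mk [CharZero k] (x : OB (toPt X)) :
    equivOmega X (OB1.mk _ x) = Omega.mk X (OB.toZ X x) := toOmega_mk x

theorem OB1Cov.equivOmega_of [CharZero k] (c : CobCycle X) :
    equivOmega X (OB1.of c.toBiv) = Omega.of c :=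
  (equivOmega_mk (OB.ofCyc c.1 c.2.1)).trans (congrArg (Omega.mk X)
    ((OB.toZ_ofCyc c.1 c.2.1).trans (ZCyc.ofSmooth_eq_of c)))

theorem OB1Cov.equivOmega_push [CharZero k] (f : X ⟶ Y) (hf : IsProper (mor f)) (x : OB1Cov X) :
    equivOmega Y (push f hf x) = Omega.push f hf (equivOmega X x) :=
  LinearMap.congr_fun (f := (equivOmega Y).toLinearMap ∘ₗ push f hf)
    (g := Omega.push f hf ∘ₗ (equivOmega X).toLinearMap) (OB1.hom_ext fun x => by
      change equivOmega Y (OB1.mk _ (OB.push f hf (toPt_comp f) x)) =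
        Omega.push f hf (equivOmega X (OB1.mk _ x))
      rw [equivOmega_mk, equivOmega_mk, Omega.push_mk, OB.toZ_push]) x

end Comparison
end Bordism

end

theorem mainTheorem1 {k : Type u} [Field k] [CharZero k] :
    (∀ (X : Bordism.QProj k) (h : IsProper (Bordism.QProj.mor (𝟙 X))) (x : Bordism.OB1Cov X),
      Bordism.OB1Cov.push (𝟙 X) h x = x) ∧
    (∀ (X Y Z : Bordism.QProj k) (f : X ⟶ Y) (g : Y ⟶ Z)
      (hf : IsProper (Bordism.QProj.mor f)) (hg : IsProper (Bordism.QProj.mor g))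
      (hfg : IsProper (Bordism.QProj.mor (f ≫ g))) (x : Bordism.OB1Cov X),
      Bordism.OB1Cov.push (f ≫ g) hfg x =
        Bordism.OB1Cov.push g hg (Bordism.OB1Cov.push f hf x)) ∧
    ∃ e : ∀ X : Bordism.QProj k, Bordism.OB1Cov X ≃ₗ[Bordism.Lazard] Bordism.Omega X,
      (∀ (X : Bordism.QProj k) (c : Bordism.CobCycle X),
        e X (Bordism.OB1.of c.toBiv) = Bordism.Omega.of c) ∧
      (∀ (X Y : Bordism.QProj k) (f : X ⟶ Y) (hf : IsProper (Bordism.QProj.mor f))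
        (x : Bordism.OB1Cov X),
        e Y (Bordism.OB1Cov.push f hf x) = Bordism.Omega.push f hf (e X x)) :=
  ⟨fun _ h x => Bordism.OB1Cov.push_id h x,
    fun _ _ _ f g hf hg hfg x => Bordism.OB1Cov.push_comp f g hf hg hfg x,
    fun X => Bordism.OB1Cov.equivOmega X,
    fun _ c => Bordism.OB1Cov.equivOmega_of c,
    fun _ _ f hf x => Bordism.OB1Cov.equivOmega_push f hf x⟩
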